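/- Let $U_s:[0,\infty)\to\mathbb R$ be bounded, of class $C^3([0,\infty))$, with $U_s''<0$ on $[0,\infty)$, $\sup_{y\ge 0}(1+y^2)^{3}|U_s''(y)|<\infty$, $\sup_{y\ge 0}|U_s'''(y)/U_s''(y)|<\infty$, $U_s(0)=0$ and $\lim_{y\to\infty}U_s(y)=1$, and put $V_s(y)=y+U_s(y)$. For $\omega:(0,\infty)\to\mathbb C$ write $$\mathcal U[\omega]=\int_0^\infty\omega\,dy,\qquad \mathcal V_y[\omega]=-\int_0^y\int_{y'}^\infty\omega(z)\,dz\,dy',\qquad \mathcal V[\omega]=-\int_0^\infty\int_{y}^\infty\omega(z)\,dz\,dy .$$ Let $H$ be the space of pairs $(\omega,A)$ with $A\in\mathbb C$ and $\omega:(0,\infty)\to\mathbb C$ measurable (modulo equality almost everywhere) such that $$\|(\omega,A)\|_H=\Big(\int_0^\infty (1+y)^6|\omega(y)|^2\,dy+|A|^2\Big)^{1/2}<\infty .$$ There exist positive constants $K_*$, $k_0$, $M$, depending only on $U_s$, such that for every $k\in\mathbb R$ with $|k|\ge k_0$, every $\lambda\in\mathbb C$ with $\operatorname{Re}\lambda\ge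 K_*|k|^{2/3}$ and all data $(\hat\omega_{init},\hat A_{init})\in H$, the system $$(\lambda+ik+ik|k|)\,\hat A=ik\,\mathcal V[\hat\omega]+\hat A_{init},$$ $$(\lambda+ikV_s)\,\hat\omega-ik\,U_s''\,\mathcal V_y[\hat\omega]-\partial_y^2\hat\omega=ik\,U_s''(y)\,y\,\hat A+\hat\omega_{init}\quad\text{on }(0,\infty),$$ $$\mathcal U[\hat\omega]=\hat A,$$ where the second equation is understood in the sense of distributions on $(0,\infty)$, has a unique solution $(\hat\omega,\hat A)\in H$, and this solution satisfies $$\|(\hat\omega,\hat A)\|_H\le M\,|k|^{1/3}\,|\lambda|^{1/4}\,\|(\hat\omega_{init},\hat A_{init})\|_H .$$ -/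

import Mathlib

open MeasureTheory Set Filter Topology

noncomputable section

namespace TripleDeck

/-- The standing assumptions on the bounded part `U = U_s` of the shear flow
`V_s(y) = y + U_s(y)`.  Only the values of `U` on `[0, ∞)` matter; derivatives are one-sided
at `y = 0`.  Here `⟨y⟩ = (1 + y²)^{1/2}`, so that `⟨y⟩⁶ = (1 + y²)³`. -/
structure IsShearProfile (U : ℝ → ℝ) : Prop where
  contDiffOn : ContDiffOn ℝ 3 U (Ici 0)
  bounded : ∃ C : ℝ, ∀ y ∈ Ici (0 : ℝ), |U y| ≤ C
  concave : ∀ y ∈ Ici (0 : ℝ), iteratedDerivWithin 2 U (Ici 0) y < 0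
  decay : ∃ C : ℝ, ∀ y ∈ Ici (0 : ℝ), (1 + y ^ 2) ^ 3 * |iteratedDerivWithin 2 U (Ici 0) y| ≤ C
  ratio : ∃ C : ℝ, ∀ y ∈ Ici (0 : ℝ),
    |iteratedDerivWithin 3 U (Ici 0) y / iteratedDerivWithin 2 U (Ici 0) y| ≤ C
  zero : U 0 = 0
  tendsto_one : Tendsto U atTop (𝓝 1)

/-- The shear flow `V_s(y) = y + U_s(y)`. -/
def shear (U : ℝ → ℝ) (y : ℝ) : ℝ := y + U y

/-- `U_s''` on `[0, ∞)`. -/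
def shearDeriv2 (U : ℝ → ℝ) (y : ℝ) : ℝ := iteratedDerivWithin 2 U (Ici 0) y

/-- The mean `𝒰[ω] = ∫₀^∞ ω`. -/
def meanU (ω : ℝ → ℂ) : ℂ := ∫ y in Ioi (0 : ℝ), ω y

/-- `𝒱_y[ω] = ∫₀^y ∫_∞^{y'} ω = ∫₀^y (- ∫_{y'}^∞ ω) dy'`. -/
def opVy (ω : ℝ → ℂ) (y : ℝ) : ℂ := ∫ y' in (0 : ℝ)..y, -∫ z in Ioi y', ω z

/-- `𝒱[ω] = ∫₀^∞ ∫_∞^y ω = ∫₀^∞ (- ∫_y^∞ ω) dy`. -/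
def opV (ω : ℝ → ℂ) : ℂ := ∫ y in Ioi (0 : ℝ), -∫ z in Ioi y, ω z

/-- `(ω, A)` belongs to `H` (for any `A : ℂ`): `(1+y)³ ω ∈ L²(0, ∞)`. -/
def MemH (ω : ℝ → ℂ) : Prop :=
  MemLp (fun y : ℝ => (((1 + y) ^ 3 : ℝ) : ℂ) * ω y) 2 (volume.restrict (Ioi 0))

/-- The norm `‖(ω, A)‖_H = (‖(1+y)³ ω‖²_{L²(0,∞)} + |A|²)^{1/2}`. -/
def normH (ω : ℝ → ℂ) (A : ℂ) : ℝ :=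
  Real.sqrt ((∫ y in Ioi (0 : ℝ), ‖(((1 + y) ^ 3 : ℝ) : ℂ) * ω y‖ ^ 2) + ‖A‖ ^ 2)

/-- The vorticity equation
`(lam + i k V_s) ω - i k U_s'' 𝒱_y[ω] - ∂_y² ω = i k U_s'' y A + ωi`
in the sense of distributions on the open half-line `(0, ∞)`. -/
def VorticityEq (U : ℝ → ℝ) (k : ℝ) (lam : ℂ) (ωi ω : ℝ → ℂ) (A : ℂ) : Prop :=
  ∀ φ : ℝ → ℝ, ContDiff ℝ ((⊤ : ℕ∞) : WithTop ℕ∞) φ → HasCompactSupport φ → tsupport φ ⊆ Ioi 0 →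
    (∫ y in Ioi (0 : ℝ), φ y • ((lam + Complex.I * k * shear U y) * ω y
        - Complex.I * k * shearDeriv2 U y * opVy ω y))
      - (∫ y in Ioi (0 : ℝ), iteratedDeriv 2 φ y • ω y)
    = ∫ y in Ioi (0 : ℝ), φ y • (Complex.I * k * shearDeriv2 U y * y * A + ωi y)

/-- `(ω, A) ∈ H` solves the Fourier–Laplace transformed vorticity–Benjamin-Ono system with data
`(ωi, Ai)`.  Membership in `H` makes all the integrals below absolutely convergent. -/
structure IsSolution (U : ℝ → ℝ) (k : ℝ) (lam : ℂ) (ωi : ℝ → ℂ) (Ai : ℂ)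
    (ω : ℝ → ℂ) (A : ℂ) : Prop where
  memH : MemH ω
  benjaminOno : (lam + Complex.I * k + Complex.I * k * (|k| : ℝ)) * A
    = Complex.I * k * opV ω + Ai
  vorticity : VorticityEq U k lam ωi ω A
  mean : meanU ω = A

end TripleDeck

end

noncomputable section

namespace TripleDeck

/-! The mean condition `𝒰[ω] = A` plays the role of the missing boundary condition at the wall, so
it is dropped first and restored at the end. Write `v = -U_s''`, so that the vorticity equation
reads `ω'' = (λ + ikV_s) ω + ik v (𝒱_y[ω] + y A) - f`. By Fubini `𝒱_y` is minus the integral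
operator with the real symmetric kernel `min(y, z)`, and `𝒱[ω] = -∫ z ω`. In the weighted space
`L²(dy/v)` paired with the Benjamin–Ono equation, the nonlocal terms and the coupling are therefore
skew-adjoint. The dispersive terms are imaginary, and `|v'| ≤ 2θ v` limits the effect of the weight
on the diffusion, so the reduced system has coercivity constant `Re λ - θ²`, however large `k` is.
Lions' lemma, applied to the adjoint on test functions vanishing near `0`, gives weak solutions with
a bound and no boundary condition (`exists_weak_solution`).

Data in `H` need not lie in `L²(dy/v)`. The local equation is solved first, in the polynomially
weighted space. Its nonlocal residual carries a factor `v`, so it does lie in `L²(dy/v)` and can be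
removed there (`exists_nonlocal_correction`). This costs `|k| / Re λ`, hence the factor `|k|^{1/3}`.

To restore the mean one needs a homogeneous solution `Ω`, with second component `B`, such that `𝒰[Ω]
- B` is bounded away from zero (`exists_homogeneous`). It is a perturbation of the layer `s
e^{-sy}`, `s² = λ`, which has mean `1`. Because `V_s` vanishes linearly at the wall and the layer
has thickness `1/Re s`, all corrections to the mean and to `B` are of size `|k| / (Re λ)^{3/2}`,
which is small exactly when `Re λ ≥ K |k|^{2/3}` with `K` large. Its norm in `H` is of order
`|s|^{1/2} = |λ|^{1/4}`, the second loss in the estimate. Adding a multiple of `Ω` to a reduced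
solution gives existence with the bound (`exists_solution_bound`).

For uniqueness, a weak solution is the decaying double integral of its own right-hand side
(`ae_eq_doubleTail`), hence has a classical representative. An energy argument with weight `1/v`,
regularised to `1/(v + ε)` since `ω ∈ L²(dy/v)` is not known, shows that a homogeneous reduced
solution with `ω'(0) = 0` vanishes (`eq_zero_of_integral_eq_zero`). So homogeneous reduced solutions
form at most a line, spanned by `Ω`, and only zero on that line satisfies the mean condition. -/

/-! ### Abstract solvability from coercivity of the adjoint -/

/-- **Lions' projection lemma**: a coercive lower bound for the formal adjoint yields solvability. -/
theorem exists_weak_solution_of_coercive {D E : Type*} [AddCommGroup D] [Module ℂ D]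
    [NormedAddCommGroup E] [InnerProductSpace ℂ E] [CompleteSpace E]
    (j Q : D →ₗ[ℂ] E) {c : ℝ} (hc : 0 < c)
    (h : ∀ x, c * ‖j x‖ ^ 2 ≤ (inner ℂ (j x) (Q x)).re) (f : E) :
    ∃ u : E, ‖u‖ ≤ ‖f‖ / c ∧ ∀ x, inner ℂ (Q x) u = inner ℂ (j x) f := by
  have hb : ∀ x, ‖j x‖ ≤ ‖Q x‖ / c := by
    intro x
    rw [le_div_iff₀ hc]
    rcases (norm_nonneg (j x)).eq_or_lt with h0 | h0
    · rw [← h0]; simp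
    · have h1 : (inner ℂ (j x) (Q x)).re ≤ ‖j x‖ * ‖Q x‖ :=
        (Complex.re_le_norm _).trans (norm_inner_le_norm _ _)
      have h2 := (h x).trans h1
      have : ‖j x‖ * (‖j x‖ * c) ≤ ‖j x‖ * ‖Q x‖ := by nlinarith
      exact le_of_mul_le_mul_left this h0
  -- A linear section of `Q` over its range defines the functional `Q x ↦ ⟨f, j x⟩`. It is bounded
  -- by `hb`, extended by Hahn–Banach without increase of norm, and represented by Riesz.
  obtain ⟨g, hg⟩ := Q.rangeRestrict.exists_rightInverse_of_surjective
    (LinearMap.range_rangeRestrict Q)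
  have hg' : ∀ y : LinearMap.range Q, Q (g y) = y := fun y => by
    have := LinearMap.congr_fun hg y
    exact congrArg Subtype.val this
  have hfb : ∀ x, ‖inner ℂ f (j x)‖ ≤ ‖f‖ / c * ‖Q x‖ := fun x =>
    (norm_inner_le_norm _ _).trans (by
      calc ‖f‖ * ‖j x‖ ≤ ‖f‖ * (‖Q x‖ / c) := by gcongr; exact hb x
        _ = _ := by ring)
  let ℓ : LinearMap.range Q →ₗ[ℂ] ℂ := (innerₛₗ ℂ f).comp (j.comp g)
  let L : StrongDual ℂ (LinearMap.range Q) := ℓ.mkContinuous (‖f‖ / c) (fun y => by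
    have := hfb (g y)
    rw [hg'] at this
    exact this)
  obtain ⟨G, hG, hGn⟩ := exists_extension_norm_eq (LinearMap.range Q) L
  refine ⟨(InnerProductSpace.toDual ℂ E).symm G, ?_, fun x => ?_⟩
  · rw [LinearIsometryEquiv.norm_map, hGn]
    exact LinearMap.mkContinuous_norm_le _ (by positivity) _
  · rw [← inner_conj_symm, InnerProductSpace.toDual_symm_apply]
    have h1 : G (Q x) = inner ℂ f (j (g ⟨Q x, x, rfl⟩)) := hG ⟨Q x, x, rfl⟩
    -- The section need not return `x` itself, but `j` vanishes on the kernel of `Q` by the same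
    -- bound, so the choice does not matter.
    have h2 : inner ℂ f (j (g ⟨Q x, x, rfl⟩ - x)) = (0 : ℂ) := by
      have := hfb (g ⟨Q x, x, rfl⟩ - x)
      rw [map_sub Q, hg', sub_self, norm_zero, mul_zero] at this
      exact norm_le_zero_iff.mp this
    rw [map_sub, inner_sub_right, sub_eq_zero] at h2
    rw [h1, h2, inner_conj_symm]

/-! ### Square-integrable functions and first moments on the half-line -/

/-- Lebesgue measure on the open half-line. -/
abbrev hl : Measure ℝ := volume.restrict (Ioi 0)

/-- The `L²(0, ∞)` norm. -/
def nrm (f : ℝ → ℂ) : ℝ := (eLpNorm f 2 hl).toReal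

theorem nrm_nonneg (f : ℝ → ℂ) : 0 ≤ nrm f := ENNReal.toReal_nonneg

theorem nrm_add_le {f g : ℝ → ℂ} (hf : MemLp f 2 hl) (hg : MemLp g 2 hl) :
    nrm (fun y => f y + g y) ≤ nrm f + nrm g := by
  unfold nrm
  rw [← ENNReal.toReal_add hf.2.ne hg.2.ne]
  exact ENNReal.toReal_mono (ENNReal.add_ne_top.2 ⟨hf.2.ne, hg.2.ne⟩)
    (eLpNorm_add_le hf.1 hg.1 (by norm_num))

theorem nrm_const_mul (c : ℂ) (f : ℝ → ℂ) : nrm (fun y => c * f y) = ‖c‖ * nrm f := by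
  unfold nrm
  have := eLpNorm_const_smul c f 2 hl
  simp only [Pi.smul_def, smul_eq_mul] at this
  rw [this, ENNReal.toReal_mul]
  simp

theorem nrm_mono {f g : ℝ → ℂ} (hg : MemLp g 2 hl) (h : ∀ y, 0 < y → ‖f y‖ ≤ ‖g y‖) :
    nrm f ≤ nrm g := by
  refine ENNReal.toReal_mono hg.2.ne (eLpNorm_mono_ae ?_)
  filter_upwards [ae_restrict_mem measurableSet_Ioi] with y hy using h y hy

theorem nrm_congr {f g : ℝ → ℂ} (h : f =ᵐ[hl] g) : nrm f = nrm g := by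
  unfold nrm; rw [eLpNorm_congr_ae h]

theorem nrm_sq {f : ℝ → ℂ} (hf : MemLp f 2 hl) : nrm f ^ 2 = ∫ y in Ioi (0 : ℝ), ‖f y‖ ^ 2 := by
  have h := hf.eLpNorm_eq_integral_rpow_norm (by norm_num) (by norm_num)
  have h0 : 0 ≤ ∫ y in Ioi (0 : ℝ), ‖f y‖ ^ (2 : ℝ) := integral_nonneg fun _ => by positivity
  unfold nrm
  rw [h, ENNReal.toReal_ofReal (by positivity)]
  simp only [ENNReal.toReal_ofNat]
  rw [← Real.rpow_natCast, ← Real.rpow_mul h0]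
  norm_num

theorem nrm_le_of_sq {f : ℝ → ℂ} (hf : MemLp f 2 hl) {c : ℝ} (hc : 0 ≤ c)
    (h : ∫ y in Ioi (0 : ℝ), ‖f y‖ ^ 2 ≤ c ^ 2) : nrm f ≤ c := by
  rw [← nrm_sq hf] at h
  exact (sq_le_sq₀ (nrm_nonneg f) hc).1 h

/-- Cauchy–Schwarz on the half-line. -/
theorem integral_mul_le_nrm {f g : ℝ → ℂ} (hf : MemLp f 2 hl) (hg : MemLp g 2 hl) :
    ∫ y in Ioi (0 : ℝ), ‖f y‖ * ‖g y‖ ≤ nrm f * nrm g := by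
  have h := integral_mul_norm_le_Lp_mul_Lq (μ := hl) (f := f) (g := g)
    (p := 2) (q := 2) Real.HolderConjugate.two_two (by simpa using hf) (by simpa using hg)
  refine h.trans (le_of_eq ?_)
  have aux : ∀ {f : ℝ → ℂ}, MemLp f 2 hl →
      (∫ y in Ioi (0 : ℝ), ‖f y‖ ^ (2 : ℝ)) ^ (1 / 2 : ℝ) = nrm f := by
    intro f hf
    rw [← Real.sqrt_eq_rpow]
    simp only [Real.rpow_ofNat]
    rw [← nrm_sq hf, Real.sqrt_sq (nrm_nonneg f)]
  rw [aux hf, aux hg]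

theorem normH_eq {ω : ℝ → ℂ} (h : MemH ω) (A : ℂ) :
    normH ω A = √(nrm (fun y : ℝ => (((1 + y) ^ 3 : ℝ) : ℂ) * ω y) ^ 2 + ‖A‖ ^ 2) := by
  rw [nrm_sq h]; rfl

/-- Finiteness of the first moment on the half-line. -/
def Mom (ω : ℝ → ℂ) : Prop := Integrable (fun z : ℝ => ((1 + z : ℝ) : ℂ) * ω z) hl

/-- The first absolute moment `∫ (1 + z) |ω|`. -/
def mom (ω : ℝ → ℂ) : ℝ := ∫ z in Ioi (0 : ℝ), (1 + z) * ‖ω z‖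

theorem aestronglyMeasurable_of_weight {ω : ℝ → ℂ} {ρ : ℝ → ℝ} (hρ : ∀ y, 0 < y → 0 < ρ y)
    (hc : ContinuousOn ρ (Ioi 0)) (h : AEStronglyMeasurable (fun y => (ρ y : ℂ) * ω y) hl) :
    AEStronglyMeasurable ω hl := by
  have h1 : AEStronglyMeasurable (fun y => (((ρ y)⁻¹ : ℝ) : ℂ)) hl := by
    refine ContinuousOn.aestronglyMeasurable ?_ measurableSet_Ioi
    exact Complex.continuous_ofReal.comp_continuousOn (hc.inv₀ fun y hy => (hρ y hy).ne')
  refine (h1.mul h).congr ?_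
  filter_upwards [ae_restrict_mem measurableSet_Ioi] with y hy
  have := (hρ y hy).ne'
  simp only [Pi.mul_apply, ← mul_assoc, ← Complex.ofReal_mul]
  rw [inv_mul_cancel₀ this]; simp

theorem Mom.aestronglyMeasurable {ω : ℝ → ℂ} (h : Mom ω) : AEStronglyMeasurable ω hl :=
  aestronglyMeasurable_of_weight (ρ := fun y => 1 + y) (fun y hy => by positivity)
    (by fun_prop) h.1

theorem Mom.integrable_of_le {ω η : ℝ → ℂ} (h : Mom ω) (hη : AEStronglyMeasurable η hl)
    {c : ℝ} (hle : ∀ y, 0 < y → ‖η y‖ ≤ c * ((1 + y) * ‖ω y‖)) : Integrable η hl := by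
  refine (Integrable.norm h |>.const_mul c).mono' hη ?_
  filter_upwards [ae_restrict_mem measurableSet_Ioi] with y hy
  have hy' : (0 : ℝ) < y := hy
  refine (hle y hy).trans (le_of_eq ?_)
  rw [norm_mul, Complex.norm_real, Real.norm_of_nonneg (by positivity)]

theorem Mom.integrable {ω : ℝ → ℂ} (h : Mom ω) : Integrable ω hl :=
  h.integrable_of_le h.aestronglyMeasurable (c := 1) fun y hy => by
    nlinarith [norm_nonneg (ω y)]

theorem Mom.integrable_mul {ω : ℝ → ℂ} (h : Mom ω) :
    Integrable (fun z : ℝ => (z : ℂ) * ω z) hl := by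
  refine h.integrable_of_le (c := 1) ?_ fun y hy => ?_
  · exact (Complex.continuous_ofReal.aestronglyMeasurable).mul h.aestronglyMeasurable
  · rw [norm_mul, Complex.norm_real, Real.norm_of_nonneg hy.le]
    nlinarith [norm_nonneg (ω y)]

theorem Mom.integrable_norm {ω : ℝ → ℂ} (h : Mom ω) :
    Integrable (fun z : ℝ => (1 + z) * ‖ω z‖) hl := by
  refine (Integrable.norm h).congr ?_
  filter_upwards [ae_restrict_mem measurableSet_Ioi] with y hy
  have hy' : (0 : ℝ) < y := hy
  rw [norm_mul, Complex.norm_real, Real.norm_of_nonneg (by positivity)]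

theorem mom_nonneg (ω : ℝ → ℂ) : 0 ≤ mom ω :=
  setIntegral_nonneg measurableSet_Ioi fun y hy => by
    have hy' : (0 : ℝ) < y := hy
    positivity

theorem Mom.add {ω η : ℝ → ℂ} (h : Mom ω) (h' : Mom η) : Mom (fun y => ω y + η y) := by
  refine (Integrable.add h h').congr (ae_of_all _ fun y => ?_)
  simp [mul_add]

theorem Mom.const_mul {ω : ℝ → ℂ} (h : Mom ω) (c : ℂ) : Mom (fun y => c * ω y) := by
  refine (Integrable.const_mul h c).congr (ae_of_all _ fun y => ?_)
  simp only; ring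

theorem Mom.conj {ω : ℝ → ℂ} (h : Mom ω) : Mom (fun y => starRingEnd ℂ (ω y)) := by
  refine (Complex.conjCLE.toContinuousLinearMap.integrable_comp h).congr (ae_of_all _ fun y => ?_)
  simp

/-! ### The nonlocal operators as integral operators -/

/-- The symmetric form `-∫ min(y, z) ω(z) dz` of `𝒱_y`. -/
def greenV (ω : ℝ → ℂ) (y : ℝ) : ℂ := -∫ z in Ioi (0 : ℝ), ((min |y| z : ℝ) : ℂ) * ω z

theorem Mom.min_integrable {ω : ℝ → ℂ} (h : Mom ω) (y : ℝ) :
    Integrable (fun z : ℝ => ((min |y| z : ℝ) : ℂ) * ω z) hl := by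
  refine h.integrable_of_le (c := 1) ?_ fun z hz => ?_
  · exact (by fun_prop : Continuous fun z : ℝ => ((min |y| z : ℝ) : ℂ)).aestronglyMeasurable.mul
      h.aestronglyMeasurable
  · rw [norm_mul, Complex.norm_real, Real.norm_of_nonneg (le_min (abs_nonneg _) hz.le)]
    have := min_le_right |y| z
    nlinarith [norm_nonneg (ω z)]

theorem norm_greenV_le_integral {ω : ℝ → ℂ} (h : Mom ω) (y : ℝ) :
    ‖greenV ω y‖ ≤ ∫ z in Ioi (0 : ℝ), ‖(z : ℂ) * ω z‖ := by
  unfold greenV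
  rw [norm_neg]
  refine (norm_integral_le_integral_norm _).trans ?_
  refine setIntegral_mono_on (h.min_integrable y).norm h.integrable_mul.norm measurableSet_Ioi ?_
  intro z hz
  have hz' : (0 : ℝ) < z := hz
  simp only [norm_mul, Complex.norm_real, Real.norm_of_nonneg (le_min (abs_nonneg y) hz'.le),
    Real.norm_of_nonneg hz'.le]
  gcongr
  exact min_le_right _ _

theorem integral_norm_mul_le_mom {ω : ℝ → ℂ} (h : Mom ω) :
    ∫ z in Ioi (0 : ℝ), ‖(z : ℂ) * ω z‖ ≤ mom ω := by
  refine setIntegral_mono_on h.integrable_mul.norm h.integrable_norm measurableSet_Ioi ?_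
  intro z hz
  have hz' : (0 : ℝ) < z := hz
  simp only [norm_mul, Complex.norm_real, Real.norm_of_nonneg hz'.le]
  nlinarith [norm_nonneg (ω z)]

theorem norm_greenV_le {ω : ℝ → ℂ} (h : Mom ω) (y : ℝ) : ‖greenV ω y‖ ≤ mom ω :=
  (norm_greenV_le_integral h y).trans (integral_norm_mul_le_mom h)

theorem norm_meanU_le {ω : ℝ → ℂ} (h : Mom ω) : ‖meanU ω‖ ≤ mom ω := by
  refine (norm_integral_le_integral_norm _).trans ?_
  refine setIntegral_mono_on h.integrable.norm h.integrable_norm measurableSet_Ioi ?_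
  intro z hz
  have hz' : (0 : ℝ) < z := hz
  nlinarith [norm_nonneg (ω z)]

theorem continuous_greenV {ω : ℝ → ℂ} (h : Mom ω) : Continuous (greenV ω) := by
  unfold greenV
  refine (continuous_of_dominated (bound := fun z : ℝ => ‖(z : ℂ) * ω z‖)
    (fun y => (h.min_integrable y).1) (fun y => ?_) h.integrable_mul.norm
    (ae_of_all _ fun z => by fun_prop)).neg
  filter_upwards [ae_restrict_mem measurableSet_Ioi] with z hz
  have hz' : (0 : ℝ) < z := hz
  simp only [norm_mul, Complex.norm_real, Real.norm_of_nonneg (le_min (abs_nonneg y) hz'.le),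
    Real.norm_of_nonneg hz'.le]
  gcongr
  exact min_le_right _ _

theorem greenV_add {ω η : ℝ → ℂ} (h : Mom ω) (h' : Mom η) (y : ℝ) :
    greenV (fun y => ω y + η y) y = greenV ω y + greenV η y := by
  unfold greenV
  simp only [mul_add]
  rw [integral_add (h.min_integrable y) (h'.min_integrable y), neg_add]

theorem greenV_const_mul (ω : ℝ → ℂ) (c : ℂ) (y : ℝ) :
    greenV (fun y => c * ω y) y = c * greenV ω y := by
  unfold greenV
  simp only [mul_left_comm _ c]
  rw [integral_const_mul, mul_neg]

theorem greenV_conj (ω : ℝ → ℂ) (y : ℝ) :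
    greenV (fun y => starRingEnd ℂ (ω y)) y = starRingEnd ℂ (greenV ω y) := by
  unfold greenV
  rw [map_neg, ← integral_conj]
  simp

theorem greenV_congr {ω η : ℝ → ℂ} (h : ω =ᵐ[hl] η) (y : ℝ) : greenV ω y = greenV η y := by
  unfold greenV
  congr 1
  refine integral_congr_ae ?_
  filter_upwards [h] with z hz
  rw [hz]

/-- Fubini: the value `ω z` is counted once for each `y ∈ S` with `y < z`. The choices `S = (0, y]`
and `S = (0, ∞)` produce the kernels `min(y, z)` and `z` of `𝒱_y` and `𝒱`. -/
theorem integral_tail {ω : ℝ → ℂ} (h : Mom ω) {S : Set ℝ} (hS : MeasurableSet S)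
    (hS0 : S ⊆ Ioi 0) :
    ∫ y in S, ∫ z in Ioi y, ω z = ∫ z in Ioi (0 : ℝ), (volume.real (S ∩ Iio z) : ℂ) * ω z := by
  let f : ℝ → ℝ → ℂ := fun y z => (Ioi y).indicator ω z
  have h1 : ∫ y in S, ∫ z in Ioi y, ω z = ∫ y in S, ∫ z in Ioi (0 : ℝ), f y z := by
    refine setIntegral_congr_fun hS fun y hy => ?_
    have : Ioi (0 : ℝ) ∩ Ioi y = Ioi y := inter_eq_right.2 (Ioi_subset_Ioi (le_of_lt (hS0 hy)))
    simp only [f]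
    rw [setIntegral_indicator measurableSet_Ioi, this]
  have hvol : ∀ z : ℝ, 0 < z → volume.real (S ∩ Iio z) ≤ z := fun z hz => by
    have : S ∩ Iio z ⊆ Ioo 0 z := fun x hx => ⟨hS0 hx.1, hx.2⟩
    refine (measureReal_mono this (by simp)).trans ?_
    simp [hz.le]
  have hfin : ∀ z : ℝ, volume (S ∩ Iio z) ≠ ⊤ := fun z => by
    have : S ∩ Iio z ⊆ Ioo 0 z := fun x hx => ⟨hS0 hx.1, hx.2⟩
    exact ((measure_mono this).trans_lt (by simp)).ne
  have hind : ∀ y z, f y z = (Iio z).indicator (fun _ => ω z) y := fun y z => by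
    simp only [f, indicator_apply, mem_Ioi, mem_Iio]
  have hmeas : AEStronglyMeasurable (Function.uncurry f) ((volume.restrict S).prod hl) := by
    have : Function.uncurry f = {p : ℝ × ℝ | p.1 < p.2}.indicator (fun p => ω p.2) := by
      ext ⟨y, z⟩
      simp [f, indicator_apply]
    rw [this]
    refine AEStronglyMeasurable.indicator ?_ (measurableSet_lt measurable_fst measurable_snd)
    exact h.aestronglyMeasurable.comp_snd
  have hint : Integrable (Function.uncurry f) ((volume.restrict S).prod hl) := by
    rw [integrable_prod_iff' hmeas]
    refine ⟨ae_of_all _ fun z => ?_, ?_⟩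
    · simp only [Function.uncurry, hind]
      rw [integrable_indicator_iff measurableSet_Iio]
      refine integrableOn_const ?_
      rw [Measure.restrict_apply measurableSet_Iio, inter_comm]
      exact hfin z
    · have : ∀ z, ∫ y in S, ‖Function.uncurry f (y, z)‖ = volume.real (S ∩ Iio z) * ‖ω z‖ := by
        intro z
        have : ∀ y, ‖Function.uncurry f (y, z)‖ = (Iio z).indicator (fun _ => ‖ω z‖) y := by
          intro y
          simp only [Function.uncurry, hind, norm_indicator_eq_indicator_norm]
        simp only [this]
        rw [setIntegral_indicator measurableSet_Iio, setIntegral_const, smul_eq_mul]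
      simp only [this]
      refine (h.integrable_norm).mono' ?_ ?_
      · have : (fun z => volume.real (S ∩ Iio z) * ‖ω z‖) =
            fun z => ∫ y in S, ‖Function.uncurry f (y, z)‖ := by ext z; rw [this]
        rw [this]
        exact (hmeas.norm.prod_swap).integral_prod_right'
      · filter_upwards [ae_restrict_mem measurableSet_Ioi] with z hz
        have hz' : (0 : ℝ) < z := hz
        rw [norm_mul, norm_norm, Real.norm_of_nonneg measureReal_nonneg]
        gcongr
        linarith [hvol z hz]
  rw [h1, integral_integral_swap hint]
  congr 1
  ext z
  simp only [hind]
  rw [setIntegral_indicator measurableSet_Iio, setIntegral_const, Complex.real_smul]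

theorem opVy_eq {ω : ℝ → ℂ} (h : Mom ω) {y : ℝ} (hy : 0 ≤ y) : opVy ω y = greenV ω y := by
  unfold opVy greenV
  rw [intervalIntegral.integral_neg, intervalIntegral.integral_of_le hy,
    integral_tail h measurableSet_Ioc fun x hx => hx.1]
  congr 1
  refine setIntegral_congr_fun measurableSet_Ioi fun z hz => ?_
  have hz' : (0 : ℝ) < z := hz
  congr 2
  rw [abs_of_nonneg hy]
  rcases le_or_gt z y with hzy | hzy
  · have : Ioc 0 y ∩ Iio z = Ioo 0 z := by
      ext x; simp only [mem_inter_iff, mem_Ioc, mem_Iio, mem_Ioo]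
      constructor
      · rintro ⟨⟨a, b⟩, c⟩; exact ⟨a, c⟩
      · rintro ⟨a, c⟩; exact ⟨⟨a, by linarith⟩, c⟩
    rw [this, min_eq_right hzy]; simp [hz'.le]
  · have : Ioc 0 y ∩ Iio z = Ioc 0 y := by
      ext x; simp only [mem_inter_iff, mem_Ioc, mem_Iio]
      constructor
      · rintro ⟨⟨a, b⟩, c⟩; exact ⟨a, b⟩
      · rintro ⟨a, b⟩; exact ⟨⟨a, b⟩, by linarith⟩
    rw [this, min_eq_left hzy.le]; simp [hy]

theorem opV_eq {ω : ℝ → ℂ} (h : Mom ω) : opV ω = -∫ z in Ioi (0 : ℝ), (z : ℂ) * ω z := by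
  unfold opV
  rw [integral_neg, integral_tail h measurableSet_Ioi Subset.rfl]
  congr 1
  refine setIntegral_congr_fun measurableSet_Ioi fun z hz => ?_
  have hz' : (0 : ℝ) < z := hz
  simp only [Ioi_inter_Iio]
  congr 2
  simp [hz'.le]

theorem norm_opV_le_integral {ω : ℝ → ℂ} (h : Mom ω) :
    ‖opV ω‖ ≤ ∫ z in Ioi (0 : ℝ), ‖(z : ℂ) * ω z‖ := by
  rw [opV_eq h, norm_neg]
  exact norm_integral_le_integral_norm _

theorem opV_add {ω η : ℝ → ℂ} (h : Mom ω) (h' : Mom η) :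
    opV (fun y => ω y + η y) = opV ω + opV η := by
  rw [opV_eq h, opV_eq h', opV_eq (h.add h')]
  simp only [mul_add]
  rw [integral_add h.integrable_mul h'.integrable_mul, neg_add]

theorem opV_const_mul {ω : ℝ → ℂ} (h : Mom ω) (c : ℂ) :
    opV (fun y => c * ω y) = c * opV ω := by
  rw [opV_eq h, opV_eq (h.const_mul c)]
  simp only [mul_left_comm _ c]
  rw [integral_const_mul, mul_neg]

theorem meanU_add {ω η : ℝ → ℂ} (h : Mom ω) (h' : Mom η) :
    meanU (fun y => ω y + η y) = meanU ω + meanU η := integral_add h.integrable h'.integrable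

theorem meanU_const_mul (ω : ℝ → ℂ) (c : ℂ) :
    meanU (fun y => c * ω y) = c * meanU ω := integral_const_mul _ _

/-- The operator `𝒱_y` is symmetric. -/
theorem greenV_symm {ω η : ℝ → ℂ} (h : Mom ω) (h' : Mom η) :
    ∫ y in Ioi (0 : ℝ), greenV ω y * η y = ∫ y in Ioi (0 : ℝ), ω y * greenV η y := by
  have hint : Integrable (Function.uncurry fun y z : ℝ =>
      (((min |y| z : ℝ) : ℂ) * ω z) * η y) (hl.prod hl) := by
    have hm : AEStronglyMeasurable (Function.uncurry fun y z : ℝ =>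
      (((min |y| z : ℝ) : ℂ) * ω z) * η y) (hl.prod hl) := by
      refine AEStronglyMeasurable.mul (AEStronglyMeasurable.mul ?_ ?_) ?_
      · exact (by fun_prop : Continuous fun p : ℝ × ℝ =>
          ((min |p.1| p.2 : ℝ) : ℂ)).aestronglyMeasurable
      · exact h.aestronglyMeasurable.comp_snd
      · exact h'.aestronglyMeasurable.comp_fst
    refine (h'.integrable.mul_prod h.integrable_mul).mono hm ?_
    rw [Measure.prod_restrict]
    filter_upwards [ae_restrict_mem (measurableSet_Ioi.prod measurableSet_Ioi)] with p hp
    have h1 : (0 : ℝ) < p.1 := hp.1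
    have h2 : (0 : ℝ) < p.2 := hp.2
    simp only [Function.uncurry, norm_mul, Complex.norm_real,
      Real.norm_of_nonneg (le_min (abs_nonneg p.1) h2.le), Real.norm_of_nonneg h2.le]
    rw [mul_comm ‖η p.1‖]
    gcongr
    exact min_le_right _ _
  unfold greenV
  simp only [neg_mul, mul_neg, integral_neg]
  congr 1
  simp only [← integral_mul_const, ← integral_const_mul]
  rw [integral_integral_swap hint]
  refine setIntegral_congr_fun measurableSet_Ioi fun y hy => ?_
  refine setIntegral_congr_fun measurableSet_Ioi fun z hz => ?_
  have h1 : (0 : ℝ) < y := hy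
  have h2 : (0 : ℝ) < z := hz
  simp only [abs_of_pos h1, abs_of_pos h2]
  rw [min_comm]; ring

/-! ### Test functions and admissible weights -/

/-- Test functions: complex `C²` functions vanishing outside a compact subset of `(0, ∞)`. -/
def testSpace : Submodule ℂ (ℝ → ℂ) where
  carrier := {χ | ContDiff ℝ 2 χ ∧ ∃ a b : ℝ, 0 < a ∧ ∀ y, y ∉ Icc a b → χ y = 0}
  zero_mem' := ⟨contDiff_const, 1, 1, one_pos, fun _ _ => rfl⟩
  add_mem' := by
    rintro χ χ' ⟨h, a, b, ha, hz⟩ ⟨h', a', b', ha', hz'⟩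
    refine ⟨h.add h', min a a', max b b', lt_min ha ha', fun y hy => ?_⟩
    have h1 : y ∉ Icc a b := fun hh => hy ⟨(min_le_left _ _).trans hh.1, hh.2.trans (le_max_left _ _)⟩
    have h2 : y ∉ Icc a' b' :=
      fun hh => hy ⟨(min_le_right _ _).trans hh.1, hh.2.trans (le_max_right _ _)⟩
    simp [hz y h1, hz' y h2]
  smul_mem' := by
    rintro c χ ⟨h, a, b, ha, hz⟩
    exact ⟨contDiff_const.smul h, a, b, ha, fun y hy => by simp [hz y hy]⟩

theorem eq_zero_of_notMem_Icc {χ : ℝ → ℂ} {a b : ℝ} (h : ∀ y, y ∉ Icc a b → χ y = 0) {y : ℝ}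
    (hy : y ∉ Icc a b) : χ =ᶠ[𝓝 y] 0 := by
  filter_upwards [isClosed_Icc.isOpen_compl.mem_nhds hy] with z hz using h z hz

theorem deriv_eq_zero_of_notMem_Icc {χ : ℝ → ℂ} {a b : ℝ} (h : ∀ y, y ∉ Icc a b → χ y = 0) :
    ∀ y, y ∉ Icc a b → deriv χ y = 0 := fun y hy => by
  rw [(eq_zero_of_notMem_Icc h hy).deriv_eq]; simp

/-- Continuity is asked only on the open half-line because the weights are controlled only there;
the support stays away from `0`. -/
theorem memLp_of_continuousOn_compact {g : ℝ → ℂ} {a b : ℝ} (ha : 0 < a)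
    (hg : ContinuousOn g (Ioi 0)) (h : ∀ y, y ∉ Icc a b → g y = 0) (p : ENNReal) :
    MemLp g p hl := by
  have h1 : g = (Icc a b).indicator g := by
    ext y
    by_cases hy : y ∈ Icc a b
    · rw [indicator_of_mem hy]
    · rw [indicator_of_notMem hy, h y hy]
  have hc : ContinuousOn g (Icc a b) := hg.mono fun y hy => lt_of_lt_of_le ha hy.1
  obtain ⟨C, hC⟩ := isCompact_Icc.exists_bound_of_continuousOn hc
  rw [h1, memLp_indicator_iff_restrict measurableSet_Icc]
  have : IsFiniteMeasure (hl.restrict (Icc a b)) := ⟨by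
    rw [Measure.restrict_apply_univ]
    exact (Measure.restrict_apply_le _ _).trans_lt (by simp)⟩
  refine MemLp.of_bound ?_ C ?_
  · refine AEStronglyMeasurable.mono_measure ?_ (Measure.restrict_mono_measure Measure.restrict_le_self _)
    exact hc.aestronglyMeasurable measurableSet_Icc
  · filter_upwards [ae_restrict_mem measurableSet_Icc] with y hy using hC y hy

/-- Positive `C¹` weights `v` on `(0, ∞)` with `|v'| ≤ 2 θ v` and `v ≤ d² (1 + y)⁻⁶`. -/
structure IsWeight (v : ℝ → ℝ) (θ d : ℝ) : Prop where
  nonneg_d : 0 ≤ d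
  pos : ∀ y, 0 < y → 0 < v y
  hasDeriv : ∃ v' : ℝ → ℝ, ContinuousOn v' (Ioi 0) ∧
    ∀ y, 0 < y → HasDerivAt v (v' y) y ∧ |v' y| ≤ 2 * θ * v y
  bound : ∀ y, 0 < y → v y * (1 + y) ^ 6 ≤ d ^ 2

theorem IsWeight.continuousOn {v : ℝ → ℝ} {θ d : ℝ} (h : IsWeight v θ d) :
    ContinuousOn v (Ioi 0) := by
  obtain ⟨v', -, h'⟩ := h.hasDeriv
  exact fun y hy => (h' y hy).1.continuousAt.continuousWithinAt

/-- `ω / √v`. -/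
def wdiv (v : ℝ → ℝ) (ω : ℝ → ℂ) (y : ℝ) : ℂ := (((√(v y))⁻¹ : ℝ) : ℂ) * ω y

theorem IsWeight.sqrt_le {v : ℝ → ℝ} {θ d : ℝ} (h : IsWeight v θ d) {y : ℝ} (hy : 0 < y) :
    √(v y) * (1 + y) ^ 3 ≤ d := by
  have h1 := h.bound y hy
  have h2 : √(v y) ^ 2 = v y := Real.sq_sqrt (h.pos y hy).le
  refine (sq_le_sq₀ (by positivity) h.nonneg_d).1 ?_
  calc (√(v y) * (1 + y) ^ 3) ^ 2 = √(v y) ^ 2 * (1 + y) ^ 6 := by ring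
    _ ≤ d ^ 2 := by rw [h2]; exact h1

theorem IsWeight.continuousOn_sqrt {v : ℝ → ℝ} {θ d : ℝ} (h : IsWeight v θ d) :
    ContinuousOn (fun y => √(v y)) (Ioi 0) := h.continuousOn.sqrt

theorem IsWeight.continuousOn_sqrt_ofReal {v : ℝ → ℝ} {θ d : ℝ} (h : IsWeight v θ d) :
    ContinuousOn (fun y => ((√(v y) : ℝ) : ℂ)) (Ioi 0) :=
  Complex.continuous_ofReal.comp_continuousOn h.continuousOn_sqrt

theorem IsWeight.aestronglyMeasurable {v : ℝ → ℝ} {θ d : ℝ} (h : IsWeight v θ d) {ω : ℝ → ℂ}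
    (hω : AEStronglyMeasurable (wdiv v ω) hl) : AEStronglyMeasurable ω hl :=
  aestronglyMeasurable_of_weight (ρ := fun y => (√(v y))⁻¹)
    (fun y hy => inv_pos.2 (Real.sqrt_pos.2 (h.pos y hy)))
    (h.continuousOn_sqrt.inv₀ fun y hy => (Real.sqrt_pos.2 (h.pos y hy)).ne') hω

theorem norm_le_of_wdiv {v : ℝ → ℝ} {θ d : ℝ} (h : IsWeight v θ d) (ω : ℝ → ℂ) {y : ℝ}
    (hy : 0 < y) : (1 + y) ^ 3 * ‖ω y‖ ≤ d * ‖wdiv v ω y‖ := by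
  have h1 := h.sqrt_le hy
  have h2 := Real.sqrt_pos.2 (h.pos y hy)
  unfold wdiv
  rw [norm_mul, Complex.norm_real, Real.norm_of_nonneg (inv_nonneg.2 h2.le), ← mul_assoc]
  gcongr
  rw [← div_eq_mul_inv, le_div_iff₀ h2, mul_comm]
  exact h1

/-- The upper bound on `v` embeds `L²(dy/v)` into `H`, with norm at most `d`. -/
theorem memLp_of_wdiv {v : ℝ → ℝ} {θ d : ℝ} (h : IsWeight v θ d) {ω : ℝ → ℂ}
    (hω : MemLp (wdiv v ω) 2 hl) : MemH ω := by
  refine (hω.norm.const_mul d).mono ?_ ?_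
  · exact (by fun_prop : Continuous fun y : ℝ =>
      (((1 + y) ^ 3 : ℝ) : ℂ)).aestronglyMeasurable.mul (h.aestronglyMeasurable hω.1)
  · filter_upwards [ae_restrict_mem measurableSet_Ioi] with y hy
    have hy' : (0 : ℝ) < y := hy
    rw [norm_mul, Complex.norm_real, Real.norm_of_nonneg (by positivity), norm_mul, norm_norm,
      Real.norm_of_nonneg h.nonneg_d]
    exact norm_le_of_wdiv h ω hy

theorem nrm_le_of_wdiv {v : ℝ → ℝ} {θ d : ℝ} (h : IsWeight v θ d) {ω : ℝ → ℂ}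
    (hω : MemLp (wdiv v ω) 2 hl) :
    nrm (fun y : ℝ => (((1 + y) ^ 3 : ℝ) : ℂ) * ω y) ≤ d * nrm (wdiv v ω) := by
  have : d * nrm (wdiv v ω) = nrm (fun y => (d : ℂ) * wdiv v ω y) := by
    rw [nrm_const_mul, Complex.norm_real, Real.norm_of_nonneg h.nonneg_d]
  rw [this]
  refine nrm_mono (hω.const_mul _) fun y hy => ?_
  rw [norm_mul, Complex.norm_real, Real.norm_of_nonneg (by positivity), norm_mul,
    Complex.norm_real, Real.norm_of_nonneg h.nonneg_d]
  exact norm_le_of_wdiv h ω hy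

/-! ### Powers of `1 + y` and the space `H` -/

theorem integral_inv_pow {n : ℕ} (hn : 2 ≤ n) :
    IntegrableOn (fun y : ℝ => ((1 + y) ^ n)⁻¹) (Ioi 0) ∧
    ∫ y in Ioi (0 : ℝ), ((1 + y) ^ n)⁻¹ ≤ 1 := by
  have hn' : (n - 1 : ℝ) ≠ 0 := by
    have : (2 : ℝ) ≤ n := by exact_mod_cast hn
    linarith
  have hn1 : (2 : ℝ) ≤ n := by exact_mod_cast hn
  have hd : ∀ y ∈ Ici (0 : ℝ), HasDerivAt (fun y : ℝ => -((1 + y) ^ (n - 1))⁻¹ / (n - 1))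
      (((1 + y) ^ n)⁻¹) y := by
    intro y hy
    have hy' : (0 : ℝ) ≤ y := hy
    have h0 : (1 + y) ≠ 0 := by positivity
    have h1 := ((((hasDerivAt_id y).const_add 1).fun_pow (n - 1)).inv
      (pow_ne_zero _ h0)).neg.div_const ((n : ℝ) - 1)
    refine h1.congr_deriv ?_
    obtain ⟨m, rfl⟩ : ∃ m, n = m + 2 := ⟨n - 2, by omega⟩
    simp only [id]
    have e : m + 2 - 1 = m + 1 := by omega
    rw [e]
    push_cast at hn' ⊢
    have : (m : ℝ) + 2 - 1 ≠ 0 := hn'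
    field_simp
    ring
  have hlim : Tendsto (fun y : ℝ => -((1 + y) ^ (n - 1))⁻¹ / (n - 1)) atTop (𝓝 0) := by
    have : Tendsto (fun y : ℝ => ((1 + y) ^ (n - 1))⁻¹) atTop (𝓝 0) :=
      tendsto_inv_atTop_zero.comp ((tendsto_pow_atTop (by omega)).comp
        (tendsto_atTop_add_const_left _ 1 tendsto_id))
    simpa using this.neg.div_const ((n : ℝ) - 1)
  have hpos : ∀ y ∈ Ioi (0 : ℝ), 0 ≤ ((1 + y) ^ n)⁻¹ := fun y hy => by
    have hy' : (0 : ℝ) < y := hy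
    positivity
  have hint := integrableOn_Ioi_deriv_of_nonneg' hd hpos hlim
  refine ⟨hint, ?_⟩
  rw [integral_Ioi_of_hasDerivAt_of_tendsto' hd hint hlim]
  simp only [add_zero, one_pow, inv_one, zero_sub, neg_div, neg_neg]
  rw [div_le_one (by linarith)]
  linarith

theorem memLp_inv_pow {n : ℕ} (hn : 1 ≤ n) :
    MemLp (fun y : ℝ => ((((1 + y) ^ n)⁻¹ : ℝ) : ℂ)) 2 hl := by
  have hm : AEStronglyMeasurable (fun y : ℝ => ((((1 + y) ^ n)⁻¹ : ℝ) : ℂ)) hl := by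
    refine ContinuousOn.aestronglyMeasurable ?_ measurableSet_Ioi
    refine Complex.continuous_ofReal.comp_continuousOn (ContinuousOn.inv₀ (by fun_prop) ?_)
    intro y hy
    have hy' : (0 : ℝ) < y := hy
    positivity
  rw [memLp_two_iff_integrable_sq_norm hm]
  refine (integral_inv_pow (n := 2 * n) (by omega)).1.congr (ae_of_all _ fun y => ?_)
  simp only [Complex.norm_real, Real.norm_eq_abs, sq_abs]
  rw [inv_pow, ← pow_mul, mul_comm]

theorem nrm_inv_pow_le {n : ℕ} (hn : 1 ≤ n) :
    nrm (fun y : ℝ => ((((1 + y) ^ n)⁻¹ : ℝ) : ℂ)) ≤ 1 := by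
  refine nrm_le_of_sq (memLp_inv_pow hn) zero_le_one ?_
  rw [one_pow]
  refine le_trans (le_of_eq ?_) (integral_inv_pow (n := 2 * n) (by omega)).2
  refine integral_congr_ae (ae_of_all _ fun y => ?_)
  simp only [Complex.norm_real, Real.norm_eq_abs, sq_abs]
  rw [inv_pow, ← pow_mul, mul_comm]

theorem MemH.aestronglyMeasurable {ω : ℝ → ℂ} (h : MemH ω) : AEStronglyMeasurable ω hl :=
  aestronglyMeasurable_of_weight (ρ := fun y => (1 + y) ^ 3) (fun y hy => by positivity)
    (by fun_prop) h.1

theorem MemH.mul_eq (ω : ℝ → ℂ) {y : ℝ} (hy : 0 < y) :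
    (1 + y) * ‖ω y‖ = ‖((((1 + y) ^ 2)⁻¹ : ℝ) : ℂ)‖ * ‖(((1 + y) ^ 3 : ℝ) : ℂ) * ω y‖ := by
  rw [norm_mul, Complex.norm_real, Complex.norm_real, Real.norm_of_nonneg (by positivity),
    Real.norm_of_nonneg (by positivity)]
  field_simp

/-- Cauchy–Schwarz for `(1 + y)|ω| = (1 + y)⁻² · (1 + y)³|ω|`. All integrals in the system converge
absolutely because of this. -/
theorem MemH.mom {ω : ℝ → ℂ} (h : MemH ω) : Mom ω := by
  have h1 := (memLp_inv_pow (n := 2) (by norm_num)).norm.integrable_mul h.norm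
  refine h1.mono' ?_ ?_
  · exact (by fun_prop : Continuous fun y : ℝ =>
      ((1 + y : ℝ) : ℂ)).aestronglyMeasurable.mul h.aestronglyMeasurable
  · filter_upwards [ae_restrict_mem measurableSet_Ioi] with y hy
    have hy' : (0 : ℝ) < y := hy
    rw [norm_mul, Complex.norm_real, Real.norm_of_nonneg (by positivity), MemH.mul_eq ω hy']
    rfl

theorem MemH.mom_le {ω : ℝ → ℂ} (h : MemH ω) :
    TripleDeck.mom ω ≤ nrm (fun y : ℝ => (((1 + y) ^ 3 : ℝ) : ℂ) * ω y) := by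
  unfold TripleDeck.mom
  rw [setIntegral_congr_fun measurableSet_Ioi fun y hy => MemH.mul_eq ω hy]
  refine (integral_mul_le_nrm (memLp_inv_pow (by norm_num)) h).trans ?_
  exact mul_le_of_le_one_left (nrm_nonneg _) (nrm_inv_pow_le (by norm_num))

theorem MemH.add {ω η : ℝ → ℂ} (h : MemH ω) (h' : MemH η) : MemH (fun y => ω y + η y) := by
  refine (MemLp.add h h').ae_eq (ae_of_all _ fun y => ?_)
  simp [mul_add]

theorem MemH.const_mul {ω : ℝ → ℂ} (h : MemH ω) (c : ℂ) : MemH (fun y => c * ω y) := by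
  refine (MemLp.const_mul h c).ae_eq (ae_of_all _ fun y => ?_)
  simp only; ring

/-! ### The formal adjoint and its coercivity -/

theorem testSpace_regular {χ : ℝ → ℂ} (hχ : ContDiff ℝ 2 χ) :
    Differentiable ℝ χ ∧ Differentiable ℝ (deriv χ) ∧ Continuous (deriv (deriv χ)) := by
  have h1 : ContDiff ℝ (1 + 1) χ := by simpa [one_add_one_eq_two] using hχ
  obtain ⟨h2, -, h3⟩ := contDiff_succ_iff_deriv.1 h1
  exact ⟨h2, (h3.differentiable one_ne_zero), h3.continuous_deriv le_rfl⟩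

theorem memLp_mul_test {χ : ℝ → ℂ}
    (hχ : χ ∈ testSpace) {w : ℝ → ℝ} (hw : ContinuousOn w (Ioi 0)) (p : ENNReal) :
    MemLp (fun y => (w y : ℂ) * χ y) p hl := by
  obtain ⟨hc, a, b, ha, hz⟩ := hχ
  refine memLp_of_continuousOn_compact ha (b := b) ?_ (fun y hy => by simp [hz y hy]) p
  exact (Complex.continuous_ofReal.comp_continuousOn hw).mul hc.continuous.continuousOn

theorem IsWeight.mom_mul {v : ℝ → ℝ} {θ d : ℝ} (h : IsWeight v θ d) {χ : ℝ → ℂ}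
    (hχ : χ ∈ testSpace) : Mom (fun y => (v y : ℂ) * χ y) := by
  have h1 : ContinuousOn (fun y => (1 + y) * v y) (Ioi 0) :=
    (by fun_prop : ContinuousOn (fun y : ℝ => 1 + y) (Ioi 0)).mul h.continuousOn
  refine ((memLp_one_iff_integrable).1 (memLp_mul_test hχ h1 1)).congr (ae_of_all _ fun y => ?_)
  push_cast; ring

/-- The first component of the formal adjoint of the system. -/
def adj (V : ℝ → ℝ) (k : ℝ) (lam : ℂ) (κ : ℝ) (v : ℝ → ℝ) (χ : ℝ → ℂ) (D : ℂ) (y : ℝ) : ℂ :=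
  (starRingEnd ℂ lam - Complex.I * k * V y) * χ y - deriv (deriv χ) y
    - Complex.I * κ * (greenV (fun z => (v z : ℂ) * χ z) y + y * D)

/-- The second component of the formal adjoint of the system. -/
def adjA (Lam : ℂ) (κ : ℝ) (v : ℝ → ℝ) (χ : ℝ → ℂ) (D : ℂ) : ℂ :=
  starRingEnd ℂ Lam * D - Complex.I * κ * ∫ y in Ioi (0 : ℝ), (y : ℂ) * ((v y : ℂ) * χ y)

theorem adj_add {V : ℝ → ℝ} {k : ℝ} {lam : ℂ} {κ : ℝ} {v : ℝ → ℝ} {θ d : ℝ} (h : IsWeight v θ d)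
    {χ χ' : ℝ → ℂ} (hχ : χ ∈ testSpace) (hχ' : χ' ∈ testSpace) (D D' : ℂ) (y : ℝ) :
    adj V k lam κ v (χ + χ') (D + D') y = adj V k lam κ v χ D y + adj V k lam κ v χ' D' y := by
  obtain ⟨a1, a2, -⟩ := testSpace_regular hχ.1
  obtain ⟨b1, b2, -⟩ := testSpace_regular hχ'.1
  have e1 : deriv (χ + χ') = deriv χ + deriv χ' := by
    ext y; exact deriv_add (a1 y) (b1 y)
  have e2 : deriv (deriv χ + deriv χ') y = deriv (deriv χ) y + deriv (deriv χ') y :=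
    deriv_add (a2 y) (b2 y)
  have e3 := greenV_add (h.mom_mul hχ) (h.mom_mul hχ') y
  have e4 : (fun z => (v z : ℂ) * (χ + χ') z) = fun z => (v z : ℂ) * χ z + (v z : ℂ) * χ' z := by
    ext z; simp [mul_add]
  unfold adj
  rw [e1, e2, e4, e3, Pi.add_apply]
  ring

theorem adj_smul {V : ℝ → ℝ} {k : ℝ} {lam : ℂ} {κ : ℝ} {v : ℝ → ℝ}
    {χ : ℝ → ℂ} (hχ : χ ∈ testSpace) (D : ℂ) (c : ℂ) (y : ℝ) :
    adj V k lam κ v (c • χ) (c * D) y = c * adj V k lam κ v χ D y := by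
  obtain ⟨a1, a2, -⟩ := testSpace_regular hχ.1
  have e1 : deriv (c • χ) = c • deriv χ := by
    ext y; exact deriv_const_smul c (a1 y)
  have e3 := greenV_const_mul (fun z => (v z : ℂ) * χ z) c y
  have e4 : (fun z => (v z : ℂ) * (c • χ) z) = fun z => c * ((v z : ℂ) * χ z) := by
    ext z; simp; ring
  have e2 : deriv (c • deriv χ) y = c * deriv (deriv χ) y :=
    deriv_const_smul c (a2 y)
  unfold adj
  rw [e1, e2, e4, e3, Pi.smul_apply, smul_eq_mul]
  ring

theorem adjA_add {Lam : ℂ} {κ : ℝ} {v : ℝ → ℝ} {θ d : ℝ} (h : IsWeight v θ d)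
    {χ χ' : ℝ → ℂ} (hχ : χ ∈ testSpace) (hχ' : χ' ∈ testSpace) (D D' : ℂ) :
    adjA Lam κ v (χ + χ') (D + D') = adjA Lam κ v χ D + adjA Lam κ v χ' D' := by
  unfold adjA
  have := integral_add (h.mom_mul hχ).integrable_mul (h.mom_mul hχ').integrable_mul
  simp only [Pi.add_apply, mul_add] at this ⊢
  rw [this]; ring

theorem adjA_smul {Lam : ℂ} {κ : ℝ} {v : ℝ → ℝ} {χ : ℝ → ℂ} (D : ℂ) (c : ℂ) :
    adjA Lam κ v (c • χ) (c * D) = c * adjA Lam κ v χ D := by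
  unfold adjA
  have e4 : (fun z : ℝ => (z : ℂ) * ((v z : ℂ) * (c • χ) z)) =
      fun z : ℝ => c * ((z : ℂ) * ((v z : ℂ) * χ z)) := by
    ext z; simp; ring
  rw [e4, integral_const_mul]
  ring

theorem IsWeight.memLp_local {v : ℝ → ℝ} {θ d : ℝ} (h : IsWeight v θ d)
    {V : ℝ → ℝ} (hV : ContinuousOn V (Ioi 0)) {χ : ℝ → ℂ} (hχ : χ ∈ testSpace) (c c' : ℂ) :
    MemLp (fun y => ((√(v y) : ℝ) : ℂ) * ((c - c' * V y) * χ y - deriv (deriv χ) y)) 2 hl := by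
  obtain ⟨hc, a, b, ha, hz⟩ := hχ
  obtain ⟨-, -, h3⟩ := testSpace_regular hc
  refine memLp_of_continuousOn_compact ha (b := b) ?_ (fun y hy => ?_) 2
  · refine h.continuousOn_sqrt_ofReal.mul (ContinuousOn.sub (ContinuousOn.mul ?_
      hc.continuous.continuousOn) h3.continuousOn)
    exact continuousOn_const.sub (continuousOn_const.mul
      (Complex.continuous_ofReal.comp_continuousOn hV))
  · rw [hz y hy, deriv_eq_zero_of_notMem_Icc (deriv_eq_zero_of_notMem_Icc hz) y hy]
    simp

/-- Since `√v ≤ d (1 + y)⁻³`, a linearly growing factor still leaves `(1 + y)⁻²`. This handles the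
nonlocal part of the adjoint, which is not compactly supported even for a compactly supported test
function. -/
theorem IsWeight.memLp_sqrt_mul {v : ℝ → ℝ} {θ d : ℝ} (h : IsWeight v θ d) {g : ℝ → ℂ}
    (hg : Continuous g) {C : ℝ} (hC : ∀ y, 0 < y → ‖g y‖ ≤ C * (1 + y)) :
    MemLp (fun y => ((√(v y) : ℝ) : ℂ) * g y) 2 hl := by
  refine ((memLp_inv_pow (n := 2) (by norm_num)).const_mul ((d * C : ℝ) : ℂ)).mono ?_ ?_
  · exact (h.continuousOn_sqrt_ofReal.mul hg.continuousOn).aestronglyMeasurable measurableSet_Ioi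
  · filter_upwards [ae_restrict_mem measurableSet_Ioi] with y hy
    have hy' : (0 : ℝ) < y := hy
    have h1 := h.sqrt_le hy'
    have h2 := hC y hy'
    have hC0 : 0 ≤ C := by
      have := (norm_nonneg _).trans h2
      exact nonneg_of_mul_nonneg_left this (by positivity)
    simp only [norm_mul, Complex.norm_real, Complex.ofReal_mul,
      Real.norm_of_nonneg (Real.sqrt_nonneg (v y))]
    rw [Real.norm_of_nonneg h.nonneg_d, Real.norm_of_nonneg hC0, Real.norm_of_nonneg (by positivity)]
    calc √(v y) * ‖g y‖ ≤ √(v y) * (C * (1 + y)) := by gcongr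
      _ = (√(v y) * (1 + y) ^ 3) * C * ((1 + y) ^ 2)⁻¹ := by field_simp
      _ ≤ d * C * ((1 + y) ^ 2)⁻¹ := by gcongr

theorem IsWeight.memLp_adj {v : ℝ → ℝ} {θ d : ℝ} (h : IsWeight v θ d)
    {V : ℝ → ℝ} (hV : ContinuousOn V (Ioi 0)) {χ : ℝ → ℂ} (hχ : χ ∈ testSpace) (D : ℂ)
    (k : ℝ) (lam : ℂ) (κ : ℝ) :
    MemLp (fun y => ((√(v y) : ℝ) : ℂ) * adj V k lam κ v χ D y) 2 hl := by
  have h1 := h.memLp_local hV hχ (starRingEnd ℂ lam) (Complex.I * k)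
  have hm := h.mom_mul hχ
  have h2 := h.memLp_sqrt_mul (g := fun y : ℝ => -(Complex.I * κ *
      (greenV (fun z => (v z : ℂ) * χ z) y + y * D)))
    (by have := continuous_greenV hm; fun_prop)
    (C := |κ| * (mom (fun z => (v z : ℂ) * χ z) + ‖D‖)) (fun y hy => by
      rw [norm_neg, norm_mul, norm_mul, Complex.norm_I, one_mul, Complex.norm_real,
        Real.norm_eq_abs, mul_assoc]
      gcongr
      refine (norm_add_le _ _).trans ?_
      rw [norm_mul, Complex.norm_real, Real.norm_of_nonneg hy.le]
      have := norm_greenV_le hm y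
      have := mom_nonneg (fun z => (v z : ℂ) * χ z)
      nlinarith [norm_nonneg D])
  refine (h1.add h2).ae_eq (ae_of_all _ fun y => ?_)
  simp only [adj, Pi.add_apply]
  ring

theorem integral_deriv_test {F : Type*} [NormedAddCommGroup F] [NormedSpace ℝ F]
    [CompleteSpace F] {P P' : ℝ → F} {a b : ℝ} (ha : 0 < a)
    (hz : ∀ y, y ∉ Icc a b → P y = 0) (hd : ∀ y, 0 < y → HasDerivAt P (P' y) y)
    (hi : IntegrableOn P' (Ioi 0)) : ∫ y in Ioi (0 : ℝ), P' y = 0 := by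
  have h0 : P =ᶠ[𝓝 0] 0 := by
    filter_upwards [Iio_mem_nhds ha] with y hy
    exact hz y fun h => absurd h.1 (not_le.2 hy)
  have h1 : Tendsto P atTop (𝓝 0) := by
    refine tendsto_const_nhds.congr' ?_
    filter_upwards [eventually_gt_atTop b] with y hy
    exact (hz y fun h => absurd h.2 (not_le.2 hy)).symm
  have hc : ContinuousAt P 0 := continuousAt_const.congr h0.symm
  have := integral_Ioi_of_hasDerivAt_of_tendsto hc.continuousWithinAt hd hi h1
  rw [this, Filter.EventuallyEq.eq_of_nhds h0]; simp

/-- Coercivity of the local part of the adjoint operator. -/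
theorem local_coercive {v : ℝ → ℝ} {θ d : ℝ} (h : IsWeight v θ d)
    {V : ℝ → ℝ} (hV : ContinuousOn V (Ioi 0)) {χ : ℝ → ℂ} (hχ : χ ∈ testSpace)
    (k : ℝ) (lam : ℂ) :
    (lam.re - θ ^ 2) * ∫ y in Ioi (0 : ℝ), v y * ‖χ y‖ ^ 2 ≤
      (∫ y in Ioi (0 : ℝ), starRingEnd ℂ (χ y) * (v y * ((starRingEnd ℂ lam
        - Complex.I * k * V y) * χ y - deriv (deriv χ) y))).re := by
  obtain ⟨hc, a, b, ha, hz⟩ := hχ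
  obtain ⟨d1, d2, c3⟩ := testSpace_regular hc
  obtain ⟨v', hv'c, hv'⟩ := h.hasDeriv
  have hz1 := deriv_eq_zero_of_notMem_Icc hz
  have hz2 := deriv_eq_zero_of_notMem_Icc hz1
  have hvC : ContinuousOn (fun y => ((v y : ℝ) : ℂ)) (Ioi 0) :=
    Complex.continuous_ofReal.comp_continuousOn h.continuousOn
  have hVC : ContinuousOn (fun y => ((V y : ℝ) : ℂ)) (Ioi 0) :=
    Complex.continuous_ofReal.comp_continuousOn hV
  have hint : Integrable (fun y => starRingEnd ℂ (χ y) * (v y * ((starRingEnd ℂ lam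
        - Complex.I * k * V y) * χ y - deriv (deriv χ) y))) hl := by
    refine memLp_one_iff_integrable.1 (memLp_of_continuousOn_compact ha (b := b) ?_ (fun y hy => ?_) 1)
    · refine (Complex.continuous_conj.comp hc.continuous).continuousOn.mul (hvC.mul ?_)
      exact ((continuousOn_const.sub (continuousOn_const.mul hVC)).mul
        hc.continuous.continuousOn).sub c3.continuousOn
    · simp [hz y hy]
  -- the total derivative
  let P : ℝ → ℝ := fun y => v y * (deriv χ y * starRingEnd ℂ (χ y)).re
  let P' : ℝ → ℝ := fun y => v' y * (deriv χ y * starRingEnd ℂ (χ y)).re + v y *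
    (deriv (deriv χ) y * starRingEnd ℂ (χ y) + deriv χ y * starRingEnd ℂ (deriv χ y)).re
  have hP : ∀ y, 0 < y → HasDerivAt P (P' y) y := fun y hy => by
    have e1 : HasDerivAt (fun y => starRingEnd ℂ (χ y)) (starRingEnd ℂ (deriv χ y)) y :=
      Complex.conjCLE.toContinuousLinearMap.hasFDerivAt.comp_hasDerivAt y (d1 y).hasDerivAt
    have e2 := (d2 y).hasDerivAt.fun_mul e1
    have e3 := Complex.reCLM.hasFDerivAt.comp_hasDerivAt y e2
    exact (hv' y hy).1.mul e3
  have hPi : IntegrableOn P' (Ioi 0) := by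
    have hd1 : Continuous (deriv χ) := d2.continuous
    have hχc := hc.continuous
    have : ContinuousOn (fun y => (P' y : ℂ)) (Ioi 0) := by
      refine Complex.continuous_ofReal.comp_continuousOn ((hv'c.mul ?_).add (h.continuousOn.mul ?_))
      · exact (Complex.continuous_re.comp (hd1.mul (Complex.continuous_conj.comp hχc))).continuousOn
      · exact (Complex.continuous_re.comp ((c3.mul (Complex.continuous_conj.comp hχc)).add
          (hd1.mul (Complex.continuous_conj.comp hd1)))).continuousOn
    have := memLp_one_iff_integrable.1 (memLp_of_continuousOn_compact ha (b := b) this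
      (fun y hy => by simp [P', hz y hy, hz1 y hy]) 1)
    exact this.re
  have hP0 : ∫ y in Ioi (0 : ℝ), P' y = 0 :=
    integral_deriv_test ha (b := b) (fun y hy => by simp [P, hz y hy]) hP hPi
  have hint2 : Integrable (fun y => v y * ‖χ y‖ ^ 2) hl := by
    have : ContinuousOn (fun y => ((v y * ‖χ y‖ ^ 2 : ℝ) : ℂ)) (Ioi 0) := by
      refine Complex.continuous_ofReal.comp_continuousOn (h.continuousOn.mul ?_)
      exact (hc.continuous.norm.pow 2).continuousOn
    exact (memLp_one_iff_integrable.1 (memLp_of_continuousOn_compact ha (b := b) this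
      (fun y hy => by simp [hz y hy]) 1)).re
  have hre : (∫ y in Ioi (0 : ℝ), starRingEnd ℂ (χ y) * (v y * ((starRingEnd ℂ lam
        - Complex.I * k * V y) * χ y - deriv (deriv χ) y))).re =
      ∫ y in Ioi (0 : ℝ), (starRingEnd ℂ (χ y) * (v y * ((starRingEnd ℂ lam
        - Complex.I * k * V y) * χ y - deriv (deriv χ) y))).re :=
    (integral_re hint).symm
  rw [hre, ← integral_const_mul]
  refine le_of_le_of_eq ?_ ((integral_add hint.re hPi).trans (by rw [hP0, add_zero]; rfl))
  refine setIntegral_mono_on (hint2.const_mul _) (hint.re.add hPi) measurableSet_Ioi ?_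
  intro y hy
  have hv0 := h.pos y hy
  have hv1 := (hv' y hy).2
  have hn : ‖χ y‖ ^ 2 = (χ y).re ^ 2 + (χ y).im ^ 2 := by
    rw [← Complex.normSq_eq_norm_sq, Complex.normSq_apply]; ring
  simp only [P', Complex.mul_re, Complex.add_re, Complex.conj_re, Complex.conj_im, hn]
  set p := (χ y).re
  set q := (χ y).im
  set p1 := (deriv χ y).re
  set q1 := (deriv χ y).im
  -- Young's inequality with `|v'| ≤ 2θ v`: the term `v |χ'|²` is exactly the one gained from
  -- integrating `-χ''` by parts, and `θ² v |χ|²` is the loss in the coercivity constant.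
  have hmix : |v' y * (p1 * p + q1 * q)| ≤ v y * (p1 ^ 2 + q1 ^ 2) + θ ^ 2 * v y * (p ^ 2 + q ^ 2) := by
    rw [abs_mul]
    have h1 : |v' y| * |p1 * p + q1 * q| ≤ 2 * θ * v y * |p1 * p + q1 * q| := by gcongr
    refine h1.trans ?_
    rcases abs_cases (p1 * p + q1 * q) with ⟨e, -⟩ | ⟨e, -⟩ <;> rw [e]
    · nlinarith [mul_nonneg hv0.le (sq_nonneg (p1 - θ * p)), mul_nonneg hv0.le (sq_nonneg (q1 - θ * q))]
    · nlinarith [mul_nonneg hv0.le (sq_nonneg (p1 + θ * p)), mul_nonneg hv0.le (sq_nonneg (q1 + θ * q))]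
  have := (abs_le.1 hmix).1
  simp only [RCLike.re_to_complex, Complex.mul_re, Complex.conj_re, Complex.conj_im,
    Complex.ofReal_re, Complex.ofReal_im, Complex.sub_re, Complex.sub_im, Complex.mul_im,
    Complex.I_re, Complex.I_im]
  nlinarith

theorem IsWeight.sqrt_mul_sqrt {v : ℝ → ℝ} {θ d : ℝ} (h : IsWeight v θ d) {y : ℝ} (hy : 0 < y) :
    ((√(v y) : ℝ) : ℂ) * ((√(v y) : ℝ) : ℂ) = (v y : ℂ) := by
  rw [← Complex.ofReal_mul, Real.mul_self_sqrt (h.pos y hy).le]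

theorem Mom.integrable_mul_bounded {ω g : ℝ → ℂ} (h : Mom ω) (hg : AEStronglyMeasurable g hl)
    {C : ℝ} (hC : ∀ y, 0 < y → ‖g y‖ ≤ C * (1 + y)) : Integrable (fun y => g y * ω y) hl := by
  refine h.integrable_of_le (c := C) (hg.mul h.aestronglyMeasurable) fun y hy => ?_
  rw [norm_mul, ← mul_assoc]
  gcongr
  exact hC y hy

theorem Mom.integrable_greenV {ω η : ℝ → ℂ} (h : Mom ω) (h' : Mom η) :
    Integrable (fun y => greenV η y * ω y) hl :=
  h.integrable_mul_bounded (continuous_greenV h').aestronglyMeasurable (C := mom η) fun y hy =>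
    (norm_greenV_le h' y).trans (by nlinarith [mom_nonneg η])

/-- Coercivity of the full adjoint operator: the nonlocal terms are skew. -/
theorem adj_coercive {v : ℝ → ℝ} {θ d : ℝ} (h : IsWeight v θ d)
    {V : ℝ → ℝ} (hV : ContinuousOn V (Ioi 0)) {χ : ℝ → ℂ} (hχ : χ ∈ testSpace) (D : ℂ)
    (k : ℝ) {lam Lam : ℂ} (hLam : lam.re ≤ Lam.re) (κ : ℝ) :
    (lam.re - θ ^ 2) * ((∫ y in Ioi (0 : ℝ), v y * ‖χ y‖ ^ 2) + ‖D‖ ^ 2) ≤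
      ((∫ y in Ioi (0 : ℝ), starRingEnd ℂ (χ y) * (v y * adj V k lam κ v χ D y))
        + starRingEnd ℂ D * adjA Lam κ v χ D).re := by
  set η : ℝ → ℂ := fun y => (v y : ℂ) * χ y with hη
  have hm : Mom η := h.mom_mul hχ
  have hmc : Mom (fun y => starRingEnd ℂ (η y)) := hm.conj
  have hL := local_coercive h hV hχ k lam
  set L := ∫ y in Ioi (0 : ℝ), starRingEnd ℂ (χ y) * (v y * ((starRingEnd ℂ lam
        - Complex.I * k * V y) * χ y - deriv (deriv χ) y)) with hLdef
  set S := ∫ y in Ioi (0 : ℝ), greenV η y * starRingEnd ℂ (η y) with hS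
  set T := ∫ y in Ioi (0 : ℝ), (y : ℂ) * η y with hT
  have hLi : Integrable (fun y => starRingEnd ℂ (χ y) * (v y * ((starRingEnd ℂ lam
        - Complex.I * k * V y) * χ y - deriv (deriv χ) y))) hl := by
    have h1 := h.memLp_local hV hχ (starRingEnd ℂ lam) (Complex.I * k)
    have h2 := (memLp_mul_test hχ h.continuousOn_sqrt 2).star
    refine (h2.integrable_mul h1).congr ?_
    filter_upwards [ae_restrict_mem measurableSet_Ioi] with y hy
    have := h.sqrt_mul_sqrt hy
    simp only [Pi.mul_apply, Pi.star_apply, star_mul', RCLike.star_def, Complex.conj_ofReal]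
    rw [← this]
    ring
  have hTc : ∫ y in Ioi (0 : ℝ), (y : ℂ) * starRingEnd ℂ (η y) = starRingEnd ℂ T := by
    rw [hT, ← integral_conj]; simp
  -- The kernel is real and symmetric, so the quadratic form is real and `iκS` has no real part.
  have hSr : starRingEnd ℂ S = S := by
    have e1 : starRingEnd ℂ S = ∫ y in Ioi (0 : ℝ), greenV (fun z => starRingEnd ℂ (η z)) y * η y := by
      rw [hS, ← integral_conj]; simp [greenV_conj]
    rw [e1, greenV_symm hmc hm, hS]
    simp only [mul_comm]
  have hsplit : ∫ y in Ioi (0 : ℝ), starRingEnd ℂ (χ y) * (v y * adj V k lam κ v χ D y) =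
      L - Complex.I * κ * (S + D * starRingEnd ℂ T) := by
    have e : ∀ y, starRingEnd ℂ (χ y) * (v y * adj V k lam κ v χ D y) =
        starRingEnd ℂ (χ y) * (v y * ((starRingEnd ℂ lam
        - Complex.I * k * V y) * χ y - deriv (deriv χ) y)) - Complex.I * κ *
        (greenV η y * starRingEnd ℂ (η y) + D * ((y : ℂ) * starRingEnd ℂ (η y))) := fun y => by
      simp only [adj, hη, map_mul, Complex.conj_ofReal]; ring
    simp only [e]
    have hI : Integrable (fun y => greenV η y * starRingEnd ℂ (η y)
        + D * ((y : ℂ) * starRingEnd ℂ (η y))) hl :=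
      (hmc.integrable_greenV hm).add (hmc.integrable_mul.const_mul D)
    rw [integral_sub hLi (hI.const_mul _), integral_const_mul,
      integral_add (hmc.integrable_greenV hm) (hmc.integrable_mul.const_mul D),
      integral_const_mul, hTc]
  have hSim : S.im = 0 := Complex.conj_eq_iff_im.1 hSr
  rw [hsplit]
  -- The two coupling terms are `-iκ D T̄` and `-iκ D̄ T`, whose sum `-2iκ Re(D T̄)` is imaginary.
  have hA : adjA Lam κ v χ D = starRingEnd ℂ Lam * D - Complex.I * κ * T := rfl
  rw [hA]
  have hn : ‖D‖ ^ 2 = D.re ^ 2 + D.im ^ 2 := by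
    rw [← Complex.normSq_eq_norm_sq, Complex.normSq_apply]; ring
  simp only [Complex.mul_re, Complex.add_re, Complex.conj_re, Complex.conj_im,
    Complex.ofReal_re, Complex.ofReal_im, Complex.sub_re, Complex.sub_im, Complex.mul_im,
    Complex.I_re, Complex.I_im, Complex.add_im, hSim, hn] at hL ⊢
  have h2 : θ ^ 2 * (D.re ^ 2 + D.im ^ 2) ≥ 0 := by positivity
  have h3 : (Lam.re - lam.re) * (D.re ^ 2 + D.im ^ 2) ≥ 0 :=
    mul_nonneg (by linarith) (by positivity)
  nlinarith

/-! ### Weak solutions of the reduced system -/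

/-- A family of square-integrable functions depending linearly on a parameter. -/
def mkLp {D : Type*} [AddCommGroup D] [Module ℂ D] (F : D → ℝ → ℂ)
    (hF : ∀ x, MemLp (F x) 2 hl) (hadd : ∀ x x' y, F (x + x') y = F x y + F x' y)
    (hsmul : ∀ (c : ℂ) x y, F (c • x) y = c * F x y) : D →ₗ[ℂ] Lp ℂ 2 hl where
  toFun x := (hF x).toLp (F x)
  map_add' x x' := by
    rw [← MemLp.toLp_add]
    exact MemLp.toLp_congr _ _ (ae_of_all _ fun y => hadd x x' y)
  map_smul' c x := by
    rw [RingHom.id_apply, ← MemLp.toLp_const_smul]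
    exact MemLp.toLp_congr _ _ (ae_of_all _ fun y => hsmul c x y)

theorem inner_toLp {f g : ℝ → ℂ} (hf : MemLp f 2 hl) (u : Lp ℂ 2 hl) (hg : u =ᵐ[hl] g) :
    inner ℂ (hf.toLp f) u = ∫ y in Ioi (0 : ℝ), starRingEnd ℂ (f y) * g y := by
  rw [L2.inner_def]
  refine integral_congr_ae ?_
  filter_upwards [hf.coeFn_toLp, hg] with y h1 h2
  rw [h1, h2, RCLike.inner_apply, mul_comm]

/-- Lions' lemma in `L² × ℂ` with `j (χ, D) = (√v χ, D)` and `Q` the adjoint with the same factor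
`√v`. The vector found is `(ω/√v, A)`, so its norm is that of `L²(dy/v) × ℂ`. Test functions vanish
near the wall, hence no boundary condition is selected. -/
theorem exists_adjoint_solution {v : ℝ → ℝ} {θ d : ℝ} (h : IsWeight v θ d)
    {V : ℝ → ℝ} (hV : ContinuousOn V (Ioi 0)) (k : ℝ) {lam Lam : ℂ} (hc : θ ^ 2 < lam.re)
    (hLam : lam.re ≤ Lam.re) (κ : ℝ) {f : ℝ → ℂ} (hf : MemLp (wdiv v f) 2 hl) (a : ℂ) :
    ∃ (ω : ℝ → ℂ) (A : ℂ), MemLp (wdiv v ω) 2 hl ∧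
      √(nrm (wdiv v ω) ^ 2 + ‖A‖ ^ 2) ≤ √(nrm (wdiv v f) ^ 2 + ‖a‖ ^ 2) / (lam.re - θ ^ 2) ∧
      ∀ χ ∈ testSpace, ∀ D : ℂ,
        (∫ y in Ioi (0 : ℝ), starRingEnd ℂ (adj V k lam κ v χ D y) * ω y)
          + starRingEnd ℂ (adjA Lam κ v χ D) * A =
        (∫ y in Ioi (0 : ℝ), starRingEnd ℂ (χ y) * f y) + starRingEnd ℂ D * a := by
  let j1 : testSpace × ℂ →ₗ[ℂ] Lp ℂ 2 hl :=
    mkLp (fun x y => ((√(v y) : ℝ) : ℂ) * x.1.1 y)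
      (fun x => memLp_mul_test x.1.2 h.continuousOn_sqrt 2)
      (fun x x' y => by simp [mul_add]) (fun c x y => by simp; ring)
  let q1 : testSpace × ℂ →ₗ[ℂ] Lp ℂ 2 hl :=
    mkLp (fun x y => ((√(v y) : ℝ) : ℂ) * adj V k lam κ v x.1.1 x.2 y)
      (fun x => h.memLp_adj hV x.1.2 x.2 k lam κ)
      (fun x x' y => by
        have := adj_add (V := V) (k := k) (lam := lam) (κ := κ) h x.1.2 x'.1.2 x.2 x'.2 y
        simp only [Prod.fst_add, Submodule.coe_add, Prod.snd_add]
        rw [this, mul_add])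
      (fun c x y => by
        have := adj_smul (V := V) (k := k) (lam := lam) (κ := κ) (v := v) x.1.2 x.2 c y
        simp only [Prod.smul_fst, Submodule.coe_smul, Prod.smul_snd, smul_eq_mul]
        rw [this]; ring)
  let q2 : testSpace × ℂ →ₗ[ℂ] ℂ :=
    { toFun := fun x => adjA Lam κ v x.1.1 x.2
      map_add' := fun x x' => adjA_add h x.1.2 x'.1.2 x.2 x'.2
      map_smul' := fun c x => adjA_smul x.2 c }
  let j : testSpace × ℂ →ₗ[ℂ] WithLp 2 (Lp ℂ 2 hl × ℂ) :=
    (WithLp.linearEquiv 2 ℂ (Lp ℂ 2 hl × ℂ)).symm.toLinearMap ∘ₗ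
      (j1.prod (LinearMap.snd ℂ testSpace ℂ))
  let Q : testSpace × ℂ →ₗ[ℂ] WithLp 2 (Lp ℂ 2 hl × ℂ) :=
    (WithLp.linearEquiv 2 ℂ (Lp ℂ 2 hl × ℂ)).symm.toLinearMap ∘ₗ (q1.prod q2)
  have hj1 : ∀ x : testSpace × ℂ, ‖j1 x‖ ^ 2 = ∫ y in Ioi (0 : ℝ), v y * ‖x.1.1 y‖ ^ 2 := fun x => by
    have hm := memLp_mul_test x.1.2 h.continuousOn_sqrt 2
    have : ‖j1 x‖ = nrm (fun y => ((√(v y) : ℝ) : ℂ) * x.1.1 y) := Lp.norm_toLp _ hm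
    rw [this, nrm_sq hm]
    refine setIntegral_congr_fun measurableSet_Ioi fun y hy => ?_
    simp only [norm_mul, mul_pow, Complex.norm_real, Real.norm_eq_abs, sq_abs]
    rw [Real.sq_sqrt (h.pos y hy).le]
  have hQ : ∀ x, Q x = WithLp.toLp 2 (q1 x, q2 x) := fun x => by simp [Q]
  have hcoer : ∀ x, (lam.re - θ ^ 2) * ‖j x‖ ^ 2 ≤ (inner ℂ (j x) (Q x)).re := fun x => by
    have hm := memLp_mul_test x.1.2 h.continuousOn_sqrt 2
    have e1 : ‖j x‖ ^ 2 = (∫ y in Ioi (0 : ℝ), v y * ‖x.1.1 y‖ ^ 2) + ‖x.2‖ ^ 2 := by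
      rw [WithLp.prod_norm_sq_eq_of_L2, ← hj1]; rfl
    have e2 : inner ℂ (j x) (Q x) = inner ℂ (j1 x) (q1 x) + inner ℂ x.2 (q2 x) := by
      rw [hQ, WithLp.prod_inner_apply]; rfl
    have e3 : inner ℂ (j1 x) (q1 x) =
        ∫ y in Ioi (0 : ℝ), starRingEnd ℂ (x.1.1 y) * (v y * adj V k lam κ v x.1.1 x.2 y) := by
      have := inner_toLp hm (q1 x) (h.memLp_adj hV x.1.2 x.2 k lam κ).coeFn_toLp
      refine this.trans (setIntegral_congr_fun measurableSet_Ioi fun y hy => ?_)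
      simp only [map_mul, Complex.conj_ofReal]
      rw [← h.sqrt_mul_sqrt hy]; ring
    rw [e1, e2, e3, RCLike.inner_apply, mul_comm (q2 x)]
    exact adj_coercive h hV x.1.2 x.2 k hLam κ
  obtain ⟨u, hu, hweak⟩ := exists_weak_solution_of_coercive j Q (sub_pos.2 hc) hcoer
    (WithLp.toLp 2 (hf.toLp _, a))
  let ω : ℝ → ℂ := fun y => ((√(v y) : ℝ) : ℂ) * u.fst y
  have hω : (u.fst : ℝ → ℂ) =ᵐ[hl] wdiv v ω := by
    filter_upwards [ae_restrict_mem measurableSet_Ioi] with y hy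
    have := (Real.sqrt_pos.2 (h.pos y hy)).ne'
    simp only [wdiv, ω]
    rw [← mul_assoc, ← Complex.ofReal_mul, inv_mul_cancel₀ this]; simp
  have hωm : MemLp (wdiv v ω) 2 hl := (Lp.memLp u.fst).ae_eq hω
  refine ⟨ω, u.snd, hωm, ?_, fun χ hχ D => ?_⟩
  · have e1 : ‖u‖ = √(nrm (wdiv v ω) ^ 2 + ‖u.snd‖ ^ 2) := by
      rw [WithLp.prod_norm_eq_of_L2, ← nrm_congr hω]; rfl
    have e2 : ‖(WithLp.toLp 2 (hf.toLp _, a) : WithLp 2 (Lp ℂ 2 hl × ℂ))‖ =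
        √(nrm (wdiv v f) ^ 2 + ‖a‖ ^ 2) := by
      rw [WithLp.prod_norm_eq_of_L2]
      simp only [WithLp.toLp_fst, WithLp.toLp_snd, Lp.norm_toLp]; rfl
    rw [← e1, ← e2]; exact hu
  · have hx := hweak (⟨χ, hχ⟩, D)
    have e1 : inner ℂ (Q (⟨χ, hχ⟩, D)) u = inner ℂ (q1 (⟨χ, hχ⟩, D)) u.fst
        + inner ℂ (adjA Lam κ v χ D) u.snd := by
      rw [hQ, WithLp.prod_inner_apply]; rfl
    have e2 : inner ℂ (j (⟨χ, hχ⟩, D)) (WithLp.toLp 2 (hf.toLp _, a)) =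
        inner ℂ (j1 (⟨χ, hχ⟩, D)) (hf.toLp _) + inner ℂ D a := by
      rw [WithLp.prod_inner_apply]; rfl
    have e3 : inner ℂ (q1 (⟨χ, hχ⟩, D)) u.fst =
        ∫ y in Ioi (0 : ℝ), starRingEnd ℂ (adj V k lam κ v χ D y) * ω y := by
      refine (inner_toLp (h.memLp_adj hV hχ D k lam κ) u.fst (EventuallyEq.refl _ _)).trans ?_
      refine setIntegral_congr_fun measurableSet_Ioi fun y hy => ?_
      simp only [map_mul, Complex.conj_ofReal, ω]; ring
    have e4 : inner ℂ (j1 (⟨χ, hχ⟩, D)) (hf.toLp _) =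
        ∫ y in Ioi (0 : ℝ), starRingEnd ℂ (χ y) * f y := by
      refine (inner_toLp (memLp_mul_test hχ h.continuousOn_sqrt 2) _ hf.coeFn_toLp).trans ?_
      refine setIntegral_congr_fun measurableSet_Ioi fun y hy => ?_
      have : ((√(v y) : ℝ) : ℂ) ≠ 0 :=
        Complex.ofReal_ne_zero.2 (Real.sqrt_pos.2 (h.pos y hy)).ne'
      simp only [map_mul, Complex.conj_ofReal, wdiv, Complex.ofReal_inv]
      field_simp
    rw [e1, e2, e3, e4, RCLike.inner_apply, RCLike.inner_apply] at hx
    rw [mul_comm (starRingEnd ℂ (adjA Lam κ v χ D)), mul_comm (starRingEnd ℂ D)]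
    exact hx

/-- Smooth real test functions on `(0, ∞)`. -/
structure IsTest (φ : ℝ → ℝ) : Prop where
  contDiff : ContDiff ℝ ((⊤ : ℕ∞) : WithTop ℕ∞) φ
  compact : HasCompactSupport φ
  supp : tsupport φ ⊆ Ioi 0

theorem IsTest.exists_Icc {φ : ℝ → ℝ} (h : IsTest φ) :
    ∃ a b : ℝ, 0 < a ∧ ∀ y, y ∉ Icc a b → φ y = 0 := by
  rcases (tsupport φ).eq_empty_or_nonempty with h0 | hne
  · exact ⟨1, 1, one_pos, fun y _ => image_eq_zero_of_notMem_tsupport (by simp [h0])⟩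
  · obtain ⟨a, ha⟩ := h.compact.exists_isLeast hne
    obtain ⟨b, hb⟩ := h.compact.exists_isGreatest hne
    exact ⟨a, b, h.supp ha.1, fun y hy => image_eq_zero_of_notMem_tsupport fun hy' =>
      hy ⟨ha.2 hy', hb.2 hy'⟩⟩

theorem IsTest.hasDerivAt {φ : ℝ → ℝ} (h : IsTest φ) (y : ℝ) : HasDerivAt φ (deriv φ y) y :=
  ((h.contDiff.differentiable (by simp)) y).hasDerivAt

theorem IsTest.deriv {φ : ℝ → ℝ} (h : IsTest φ) : IsTest (deriv φ) :=
  ⟨((contDiff_succ_iff_deriv (n := ((⊤ : ℕ∞) : WithTop ℕ∞))).1 (by simpa using h.contDiff)).2.2,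
    h.compact.deriv, tsupport_deriv_subset.trans h.supp⟩

theorem iteratedDeriv_two (φ : ℝ → ℝ) : iteratedDeriv 2 φ = _root_.deriv (_root_.deriv φ) := by
  rw [iteratedDeriv_succ, iteratedDeriv_one]

theorem IsTest.mem_testSpace {φ : ℝ → ℝ} (h : IsTest φ) : (fun y => (φ y : ℂ)) ∈ testSpace := by
  obtain ⟨a, b, ha, hz⟩ := h.exists_Icc
  refine ⟨Complex.ofRealCLM.contDiff.comp (contDiff_infty.1 h.contDiff 2), a, b, ha,
    fun y hy => by simp [hz y hy]⟩

theorem IsTest.deriv_ofReal {φ : ℝ → ℝ} (h : IsTest φ) :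
    _root_.deriv (_root_.deriv fun y => (φ y : ℂ)) = fun y => ((iteratedDeriv 2 φ y : ℝ) : ℂ) := by
  have e1 : (_root_.deriv fun y => (φ y : ℂ)) = fun y => ((_root_.deriv φ y : ℝ) : ℂ) := by
    ext y; exact (h.hasDerivAt y).ofReal_comp.deriv
  rw [e1, iteratedDeriv_two]
  ext y; exact (h.deriv.hasDerivAt y).ofReal_comp.deriv

theorem IsTest.integrable_mul {φ : ℝ → ℝ} (h : IsTest φ) {g : ℝ → ℂ}
    (hg : ContinuousOn g (Ioi 0)) {ω : ℝ → ℂ} (hω : Mom ω) :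
    Integrable (fun y => (φ y : ℂ) * (g y * ω y)) hl := by
  obtain ⟨a, b, ha, hz⟩ := h.exists_Icc
  have hc : ContinuousOn (fun y => (φ y : ℂ) * g y) (Ioi 0) :=
    (Complex.continuous_ofReal.comp h.contDiff.continuous).continuousOn.mul hg
  obtain ⟨C, hC⟩ := isCompact_Icc.exists_bound_of_continuousOn
    (hc.mono fun y (hy : y ∈ Icc a b) => lt_of_lt_of_le ha hy.1)
  refine (hω.integrable_mul_bounded (hc.aestronglyMeasurable measurableSet_Ioi) (C := |C|)
    fun y hy => ?_).congr (ae_of_all _ fun y => by simp only; ring)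
  by_cases hy' : y ∈ Icc a b
  · have := (hC y hy').trans (le_abs_self C)
    nlinarith [abs_nonneg C]
  · rw [hz y hy']; simp; positivity

theorem IsTest.integrable {φ : ℝ → ℝ} (h : IsTest φ) {ω : ℝ → ℂ} (hω : Mom ω) :
    Integrable (fun y => (φ y : ℂ) * ω y) hl := by
  simpa using h.integrable_mul (g := fun _ => 1) continuousOn_const hω

/-- The right-hand side of `ω'' = …` in the vorticity system with nonlocal weight `v`. -/
def sysRhs (V : ℝ → ℝ) (k : ℝ) (lam : ℂ) (κ : ℝ) (v : ℝ → ℝ) (f ω : ℝ → ℂ) (A : ℂ) (y : ℝ) : ℂ :=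
  (lam + Complex.I * k * V y) * ω y + Complex.I * κ * (v y * (greenV ω y + y * A)) - f y

/-- Distributional form of `ω'' = sysRhs` on `(0, ∞)`. -/
def WeakEq (V : ℝ → ℝ) (k : ℝ) (lam : ℂ) (κ : ℝ) (v : ℝ → ℝ) (f ω : ℝ → ℂ) (A : ℂ) : Prop :=
  ∀ φ : ℝ → ℝ, IsTest φ → ∫ y in Ioi (0 : ℝ), (φ y : ℂ) * sysRhs V k lam κ v f ω A y =
    ∫ y in Ioi (0 : ℝ), ((iteratedDeriv 2 φ y : ℝ) : ℂ) * ω y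

theorem IsTest.integrable_sysRhs {φ : ℝ → ℝ} (hφ : IsTest φ) {V v : ℝ → ℝ}
    (hV : ContinuousOn V (Ioi 0)) (hv : ContinuousOn v (Ioi 0)) {f ω : ℝ → ℂ} (hf : Mom f)
    (hω : Mom ω) (k : ℝ) (lam : ℂ) (κ : ℝ) (A : ℂ) :
    Integrable (fun y => (φ y : ℂ) * sysRhs V k lam κ v f ω A y) hl := by
  have h1 := hφ.integrable_mul (g := fun y => lam + Complex.I * k * V y)
    (continuousOn_const.add (continuousOn_const.mul
      (Complex.continuous_ofReal.comp_continuousOn hV))) hω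
  obtain ⟨a, b, ha, hz⟩ := hφ.exists_Icc
  have h2 : Integrable (fun y => (φ y : ℂ) * (Complex.I * κ * (v y * (greenV ω y + y * A)))) hl := by
    refine memLp_one_iff_integrable.1 (memLp_of_continuousOn_compact ha (b := b) ?_
      (fun y hy => by simp [hz y hy]) 1)
    have := continuous_greenV hω
    have hvC := Complex.continuous_ofReal.comp_continuousOn hv
    exact (Complex.continuous_ofReal.comp hφ.contDiff.continuous).continuousOn.mul
      (continuousOn_const.mul (hvC.mul (by fun_prop)))
  refine ((h1.add h2).sub (hφ.integrable hf)).congr (ae_of_all _ fun y => ?_)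
  simp only [sysRhs, Pi.add_apply, Pi.sub_apply]; ring

/-- Weak solvability of the vorticity system in the weighted space, with the resolvent bound. -/
theorem exists_weak_solution {v : ℝ → ℝ} {θ d : ℝ} (h : IsWeight v θ d)
    {V : ℝ → ℝ} (hV : ContinuousOn V (Ioi 0)) (k : ℝ) {lam Lam : ℂ} (hc : θ ^ 2 < lam.re)
    (hLam : lam.re ≤ Lam.re) (κ : ℝ) {f : ℝ → ℂ} (hf : MemLp (wdiv v f) 2 hl) (a : ℂ) :
    ∃ (ω : ℝ → ℂ) (A : ℂ), MemLp (wdiv v ω) 2 hl ∧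
      √(nrm (wdiv v ω) ^ 2 + ‖A‖ ^ 2) ≤ √(nrm (wdiv v f) ^ 2 + ‖a‖ ^ 2) / (lam.re - θ ^ 2) ∧
      WeakEq V k lam κ v f ω A ∧ Lam * A = Complex.I * κ * opV ω + a := by
  obtain ⟨ω, A, hω, hn, hw⟩ := exists_adjoint_solution h hV k hc hLam κ hf a
  have hm : Mom ω := (memLp_of_wdiv h hω).mom
  have hfm : Mom f := (memLp_of_wdiv h hf).mom
  refine ⟨ω, A, hω, hn, fun φ hφ => ?_, ?_⟩
  -- Testing with `D = 0` isolates the vorticity equation; the symmetry of the kernel moves the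
  -- nonlocal operator from `vφ` to `ω`.
  · have hx := hw _ hφ.mem_testSpace 0
    have hmφ := h.mom_mul hφ.mem_testSpace
    set η : ℝ → ℂ := fun y => (v y : ℂ) * (φ y : ℂ) with hη
    have hηc : ∀ y, starRingEnd ℂ (η y) = η y := fun y => by simp [hη]
    have hgc : ∀ y, starRingEnd ℂ (greenV η y) = greenV η y := fun y => by
      rw [← greenV_conj]; simp only [hηc]
    have e1 : ∀ y, starRingEnd ℂ (adj V k lam κ v (fun y => (φ y : ℂ)) 0 y) * ω y =
        (φ y : ℂ) * ((lam + Complex.I * k * V y) * ω y)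
          - ((iteratedDeriv 2 φ y : ℝ) : ℂ) * ω y
          + Complex.I * κ * (greenV η y * ω y) := fun y => by
      simp only [adj, hφ.deriv_ofReal, mul_zero, add_zero, map_sub, map_mul, Complex.conj_conj,
        Complex.conj_ofReal, Complex.conj_I, ← hη, hgc]
      ring
    have e2 : starRingEnd ℂ (adjA Lam κ v (fun y => (φ y : ℂ)) 0) =
        Complex.I * κ * ∫ y in Ioi (0 : ℝ), (y : ℂ) * η y := by
      simp only [adjA, mul_zero, zero_sub, map_neg, map_mul, Complex.conj_I, Complex.conj_ofReal,
        ← integral_conj, hη]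
      ring
    have i1 := hφ.integrable_mul (g := fun y => lam + Complex.I * k * V y)
      (continuousOn_const.add (continuousOn_const.mul
        (Complex.continuous_ofReal.comp_continuousOn hV))) hm
    have i2 : Integrable (fun y => ((iteratedDeriv 2 φ y : ℝ) : ℂ) * ω y) hl := by
      rw [iteratedDeriv_two]; exact hφ.deriv.deriv.integrable hm
    have i3 := hm.integrable_greenV hmφ
    have i3' : Integrable (fun y => η y * greenV ω y) hl := by
      simpa only [mul_comm] using hmφ.integrable_greenV hm
    have i4 : Integrable (fun y : ℝ => (y : ℂ) * η y) hl := hmφ.integrable_mul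
    have i5 := hφ.integrable hfm
    have e3 : ∫ y in Ioi (0 : ℝ), (φ y : ℂ) * sysRhs V k lam κ v f ω A y =
        (∫ y in Ioi (0 : ℝ), (φ y : ℂ) * ((lam + Complex.I * k * V y) * ω y))
        + Complex.I * κ * ((∫ y in Ioi (0 : ℝ), η y * greenV ω y)
          + (∫ y in Ioi (0 : ℝ), (y : ℂ) * η y) * A)
        - ∫ y in Ioi (0 : ℝ), (φ y : ℂ) * f y := by
      have i6 : Integrable (fun y : ℝ => η y * greenV ω y + (y : ℂ) * η y * A) hl :=
        i3'.add (i4.mul_const A)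
      have i7 : Integrable (fun y => (φ y : ℂ) * ((lam + Complex.I * k * V y) * ω y) +
          Complex.I * κ * (η y * greenV ω y + (y : ℂ) * η y * A)) hl := i1.add (i6.const_mul _)
      rw [← integral_mul_const, ← integral_add i3' (i4.mul_const A), ← integral_const_mul,
        ← integral_add i1 (i6.const_mul _), ← integral_sub i7 i5]
      refine integral_congr_ae (ae_of_all _ fun y => ?_)
      simp only [sysRhs, hη]; ring
    simp only [e1, map_zero, zero_mul, add_zero, Complex.conj_ofReal] at hx
    have i8 : Integrable (fun y => (φ y : ℂ) * ((lam + Complex.I * k * V y) * ω y)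
          - ((iteratedDeriv 2 φ y : ℝ) : ℂ) * ω y) hl := i1.sub i2
    rw [integral_add i8 (i3.const_mul _), integral_sub i1 i2, integral_const_mul,
      greenV_symm hmφ hm, e2] at hx
    rw [e3, ← hx]; ring
  -- Testing with `χ = 0`, `D = 1` isolates the Benjamin–Ono equation.
  · have hx := hw 0 testSpace.zero_mem 1
    have hg : ∀ y : ℝ, greenV (fun _ => (0 : ℂ)) y = 0 := fun y => by
      simp [greenV]
    have e1 : ∀ y : ℝ, starRingEnd ℂ (adj V k lam κ v 0 1 y) * ω y =
        Complex.I * κ * ((y : ℂ) * ω y) := fun y => by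
      have h0 : _root_.deriv (_root_.deriv (0 : ℝ → ℂ)) y = 0 := by simp
      simp only [adj, hg, h0, Pi.zero_apply, mul_zero, zero_sub, zero_add, map_neg, map_mul,
        map_sub, Complex.conj_I, Complex.conj_ofReal, map_one, map_zero]
      ring
    have e2 : starRingEnd ℂ (adjA Lam κ v 0 1) = Lam := by simp [adjA]
    simp only [e1, e2, Pi.zero_apply, map_zero, zero_mul, integral_zero, zero_add, map_one,
      one_mul] at hx
    rw [integral_const_mul] at hx
    rw [opV_eq hm, ← hx]; ring

/-! ### The weight `-U''` and the reduced system -/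

/-- The positive profile `-U''`. -/
def negDeriv2 (U : ℝ → ℝ) (y : ℝ) : ℝ := -shearDeriv2 U y

theorem IsShearProfile.continuousOn_shearDeriv2 {U : ℝ → ℝ} (hU : IsShearProfile U) :
    ContinuousOn (shearDeriv2 U) (Ici 0) :=
  hU.contDiffOn.continuousOn_iteratedDerivWithin (by norm_num) (uniqueDiffOn_Ici 0)

theorem IsShearProfile.continuousOn_shear {U : ℝ → ℝ} (hU : IsShearProfile U) :
    ContinuousOn (shear U) (Ici 0) :=
  continuousOn_id.add hU.contDiffOn.continuousOn

/-- Concavity makes `-U''` positive, the bound `C'` on `U'''/U''` gives `θ = C'/2`, and the decay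
constant `C` gives `d = √(8C)` through `(1 + y)⁶ ≤ 8 (1 + y²)³`. -/
theorem IsShearProfile.exists_isWeight {U : ℝ → ℝ} (hU : IsShearProfile U) :
    ∃ θ d : ℝ, 0 ≤ θ ∧ IsWeight (negDeriv2 U) θ d := by
  obtain ⟨C, hC⟩ := hU.decay
  obtain ⟨C', hC'⟩ := hU.ratio
  have hpos : ∀ y : ℝ, 0 < y → 0 < negDeriv2 U y := fun y hy =>
    neg_pos.2 (hU.concave y (le_of_lt hy))
  have hC'0 : 0 ≤ C' := (abs_nonneg _).trans (hC' 0 (self_mem_Ici))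
  have hC0 : 0 ≤ C := le_trans (by positivity) (hC 0 self_mem_Ici)
  refine ⟨C' / 2, √(8 * C), by positivity, by positivity, hpos,
    ⟨fun y => -iteratedDerivWithin 3 U (Ici 0) y, ?_, fun y hy => ⟨?_, ?_⟩⟩, fun y hy => ?_⟩
  · exact ((hU.contDiffOn.continuousOn_iteratedDerivWithin (by norm_num)
      (uniqueDiffOn_Ici 0)).mono Ioi_subset_Ici_self).neg
  · have h1 : DifferentiableOn ℝ (iteratedDerivWithin 2 U (Ici 0)) (Ici 0) :=
      hU.contDiffOn.differentiableOn_iteratedDerivWithin (by norm_num) (uniqueDiffOn_Ici 0)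
    have h2 := (h1 y hy.le).hasDerivWithinAt.hasDerivAt (Ici_mem_nhds hy)
    have h3 : iteratedDerivWithin 3 U (Ici 0) y =
        derivWithin (iteratedDerivWithin 2 U (Ici 0)) (Ici 0) y := by
      rw [iteratedDerivWithin_succ]
    exact h2.neg.congr_deriv (by simp only [h3])
  · have h1 := hC' y (show (0 : ℝ) ≤ y from hy.le)
    have h2 := hU.concave y (show (0 : ℝ) ≤ y from hy.le)
    rw [abs_div, div_le_iff₀ (abs_pos.2 h2.ne), abs_of_neg h2] at h1
    rw [abs_neg]
    unfold negDeriv2 shearDeriv2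
    linarith
  · have h1 := hC y (show (0 : ℝ) ≤ y from hy.le)
    have h2 := hU.concave y (show (0 : ℝ) ≤ y from hy.le)
    rw [abs_of_neg h2] at h1
    rw [Real.sq_sqrt (by positivity)]
    have h3 : (1 + y) ^ 6 ≤ 8 * (1 + y ^ 2) ^ 3 := by
      have : (1 + y) ^ 2 ≤ 2 * (1 + y ^ 2) := by nlinarith [sq_nonneg (1 - y)]
      calc (1 + y) ^ 6 = ((1 + y) ^ 2) ^ 3 := by ring
        _ ≤ (2 * (1 + y ^ 2)) ^ 3 := by gcongr
        _ = _ := by ring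
    have h4 := (hpos y hy).le
    unfold negDeriv2 shearDeriv2 at *
    nlinarith

/-- Near the wall use `U 0 = 0` and the boundedness of `U'` on `[0, 1]`, beyond `1` the boundedness
of `U`. The linear vanishing at `0` is what makes the shear a small perturbation inside the boundary
layer. -/
theorem IsShearProfile.exists_shear_le {U : ℝ → ℝ} (hU : IsShearProfile U) :
    ∃ C : ℝ, 0 ≤ C ∧ ∀ y : ℝ, 0 ≤ y → |shear U y| ≤ C * y := by
  obtain ⟨B, hB⟩ := hU.bounded
  have hB0 : 0 ≤ B := (abs_nonneg _).trans (hB 0 self_mem_Ici)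
  have hc1 : ContinuousOn (derivWithin U (Ici 0)) (Icc 0 1) :=
    (hU.contDiffOn.continuousOn_derivWithin (uniqueDiffOn_Ici 0) (by norm_num)).mono
      Icc_subset_Ici_self
  obtain ⟨L, hL⟩ := isCompact_Icc.exists_bound_of_continuousOn hc1
  have hL0 : 0 ≤ L := (norm_nonneg _).trans (hL 0 (by simp))
  have hd : DifferentiableOn ℝ U (Ici 0) := hU.contDiffOn.differentiableOn (by norm_num)
  refine ⟨1 + B + L, by positivity, fun y hy => ?_⟩
  have hUy : |U y| ≤ (B + L) * y := by
    rcases le_or_gt y 1 with h1 | h1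
    · have := (convex_Icc (0 : ℝ) 1).norm_image_sub_le_of_norm_hasDerivWithin_le
        (f := U) (f' := derivWithin U (Ici 0)) (C := L) (x := 0) (y := y)
        (fun x hx => ((hd x hx.1).hasDerivWithinAt).mono Icc_subset_Ici_self) hL
        (by simp) ⟨hy, h1⟩
      rw [hU.zero, sub_zero, sub_zero, Real.norm_eq_abs, Real.norm_of_nonneg hy] at this
      nlinarith
    · have := hB y hy
      nlinarith
  unfold shear
  refine (abs_add_le _ _).trans ?_
  rw [abs_of_nonneg hy]
  linarith

theorem sysRhs_add_smul (V : ℝ → ℝ) (k : ℝ) (lam : ℂ) (κ : ℝ) (v : ℝ → ℝ) {f₁ f₂ ω₁ ω₂ : ℝ → ℂ}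
    (h₁ : Mom ω₁) (h₂ : Mom ω₂) (A₁ A₂ c : ℂ) (y : ℝ) :
    sysRhs V k lam κ v (fun y => f₁ y + c * f₂ y) (fun y => ω₁ y + c * ω₂ y) (A₁ + c * A₂) y =
      sysRhs V k lam κ v f₁ ω₁ A₁ y + c * sysRhs V k lam κ v f₂ ω₂ A₂ y := by
  simp only [sysRhs]
  rw [greenV_add h₁ (h₂.const_mul c), greenV_const_mul]
  ring

theorem WeakEq.add_smul {V : ℝ → ℝ} {k : ℝ} {lam : ℂ} {κ : ℝ} {v : ℝ → ℝ} {f₁ f₂ ω₁ ω₂ : ℝ → ℂ}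
    {A₁ A₂ : ℂ} (hV : ContinuousOn V (Ioi 0)) (hv : ContinuousOn v (Ioi 0))
    (hf₁ : Mom f₁) (hf₂ : Mom f₂) (h₁ : Mom ω₁) (h₂ : Mom ω₂)
    (e₁ : WeakEq V k lam κ v f₁ ω₁ A₁) (e₂ : WeakEq V k lam κ v f₂ ω₂ A₂) (c : ℂ) :
    WeakEq V k lam κ v (fun y => f₁ y + c * f₂ y) (fun y => ω₁ y + c * ω₂ y) (A₁ + c * A₂) := by
  intro φ hφ
  have i1 := hφ.integrable_sysRhs hV hv hf₁ h₁ k lam κ A₁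
  have i2 := hφ.integrable_sysRhs hV hv hf₂ h₂ k lam κ A₂
  have i3 : Integrable (fun y => ((iteratedDeriv 2 φ y : ℝ) : ℂ) * ω₁ y) hl := by
    rw [iteratedDeriv_two]; exact hφ.deriv.deriv.integrable h₁
  have i4 : Integrable (fun y => ((iteratedDeriv 2 φ y : ℝ) : ℂ) * ω₂ y) hl := by
    rw [iteratedDeriv_two]; exact hφ.deriv.deriv.integrable h₂
  simp only [sysRhs_add_smul V k lam κ v h₁ h₂, mul_add, mul_left_comm _ c]
  rw [integral_add i1 (i2.const_mul c), integral_add i3 (i4.const_mul c), integral_const_mul,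
    integral_const_mul, e₁ φ hφ, e₂ φ hφ]

/-- The symbol of the Benjamin–Ono equation. -/
def symbolBO (k : ℝ) (lam : ℂ) : ℂ := lam + Complex.I * k + Complex.I * k * (|k| : ℝ)

/-- Both dispersive terms are imaginary, so the scalar equation is as coercive as the vorticity
equation. -/
theorem symbolBO_re (k : ℝ) (lam : ℂ) : (symbolBO k lam).re = lam.re := by
  simp [symbolBO]

/-- The vorticity–Benjamin–Ono system without the mean constraint. -/
structure IsSys (U : ℝ → ℝ) (k : ℝ) (lam : ℂ) (f : ℝ → ℂ) (a : ℂ) (ω : ℝ → ℂ) (A : ℂ) : Prop where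
  memH : MemH ω
  weak : WeakEq (shear U) k lam k (negDeriv2 U) f ω A
  bo : symbolBO k lam * A = Complex.I * k * opV ω + a

theorem IsShearProfile.continuousOn_shear' {U : ℝ → ℝ} (hU : IsShearProfile U) :
    ContinuousOn (shear U) (Ioi 0) := hU.continuousOn_shear.mono Ioi_subset_Ici_self

theorem IsShearProfile.continuousOn_negDeriv2 {U : ℝ → ℝ} (hU : IsShearProfile U) :
    ContinuousOn (negDeriv2 U) (Ioi 0) :=
  (hU.continuousOn_shearDeriv2.mono Ioi_subset_Ici_self).neg

theorem IsSys.add_smul {U : ℝ → ℝ} (hU : IsShearProfile U) {k : ℝ} {lam : ℂ}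
    {f₁ f₂ ω₁ ω₂ : ℝ → ℂ} {a₁ a₂ A₁ A₂ : ℂ} (hf₁ : Mom f₁) (hf₂ : Mom f₂)
    (h₁ : IsSys U k lam f₁ a₁ ω₁ A₁) (h₂ : IsSys U k lam f₂ a₂ ω₂ A₂) (c : ℂ) :
    IsSys U k lam (fun y => f₁ y + c * f₂ y) (a₁ + c * a₂)
      (fun y => ω₁ y + c * ω₂ y) (A₁ + c * A₂) where
  memH := h₁.memH.add (h₂.memH.const_mul c)
  weak := h₁.weak.add_smul hU.continuousOn_shear' hU.continuousOn_negDeriv2 hf₁ hf₂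
    h₁.memH.mom h₂.memH.mom h₂.weak c
  bo := by
    rw [opV_add h₁.memH.mom (h₂.memH.mom.const_mul c), opV_const_mul h₂.memH.mom]
    linear_combination h₁.bo + c * h₂.bo

/-- All terms other than `∂_y² ω` move to one side, with `opVy` replaced by its kernel form. Each
integrand is integrable for finite first moments, so splitting the integrals is legitimate. -/
theorem vorticityEq_iff {U : ℝ → ℝ} (hU : IsShearProfile U) {k : ℝ} {lam : ℂ} {f ω : ℝ → ℂ}
    {A : ℂ} (hf : Mom f) (hω : Mom ω) :
    VorticityEq U k lam f ω A ↔ WeakEq (shear U) k lam k (negDeriv2 U) f ω A := by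
  have key : ∀ φ : ℝ → ℝ, IsTest φ →
      (∫ y in Ioi (0 : ℝ), φ y • ((lam + Complex.I * k * shear U y) * ω y
        - Complex.I * k * shearDeriv2 U y * opVy ω y)) =
      (∫ y in Ioi (0 : ℝ), (φ y : ℂ) * sysRhs (shear U) k lam k (negDeriv2 U) f ω A y) +
      ∫ y in Ioi (0 : ℝ), φ y • (Complex.I * k * shearDeriv2 U y * y * A + f y) := by
    intro φ hφ
    have i1 := hφ.integrable_sysRhs hU.continuousOn_shear' hU.continuousOn_negDeriv2 hf hω k lam k A
    have i2 : Integrable (fun y : ℝ => φ y • (Complex.I * k * shearDeriv2 U y * y * A + f y)) hl := by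
      obtain ⟨a, b, ha, hz⟩ := hφ.exists_Icc
      have h1 : Integrable (fun y => (φ y : ℂ) * (Complex.I * k * shearDeriv2 U y * y * A)) hl := by
        refine memLp_one_iff_integrable.1 (memLp_of_continuousOn_compact ha (b := b) ?_
          (fun y hy => by simp [hz y hy]) 1)
        have hvC := Complex.continuous_ofReal.comp_continuousOn
          (hU.continuousOn_shearDeriv2.mono Ioi_subset_Ici_self)
        exact (Complex.continuous_ofReal.comp hφ.contDiff.continuous).continuousOn.mul
          (((continuousOn_const.mul hvC).mul Complex.continuous_ofReal.continuousOn).mul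
            continuousOn_const)
      refine (h1.add (hφ.integrable hf)).congr (ae_of_all _ fun y => ?_)
      simp only [Pi.add_apply, Complex.real_smul]; ring
    rw [← integral_add i1 i2]
    refine setIntegral_congr_fun measurableSet_Ioi fun y hy => ?_
    have hy' : (0 : ℝ) < y := hy
    simp only [sysRhs, negDeriv2, Complex.real_smul, opVy_eq hω hy'.le, Complex.ofReal_neg]
    ring
  constructor
  · intro h φ hφ
    have h1 := h φ hφ.contDiff hφ.compact hφ.supp
    rw [key φ hφ] at h1
    simp only [Complex.real_smul] at h1 ⊢
    linear_combination h1
  · intro h φ h1 h2 h3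
    have h4 := h φ ⟨h1, h2, h3⟩
    rw [key φ ⟨h1, h2, h3⟩, h4]
    simp only [Complex.real_smul]
    ring

theorem isSolution_iff {U : ℝ → ℝ} (hU : IsShearProfile U) {k : ℝ} {lam : ℂ} {f ω : ℝ → ℂ}
    {a A : ℂ} (hf : Mom f) :
    IsSolution U k lam f a ω A ↔ IsSys U k lam f a ω A ∧ meanU ω = A := by
  constructor
  · intro h
    exact ⟨⟨h.memH, (vorticityEq_iff hU hf h.memH.mom).1 h.vorticity, h.benjaminOno⟩, h.mean⟩
  · rintro ⟨h, hm⟩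
    exact ⟨h.memH, h.bo, (vorticityEq_iff hU hf h.memH.mom).2 h.weak, hm⟩

/-- The norm of `(1 + y)³ ω` in `L²(0, ∞)`. -/
def nrmH (ω : ℝ → ℂ) : ℝ := nrm fun y : ℝ => (((1 + y) ^ 3 : ℝ) : ℂ) * ω y

theorem nrmH_nonneg (ω : ℝ → ℂ) : 0 ≤ nrmH ω := nrm_nonneg _

theorem nrmH_add_le {ω η : ℝ → ℂ} (h : MemH ω) (h' : MemH η) :
    nrmH (fun y => ω y + η y) ≤ nrmH ω + nrmH η := by
  unfold nrmH
  simp only [mul_add]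
  exact nrm_add_le h h'

theorem nrmH_const_mul (c : ℂ) (ω : ℝ → ℂ) : nrmH (fun y => c * ω y) = ‖c‖ * nrmH ω := by
  unfold nrmH
  simp only [mul_left_comm _ c]
  exact nrm_const_mul c _

theorem Mom.zero : Mom fun _ => 0 := by
  simp [Mom]

/-! ### Local solutions and their nonlocal correction -/

/-- Weak solvability of the local equation `(λ + ikV) ω - ω'' = f`. -/
theorem exists_local_solution {v : ℝ → ℝ} {θ d : ℝ} (h : IsWeight v θ d)
    {V : ℝ → ℝ} (hV : ContinuousOn V (Ioi 0)) (k : ℝ) {lam : ℂ} (h0 : 0 < lam.re)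
    (hc : 2 * θ ^ 2 ≤ lam.re) (w : ℝ → ℝ) {f : ℝ → ℂ} (hf : MemLp (wdiv v f) 2 hl) :
    ∃ ω : ℝ → ℂ, MemLp (wdiv v ω) 2 hl ∧ nrm (wdiv v ω) ≤ 2 / lam.re * nrm (wdiv v f) ∧
      WeakEq V k lam 0 w f ω 0 := by
  -- At `κ = 0` the two equations decouple and the nonlocal weight is multiplied by zero. This
  -- allows weights unrelated to `U''`.
  obtain ⟨ω, A, hω, hn, hw, -⟩ := exists_weak_solution h hV k (lam := lam) (Lam := lam)
    (by nlinarith [sq_nonneg θ]) le_rfl 0 hf 0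
  refine ⟨ω, hω, ?_, fun φ hφ => ?_⟩
  · have h1 : nrm (wdiv v ω) ≤ √(nrm (wdiv v ω) ^ 2 + ‖A‖ ^ 2) :=
      Real.le_sqrt_of_sq_le (by nlinarith [sq_nonneg ‖A‖])
    have h2 : √(nrm (wdiv v f) ^ 2 + ‖(0 : ℂ)‖ ^ 2) = nrm (wdiv v f) := by
      simp [Real.sqrt_sq (nrm_nonneg _)]
    rw [h2] at hn
    refine (h1.trans hn).trans ?_
    rw [div_mul_eq_mul_div, div_le_div_iff₀ (by nlinarith [sq_nonneg θ]) h0]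
    nlinarith [nrm_nonneg (wdiv v f)]
  · refine Eq.trans ?_ (hw φ hφ)
    congr 1
    ext y
    simp [sysRhs]

/-- A local solution is corrected to a solution of the full system. -/
theorem exists_nonlocal_correction {U : ℝ → ℝ} (hU : IsShearProfile U) {θ d : ℝ}
    (h : IsWeight (negDeriv2 U) θ d) (k : ℝ) {lam : ℂ} (h0 : 0 < lam.re)
    (hc : 2 * θ ^ 2 ≤ lam.re) {f η : ℝ → ℂ} (a : ℂ) (hf : Mom f) (hη : MemH η)
    (hw : WeakEq (shear U) k lam 0 (negDeriv2 U) f η 0) {b : ℝ}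
    (hb : ∫ z in Ioi (0 : ℝ), ‖(z : ℂ) * η z‖ ≤ b) :
    ∃ (ω : ℝ → ℂ) (A : ℂ), IsSys U k lam f a (fun y => η y + ω y) A ∧ MemH ω ∧
      nrmH ω ≤ d * (2 / lam.re * (|k| * (d + 1) * b + ‖a‖)) ∧
      ‖A‖ ≤ 2 / lam.re * (|k| * (d + 1) * b + ‖a‖) := by
  have hb1 : ∀ y, ‖greenV η y‖ ≤ b := fun y => (norm_greenV_le_integral hη.mom y).trans hb
  have hb2 : ‖opV η‖ ≤ b := (norm_opV_le_integral hη.mom).trans hb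
  have hb0 : 0 ≤ b := (norm_nonneg _).trans hb2
  -- The residual of `η` in the full vorticity equation. Its factor `-U''` puts it in `L²(dy/v)`
  -- even when `η` is not there.
  let g : ℝ → ℂ := fun y => -(Complex.I * k * (negDeriv2 U y * greenV η y))
  have hgm : MemLp (wdiv (negDeriv2 U) g) 2 hl ∧ nrm (wdiv (negDeriv2 U) g) ≤ |k| * d * b := by
    have e : ∀ y, 0 < y → wdiv (negDeriv2 U) g y =
        ((√(negDeriv2 U y) : ℝ) : ℂ) * (-(Complex.I * k * greenV η y)) := fun y hy => by
      have : ((√(negDeriv2 U y) : ℝ) : ℂ) ≠ 0 :=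
        Complex.ofReal_ne_zero.2 (Real.sqrt_pos.2 (h.pos y hy)).ne'
      simp only [wdiv, g, Complex.ofReal_inv]
      rw [← h.sqrt_mul_sqrt hy]
      field_simp
    have hE : (fun y => ((√(negDeriv2 U y) : ℝ) : ℂ) * (-(Complex.I * k * greenV η y)))
        =ᵐ[hl] wdiv (negDeriv2 U) g := by
      filter_upwards [ae_restrict_mem measurableSet_Ioi] with y hy
      rw [e y hy]
    have hcont := continuous_greenV hη.mom
    have hM := h.memLp_sqrt_mul (g := fun y => -(Complex.I * k * greenV η y)) (by fun_prop)
      (C := |k| * b) (fun y hy => by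
        rw [norm_neg, norm_mul, norm_mul, Complex.norm_I, one_mul, Complex.norm_real,
          Real.norm_eq_abs]
        have := mul_le_mul_of_nonneg_left (hb1 y) (abs_nonneg k)
        nlinarith [mul_nonneg (abs_nonneg k) hb0])
    refine ⟨hM.ae_eq hE, ?_⟩
    rw [← nrm_congr hE]
    have h3 := memLp_inv_pow (n := 3) (by norm_num)
    calc _ ≤ nrm (fun y : ℝ => ((|k| * d * b : ℝ) : ℂ) * ((((1 + y) ^ 3)⁻¹ : ℝ) : ℂ)) := by
          refine nrm_mono (h3.const_mul _) fun y hy => ?_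
          have hs := h.sqrt_le hy
          have hd := h.nonneg_d
          rw [norm_mul, norm_neg, norm_mul, norm_mul, Complex.norm_I, one_mul, norm_mul]
          simp only [Complex.norm_real]
          rw [Real.norm_of_nonneg (Real.sqrt_nonneg _), Real.norm_eq_abs k,
            Real.norm_of_nonneg (by positivity : 0 ≤ |k| * d * b),
            Real.norm_of_nonneg (by positivity : 0 ≤ ((1 + y) ^ 3)⁻¹)]
          have h1 : √(negDeriv2 U y) ≤ d * ((1 + y) ^ 3)⁻¹ := by
            rw [← div_eq_mul_inv, le_div_iff₀ (by positivity)]; exact hs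
          calc _ ≤ (d * ((1 + y) ^ 3)⁻¹) * (|k| * b) := by
                gcongr
                exact hb1 y
            _ = _ := by ring
      _ ≤ _ := by
          have hd := h.nonneg_d
          rw [nrm_const_mul, Complex.norm_real, Real.norm_of_nonneg (by positivity)]
          exact mul_le_of_le_one_right (by positivity) (nrm_inv_pow_le (by norm_num))
  -- The scalar datum absorbs `ik 𝒱[η]`, so that `η + ω` satisfies the Benjamin–Ono equation with
  -- datum `a`.
  obtain ⟨ω, A, hω, hn, hww, hbo⟩ := exists_weak_solution h hU.continuousOn_shear' k (lam := lam)
    (Lam := symbolBO k lam) (by nlinarith [sq_nonneg θ]) (symbolBO_re k lam).ge k hgm.1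
    (a + Complex.I * k * opV η)
  have hωH := memLp_of_wdiv h hω
  have hgM : Mom g := (memLp_of_wdiv h hgm.1).mom
  have hd := h.nonneg_d
  have hN : √(nrm (wdiv (negDeriv2 U) ω) ^ 2 + ‖A‖ ^ 2) ≤
      2 / lam.re * (|k| * (d + 1) * b + ‖a‖) := by
    refine hn.trans ?_
    have h1 : √(nrm (wdiv (negDeriv2 U) g) ^ 2 + ‖a + Complex.I * k * opV η‖ ^ 2) ≤
        |k| * (d + 1) * b + ‖a‖ := by
      have h2 : ‖a + Complex.I * k * opV η‖ ≤ ‖a‖ + |k| * b := by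
        refine (norm_add_le _ _).trans ?_
        rw [norm_mul, norm_mul, Complex.norm_I, one_mul, Complex.norm_real, Real.norm_eq_abs]
        gcongr
      have h3 := nrm_nonneg (wdiv (negDeriv2 U) g)
      have h4 := norm_nonneg (a + Complex.I * k * opV η)
      refine (Real.sqrt_le_left (by positivity)).2 ?_
      have h5 : nrm (wdiv (negDeriv2 U) g) + ‖a + Complex.I * k * opV η‖ ≤
        |k| * (d + 1) * b + ‖a‖ := by nlinarith [hgm.2]
      nlinarith
    have hden : lam.re / 2 ≤ lam.re - θ ^ 2 := by linarith
    calc _ ≤ (|k| * (d + 1) * b + ‖a‖) / (lam.re / 2) := by gcongr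
      _ = _ := by field_simp
  have hN1 : nrm (wdiv (negDeriv2 U) ω) ≤ √(nrm (wdiv (negDeriv2 U) ω) ^ 2 + ‖A‖ ^ 2) :=
    Real.le_sqrt_of_sq_le (by nlinarith [sq_nonneg ‖A‖])
  have hN2 : ‖A‖ ≤ √(nrm (wdiv (negDeriv2 U) ω) ^ 2 + ‖A‖ ^ 2) :=
    Real.le_sqrt_of_sq_le (by nlinarith [sq_nonneg (nrm (wdiv (negDeriv2 U) ω))])
  refine ⟨ω, A, ⟨hη.add hωH, fun φ hφ => ?_, ?_⟩, hωH, ?_, hN2.trans hN⟩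
  · have h1 := hw φ hφ
    have h2 := hww φ hφ
    have i1 := hφ.integrable_sysRhs hU.continuousOn_shear' hU.continuousOn_negDeriv2 hf hη.mom
      k lam 0 0
    have i2 := hφ.integrable_sysRhs hU.continuousOn_shear' hU.continuousOn_negDeriv2 hgM hωH.mom
      k lam k A
    have i3 : Integrable (fun y => ((iteratedDeriv 2 φ y : ℝ) : ℂ) * η y) hl := by
      rw [iteratedDeriv_two]; exact hφ.deriv.deriv.integrable hη.mom
    have i4 : Integrable (fun y => ((iteratedDeriv 2 φ y : ℝ) : ℂ) * ω y) hl := by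
      rw [iteratedDeriv_two]; exact hφ.deriv.deriv.integrable hωH.mom
    simp only [mul_add]
    rw [integral_add i3 i4, ← h1, ← h2, ← integral_add i1 i2]
    congr 1
    ext y
    simp only [sysRhs, g]
    rw [greenV_add hη.mom hωH.mom]
    push_cast
    ring
  · rw [opV_add hη.mom hωH.mom, hbo]; ring
  · refine (nrm_le_of_wdiv h hω).trans ?_
    gcongr
    exact hN1.trans hN

/-! ### Explicit weights and the boundary-layer profile -/

theorem integral_pow_mul_exp (n : ℕ) {a : ℝ} (ha : 0 < a) :
    IntegrableOn (fun y : ℝ => y ^ n * Real.exp (-(a * y))) (Ioi 0) ∧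
    ∫ y in Ioi (0 : ℝ), y ^ n * Real.exp (-(a * y)) = n.factorial / a ^ (n + 1) := by
  have h := Real.integral_rpow_mul_exp_neg_mul_Ioi (a := n + 1) (r := a) (by positivity) ha
  have e : ∫ y in Ioi (0 : ℝ), y ^ n * Real.exp (-(a * y)) = n.factorial / a ^ (n + 1) := by
    rw [Real.Gamma_nat_eq_factorial] at h
    have h2 : (1 / a) ^ ((n : ℝ) + 1) = 1 / a ^ (n + 1) := by
      rw [show (n : ℝ) + 1 = ((n + 1 : ℕ) : ℝ) by push_cast; ring, Real.rpow_natCast, one_div_pow]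
    rw [h2] at h
    rw [div_eq_mul_one_div, mul_comm, ← h]
    refine setIntegral_congr_fun measurableSet_Ioi fun y hy => ?_
    simp only [add_sub_cancel_right, Real.rpow_natCast]
  refine ⟨Integrable.of_integral_ne_zero ?_, e⟩
  rw [e]
  positivity

theorem memLp_nrm_of_sq_le {g : ℝ → ℂ} (hg : AEStronglyMeasurable g hl) {G : ℝ → ℝ}
    (hG : IntegrableOn G (Ioi 0)) (h : ∀ y, 0 < y → ‖g y‖ ^ 2 ≤ G y) {c : ℝ} (hc : 0 ≤ c)
    (hle : ∫ y in Ioi (0 : ℝ), G y ≤ c ^ 2) : MemLp g 2 hl ∧ nrm g ≤ c := by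
  have hi : Integrable (fun y => ‖g y‖ ^ 2) hl := by
    refine Integrable.mono' hG (hg.norm.pow 2) ?_
    filter_upwards [ae_restrict_mem measurableSet_Ioi] with y hy
    rw [Real.norm_of_nonneg (by positivity)]
    exact h y hy
  have hm : MemLp g 2 hl := (memLp_two_iff_integrable_sq_norm hg).2 hi
  exact ⟨hm, nrm_le_of_sq hm hc ((setIntegral_mono_on hi hG measurableSet_Ioi h).trans hle)⟩

/-- The polynomial weight defining the space `H`. -/
theorem isWeight_pow : IsWeight (fun y => ((1 + y) ^ 6)⁻¹) 3 1 := by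
  refine ⟨zero_le_one, fun y hy => by positivity,
    ⟨fun y => -(6 * (1 + y) ^ 5) / ((1 + y) ^ 6) ^ 2, ?_, fun y hy => ⟨?_, ?_⟩⟩, fun y hy => ?_⟩
  · refine ContinuousOn.div (by fun_prop) (by fun_prop) fun y hy => ?_
    have hy' : (0 : ℝ) < y := hy
    positivity
  · have h0 : (1 + y) ^ 6 ≠ 0 := by positivity
    have h1 := (((hasDerivAt_id y).const_add 1).fun_pow 6).inv h0
    refine h1.congr_deriv ?_
    simp
  · rw [abs_div, abs_neg, abs_of_pos (by positivity : 0 < 6 * (1 + y) ^ 5),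
      abs_of_pos (by positivity : 0 < ((1 + y) ^ 6) ^ 2), div_le_iff₀ (by positivity)]
    have : 2 * 3 * ((1 + y) ^ 6)⁻¹ * ((1 + y) ^ 6) ^ 2 = 6 * (1 + y) ^ 5 * (1 + y) := by
      field_simp; norm_num
    rw [this]
    have := pow_pos (by linarith : 0 < 1 + y) 5
    nlinarith
  · rw [inv_mul_cancel₀ (by positivity)]; norm_num

theorem wdiv_pow {ω : ℝ → ℂ} :
    wdiv (fun y => ((1 + y) ^ 6)⁻¹) ω =ᵐ[hl] fun y : ℝ => (((1 + y) ^ 3 : ℝ) : ℂ) * ω y := by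
  filter_upwards [ae_restrict_mem measurableSet_Ioi] with y hy
  have hy' : (0 : ℝ) < y := hy
  unfold wdiv
  beta_reduce
  rw [show (1 + y) ^ 6 = ((1 + y) ^ 3) ^ 2 by ring, Real.sqrt_inv, inv_inv,
    Real.sqrt_sq (by positivity)]

theorem one_add_pow_le_exp {y : ℝ} (hy : 0 ≤ y) (n : ℕ) : (1 + y) ^ n ≤ Real.exp (n * y) := by
  rw [Real.exp_nat_mul]
  have := Real.add_one_le_exp y
  gcongr
  linarith

/-- For `θ ≥ 3` the exponential lies below `(1 + y)⁻⁶`. The rate is free, and it will be taken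
comparable to `√(Re λ)` to keep corrections localised in the layer. -/
theorem isWeight_exp {θ : ℝ} (hθ : 3 ≤ θ) : IsWeight (fun y => Real.exp (-(2 * θ * y))) θ 1 := by
  refine ⟨zero_le_one, fun y hy => Real.exp_pos _,
    ⟨fun y => Real.exp (-(2 * θ * y)) * (-(2 * θ)), by fun_prop, fun y hy => ⟨?_, ?_⟩⟩,
    fun y hy => ?_⟩
  · have := (((hasDerivAt_id y).const_mul (2 * θ)).neg).exp
    refine this.congr_deriv ?_
    simp
  · rw [abs_mul, abs_neg, abs_of_pos (Real.exp_pos _), abs_of_pos (by linarith), mul_comm]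
  · have h1 := one_add_pow_le_exp hy.le 6
    calc _ ≤ Real.exp (-(2 * θ * y)) * Real.exp ((6 : ℕ) * y) := by gcongr
      _ = Real.exp (-(2 * θ * y) + (6 : ℕ) * y) := (Real.exp_add _ _).symm
      _ ≤ 1 ^ 2 := by
        rw [one_pow, Real.exp_le_one_iff]
        push_cast
        nlinarith

theorem wdiv_exp (θ : ℝ) (ω : ℝ → ℂ) (y : ℝ) :
    wdiv (fun y => Real.exp (-(2 * θ * y))) ω y = ((Real.exp (θ * y) : ℝ) : ℂ) * ω y := by
  unfold wdiv
  rw [← Real.exp_half, ← Real.exp_neg]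
  congr 3; ring

/-- From `Re λ = (Re s)² - (Im s)² > 0` the root in the right half-plane satisfies `|Im s| < Re s`.
Thus `|s|` and `Re s` are comparable, and `Re s ≥ √(Re λ)`. -/
theorem exists_sqrt {lam : ℂ} (h : 0 < lam.re) :
    ∃ s : ℂ, s ^ 2 = lam ∧ 0 < s.re ∧ lam.re ≤ s.re ^ 2 ∧ ‖s‖ ^ 2 ≤ 2 * s.re ^ 2 := by
  have key : ∀ s : ℂ, s ^ 2 = lam → 0 < s.re →
      ∃ s : ℂ, s ^ 2 = lam ∧ 0 < s.re ∧ lam.re ≤ s.re ^ 2 ∧ ‖s‖ ^ 2 ≤ 2 * s.re ^ 2 := by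
    intro s hs h0
    have e : lam.re = s.re ^ 2 - s.im ^ 2 := by
      rw [← hs, pow_two, Complex.mul_re]; ring
    refine ⟨s, hs, h0, by nlinarith [sq_nonneg s.im], ?_⟩
    rw [← Complex.normSq_eq_norm_sq, Complex.normSq_apply]
    nlinarith
  obtain ⟨s, hs⟩ := IsAlgClosed.exists_pow_nat_eq lam (n := 2) (by norm_num)
  have e : lam.re = s.re ^ 2 - s.im ^ 2 := by
    rw [← hs, pow_two, Complex.mul_re]; ring
  rcases lt_trichotomy s.re 0 with h1 | h1 | h1
  · exact key (-s) (by rw [neg_sq, hs]) (by simpa using h1)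
  · rw [h1] at e; nlinarith [sq_nonneg s.im]
  · exact key s hs h1

/-- The leading boundary-layer profile. -/
def layer (s : ℂ) (y : ℝ) : ℂ := s * Complex.exp (-(s * y))

theorem norm_layer (s : ℂ) (y : ℝ) : ‖layer s y‖ = ‖s‖ * Real.exp (-(s.re * y)) := by
  unfold layer
  rw [norm_mul, Complex.norm_exp]
  simp

theorem continuous_layer (s : ℂ) : Continuous (layer s) := by
  unfold layer; fun_prop

theorem hasDerivAt_layer (s : ℂ) (y : ℝ) : HasDerivAt (layer s) (-s * layer s y) y := by
  have h1 : HasDerivAt (fun y : ℝ => -(s * (y : ℂ))) (-(s * 1)) y :=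
    ((hasDerivAt_id y).ofReal_comp.const_mul s).neg
  refine (h1.cexp.const_mul s).congr_deriv ?_
  unfold layer; ring

/-- Once `Re s ≥ 6`, half of the decay of `|layer|²` pays for the polynomial weight. The rest
integrates to `|s|²/Re s`, comparable to `|s|`. Hence `l = |s|^{1/2} = |λ|^{1/4}`, the origin of
that factor in the resolvent bound. -/
theorem memH_layer {s : ℂ} (h6 : 6 ≤ s.re) (hs : ‖s‖ ^ 2 ≤ 2 * s.re ^ 2) {l : ℝ} (hl0 : 0 ≤ l)
    (hl2 : l ^ 2 = ‖s‖) : MemH (layer s) ∧ nrmH (layer s) ≤ 2 * l := by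
  have hpos : 0 < s.re := by linarith
  have hint := integral_pow_mul_exp 0 hpos
  refine memLp_nrm_of_sq_le (G := fun y => ‖s‖ ^ 2 * (y ^ 0 * Real.exp (-(s.re * y)))) ?_
    (hint.1.const_mul _) (fun y hy => ?_) (by positivity) ?_
  · exact ((by fun_prop : Continuous fun y : ℝ => (((1 + y) ^ 3 : ℝ) : ℂ)).mul
      (continuous_layer s)).aestronglyMeasurable
  · rw [norm_mul, norm_layer, Complex.norm_real, Real.norm_of_nonneg (by positivity), pow_zero,
      one_mul]
    have h1 := one_add_pow_le_exp hy.le 6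
    calc ((1 + y) ^ 3 * (‖s‖ * Real.exp (-(s.re * y)))) ^ 2
        = ‖s‖ ^ 2 * ((1 + y) ^ 6 * (Real.exp (-(s.re * y))) ^ 2) := by ring
      _ ≤ ‖s‖ ^ 2 * (Real.exp ((6 : ℕ) * y) * (Real.exp (-(s.re * y))) ^ 2) := by gcongr
      _ = ‖s‖ ^ 2 * Real.exp ((6 - 2 * s.re) * y) := by
          rw [← Real.exp_nat_mul, ← Real.exp_add]; congr 2; push_cast; ring
      _ ≤ _ := by
          gcongr
          nlinarith
  · rw [integral_const_mul, hint.2]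
    simp only [Nat.factorial_zero, Nat.cast_one, zero_add, pow_one]
    have h2 : ‖s‖ ≤ 2 * s.re := by
      refine (sq_le_sq₀ (norm_nonneg _) (by positivity)).1 ?_
      nlinarith [sq_nonneg s.re]
    rw [mul_one_div, div_le_iff₀ hpos, mul_pow, hl2]
    nlinarith [norm_nonneg s]

theorem meanU_layer {s : ℂ} (h : 0 < s.re) : meanU (layer s) = 1 := by
  unfold meanU layer
  have h1 := integral_exp_mul_complex_Ioi (a := -s) (by simpa using h) 0
  have hs : s ≠ 0 := by rintro rfl; simp at h
  rw [integral_const_mul]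
  simp only [neg_mul] at h1
  rw [h1]; simp [hs]

/-- A layer of bounded mass and thickness `1/Re s` has first moment of order `1/Re s`; exactly it is
`|s|/(Re s)²`. -/
theorem integral_mul_layer {s : ℂ} (h : 0 < s.re) (hs : ‖s‖ ^ 2 ≤ 2 * s.re ^ 2) :
    ∫ z in Ioi (0 : ℝ), ‖(z : ℂ) * layer s z‖ ≤ 2 / s.re := by
  have hint := integral_pow_mul_exp 1 h
  have e : ∫ z in Ioi (0 : ℝ), ‖(z : ℂ) * layer s z‖ =
      ∫ z in Ioi (0 : ℝ), ‖s‖ * (z ^ 1 * Real.exp (-(s.re * z))) := by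
    refine setIntegral_congr_fun measurableSet_Ioi fun z hz => ?_
    have hz' : (0 : ℝ) < z := hz
    simp only [norm_mul, norm_layer, Complex.norm_real, Real.norm_of_nonneg hz'.le, pow_one]
    ring
  rw [e, integral_const_mul, hint.2]
  have h2 : ‖s‖ ≤ 2 * s.re := by
    refine (sq_le_sq₀ (norm_nonneg _) (by positivity)).1 ?_
    nlinarith [sq_nonneg s.re]
  simp only [Nat.factorial_one, Nat.cast_one]
  rw [mul_one_div, div_le_div_iff₀ (by positivity) h]
  calc ‖s‖ * s.re ≤ 2 * s.re * s.re := by gcongr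
    _ = _ := by ring

/-- The weight costs `e^{q² y}` after squaring, which half the decay of the layer absorbs as `q² ≤
Re s`. The bound `|V| ≤ C y` then brings in `∫ y² e^{-Re s y} = 2/(Re s)³`. The scalar `c` stands
for `±ik`. -/
theorem memLp_shear_layer {V : ℝ → ℝ} (hV : ContinuousOn V (Ioi 0)) {C : ℝ} (hC0 : 0 ≤ C)
    (hC : ∀ y, 0 ≤ y → |V y| ≤ C * y) {s : ℂ} (h : 0 < s.re) (hs : ‖s‖ ^ 2 ≤ 2 * s.re ^ 2)
    (k : ℝ) {q : ℝ} (hq : 0 < q) (hqs : q ^ 2 ≤ s.re) (c : ℂ) (hc : ‖c‖ = |k|) :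
    MemLp (wdiv (fun y => Real.exp (-(2 * (q ^ 2 / 2) * y))) fun y => c * V y * layer s y) 2 hl ∧
    nrm (wdiv (fun y => Real.exp (-(2 * (q ^ 2 / 2) * y))) fun y => c * V y * layer s y) ≤
      2 * |k| * C / q := by
  have hint := integral_pow_mul_exp 2 h
  refine memLp_nrm_of_sq_le
    (G := fun y => (|k| ^ 2 * C ^ 2 * ‖s‖ ^ 2) * (y ^ 2 * Real.exp (-(s.re * y)))) ?_
    (hint.1.const_mul _) (fun y hy => ?_) (by positivity) ?_
  · refine ContinuousOn.aestronglyMeasurable ?_ measurableSet_Ioi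
    unfold wdiv
    refine ContinuousOn.mul (Continuous.continuousOn ?_) ((continuousOn_const.mul
      (Complex.continuous_ofReal.comp_continuousOn hV)).mul (continuous_layer s).continuousOn)
    refine Complex.continuous_ofReal.comp (Continuous.inv₀ (by fun_prop) fun y => ?_)
    exact (Real.sqrt_pos.2 (Real.exp_pos _)).ne'
  · rw [wdiv_exp, norm_mul, norm_mul, norm_mul, norm_layer, hc, Complex.norm_real, Complex.norm_real,
      Real.norm_of_nonneg (Real.exp_pos _).le, Real.norm_eq_abs]
    have h1 : |V y| ^ 2 ≤ (C * y) ^ 2 := by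
      gcongr
      exact hC y hy.le
    calc (Real.exp (q ^ 2 / 2 * y) * (|k| * |V y| * (‖s‖ * Real.exp (-(s.re * y))))) ^ 2
        = (|k| ^ 2 * ‖s‖ ^ 2) * |V y| ^ 2 *
          (Real.exp (q ^ 2 / 2 * y) ^ 2 * Real.exp (-(s.re * y)) ^ 2) := by ring
      _ ≤ (|k| ^ 2 * ‖s‖ ^ 2) * (C * y) ^ 2 * Real.exp (-(s.re * y)) := by
          gcongr
          rw [← Real.exp_nat_mul, ← Real.exp_nat_mul, ← Real.exp_add, Real.exp_le_exp]
          push_cast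
          nlinarith
      _ = _ := by ring
  · rw [integral_const_mul, hint.2]
    have e : (2 * |k| * C / q) ^ 2 = 4 * (|k| ^ 2 * C ^ 2) / q ^ 2 := by
      field_simp; norm_num; ring
    have e2 : ((Nat.factorial 2 : ℕ) : ℝ) = 2 := by norm_num
    rw [e, e2, mul_div_assoc', div_le_div_iff₀ (by positivity) (by positivity)]
    have hK : 0 ≤ |k| ^ 2 * C ^ 2 := by positivity
    calc |k| ^ 2 * C ^ 2 * ‖s‖ ^ 2 * 2 * q ^ 2 ≤ |k| ^ 2 * C ^ 2 * (2 * s.re ^ 2) * 2 * s.re := by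
          gcongr
      _ = _ := by norm_num; ring

/-- The layer solves `ω'' = s² ω = λ ω`, so the shear term is its entire residual in the local
equation. -/
theorem weakEq_layer (V : ℝ → ℝ) (k : ℝ) {lam s : ℂ} (hs : s ^ 2 = lam) (w : ℝ → ℝ) :
    WeakEq V k lam 0 w (fun y => Complex.I * k * V y * layer s y) (layer s) 0 := by
  intro φ hφ
  obtain ⟨a, b, ha, hz⟩ := hφ.exists_Icc
  have e : ∀ y, (φ y : ℂ) * sysRhs V k lam 0 w (fun y => Complex.I * k * V y * layer s y)
      (layer s) 0 y = (φ y : ℂ) * (lam * layer s y) := fun y => by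
    simp only [sysRhs]; push_cast; ring
  simp only [e]
  have hd := hφ.deriv
  have hd2 := hφ.deriv.deriv
  obtain ⟨a1, b1, ha1, hz1⟩ := hd2.exists_Icc
  have i1 : Integrable (fun y => (φ y : ℂ) * (lam * layer s y)) hl :=
    memLp_one_iff_integrable.1 (memLp_of_continuousOn_compact ha (b := b)
      ((Complex.continuous_ofReal.comp hφ.contDiff.continuous).mul
        (continuous_const.mul (continuous_layer s))).continuousOn
      (fun y hy => by simp [hz y hy]) 1)
  have i2 : Integrable (fun y => ((iteratedDeriv 2 φ y : ℝ) : ℂ) * layer s y) hl := by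
    rw [iteratedDeriv_two]
    exact memLp_one_iff_integrable.1 (memLp_of_continuousOn_compact ha1 (b := b1)
      ((Complex.continuous_ofReal.comp hd2.contDiff.continuous).mul
        (continuous_layer s)).continuousOn
      (fun y hy => by simp [hz1 y hy]) 1)
  have hz' : ∀ y, y ∉ Icc a b → _root_.deriv φ y = 0 := fun y hy => by
    have : φ =ᶠ[𝓝 y] 0 := by
      filter_upwards [isClosed_Icc.isOpen_compl.mem_nhds hy] with z hz2 using hz z hz2
    rw [this.deriv_eq]; simp
  have h0 := integral_deriv_test (P := fun y => ((_root_.deriv φ y : ℝ) : ℂ) * layer s y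
      - (φ y : ℂ) * (-s * layer s y))
    (P' := fun y => ((iteratedDeriv 2 φ y : ℝ) : ℂ) * layer s y - (φ y : ℂ) * (lam * layer s y))
    ha (b := b) (fun y hy => by simp [hz y hy, hz' y hy]) (fun y _ => by
      have h1 := (hd.hasDerivAt y).ofReal_comp.fun_mul (hasDerivAt_layer s y)
      have h2 := (hφ.hasDerivAt y).ofReal_comp.fun_mul ((hasDerivAt_layer s y).const_mul (-s))
      refine (h1.sub h2).congr_deriv ?_
      rw [iteratedDeriv_two, ← hs]; ring) (i2.sub i1)
  rw [integral_sub i2 i1, sub_eq_zero] at h0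
  exact h0.symm

/-- Moment bounds from the exponential weight with rate `θ = q² / 2`. -/
theorem moments_of_exp {q : ℝ} (hq : 0 < q) {R : ℝ → ℂ}
    (h : MemLp (wdiv (fun y => Real.exp (-(2 * (q ^ 2 / 2) * y))) R) 2 hl) :
    ‖meanU R‖ ≤ nrm (wdiv (fun y => Real.exp (-(2 * (q ^ 2 / 2) * y))) R) / q ∧
    ∫ z in Ioi (0 : ℝ), ‖(z : ℂ) * R z‖ ≤
      nrm (wdiv (fun y => Real.exp (-(2 * (q ^ 2 / 2) * y))) R) * 2 / q ^ 3 := by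
  set N := nrm (wdiv (fun y => Real.exp (-(2 * (q ^ 2 / 2) * y))) R)
  have hN : 0 ≤ N := nrm_nonneg _
  have hq2 : 0 < q ^ 2 := by positivity
  have hmeas : ∀ n : ℕ, AEStronglyMeasurable
      (fun y : ℝ => ((y ^ n * Real.exp (-(q ^ 2 / 2 * y)) : ℝ) : ℂ)) hl := fun n =>
    (by fun_prop : Continuous fun y : ℝ =>
      ((y ^ n * Real.exp (-(q ^ 2 / 2 * y)) : ℝ) : ℂ)).aestronglyMeasurable
  have hsq : ∀ n : ℕ, ∀ y : ℝ, 0 < y → ‖((y ^ n * Real.exp (-(q ^ 2 / 2 * y)) : ℝ) : ℂ)‖ ^ 2 ≤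
      y ^ (2 * n) * Real.exp (-(q ^ 2 * y)) := fun n y hy => by
    rw [Complex.norm_real, Real.norm_eq_abs, sq_abs, mul_pow, ← Real.exp_nat_mul, ← pow_mul,
      mul_comm n 2]
    refine le_of_eq ?_
    congr 2; push_cast; ring
  -- Both moments come from Cauchy–Schwarz between `e^{q²y/2} R` and `yⁿ e^{-q²y/2}`, with `n = 0`
  -- and `n = 1`.
  have hmul : ∀ n : ℕ, ∀ y : ℝ, 0 < y → ‖(y : ℂ) ^ n * R y‖ =
      ‖wdiv (fun y => Real.exp (-(2 * (q ^ 2 / 2) * y))) R y‖ *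
      ‖((y ^ n * Real.exp (-(q ^ 2 / 2 * y)) : ℝ) : ℂ)‖ := fun n y hy => by
    rw [wdiv_exp, ← norm_mul]
    congr 1
    have e : ((Real.exp (q ^ 2 / 2 * y) : ℝ) : ℂ) * ((Real.exp (-(q ^ 2 / 2 * y)) : ℝ) : ℂ) = 1 := by
      rw [← Complex.ofReal_mul, ← Real.exp_add]; simp
    rw [Complex.ofReal_mul, Complex.ofReal_pow]
    linear_combination -((y : ℂ) ^ n * R y) * e
  constructor
  · obtain ⟨hi, he⟩ := integral_pow_mul_exp 0 hq2
    obtain ⟨m, hm⟩ := memLp_nrm_of_sq_le (hmeas 0) hi (hsq 0) (c := 1 / q) (by positivity) (by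
      rw [he]; simp)
    calc ‖meanU R‖ ≤ ∫ y in Ioi (0 : ℝ), ‖R y‖ := norm_integral_le_integral_norm _
      _ = ∫ y in Ioi (0 : ℝ), ‖wdiv (fun y => Real.exp (-(2 * (q ^ 2 / 2) * y))) R y‖ *
          ‖((y ^ 0 * Real.exp (-(q ^ 2 / 2 * y)) : ℝ) : ℂ)‖ := by
        refine setIntegral_congr_fun measurableSet_Ioi fun y hy => ?_
        have := hmul 0 y hy
        rwa [pow_zero, one_mul] at this
      _ ≤ N * nrm _ := integral_mul_le_nrm h m
      _ ≤ N * (1 / q) := by gcongr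
      _ = N / q := by ring
  · obtain ⟨hi, he⟩ := integral_pow_mul_exp 2 hq2
    obtain ⟨m, hm⟩ := memLp_nrm_of_sq_le (hmeas 1) hi (hsq 1) (c := 2 / q ^ 3) (by positivity) (by
      rw [he, div_pow]
      simp only [Nat.factorial]
      rw [div_le_div_iff₀ (by positivity) (by positivity)]
      push_cast
      have : 0 < q ^ 6 := by positivity
      nlinarith)
    have e : ∫ z in Ioi (0 : ℝ), ‖(z : ℂ) * R z‖ =
        ∫ y in Ioi (0 : ℝ), ‖wdiv (fun y => Real.exp (-(2 * (q ^ 2 / 2) * y))) R y‖ *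
          ‖((y ^ 1 * Real.exp (-(q ^ 2 / 2 * y)) : ℝ) : ℂ)‖ := by
      refine setIntegral_congr_fun measurableSet_Ioi fun y hy => ?_
      have := hmul 1 y hy
      rwa [pow_one] at this
    rw [e]
    calc _ ≤ N * nrm _ := integral_mul_le_nrm h m
      _ ≤ N * (2 / q ^ 3) := by gcongr
      _ = _ := by ring

/-! ### The homogeneous boundary-layer solution -/

set_option maxHeartbeats 800000 in
/-- The boundary-layer solution of the homogeneous system whose mean defect is close to `1`. -/
theorem exists_homogeneous {U : ℝ → ℝ} (hU : IsShearProfile U) :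
    ∃ δ C q₀ : ℝ, 0 < δ ∧ 0 < C ∧ 1 ≤ q₀ ∧ ∀ (k : ℝ) (lam : ℂ) (q : ℝ), q₀ ≤ q →
      q ^ 4 = lam.re → |k| ≤ δ * q ^ 6 → ∃ (Ω : ℝ → ℂ) (A : ℂ),
        IsSys U k lam (fun _ => 0) 0 Ω A ∧ 1 / 2 ≤ ‖meanU Ω - A‖ ∧
        nrmH Ω ≤ C * ‖lam‖ ^ (1 / 4 : ℝ) ∧ ‖A‖ ≤ C * ‖lam‖ ^ (1 / 4 : ℝ) := by
  obtain ⟨θ, d, hθ, hW⟩ := hU.exists_isWeight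
  obtain ⟨CV, hCV0, hCV⟩ := hU.exists_shear_le
  have hd := hW.nonneg_d
  obtain ⟨Nb, hNb⟩ : ∃ Nb : ℝ, Nb = 2 * (d + 1) * (2 + 8 * CV) := ⟨_, rfl⟩
  have hNb0 : 0 < Nb := by rw [hNb]; positivity
  obtain ⟨Γ, hΓ⟩ : ∃ Γ : ℝ, Γ = 1 + 4 * CV + (d + 1) * Nb := ⟨_, rfl⟩
  have hΓ1 : 1 ≤ Γ := by
    have : 0 ≤ (d + 1) * Nb := by positivity
    linarith
  -- The total deviation of the mean defect from `1` will be at most `δ (Γ - 1)`, so `δ ≤ 1/(2Γ)`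
  -- leaves at least `1/2`. The bound `q ≥ 3 + 2θ` provides `Re s ≥ 6`, an exponential rate at least
  -- `3`, and `2θ² ≤ Re λ`.
  refine ⟨1 / (2 * Γ), 2 + 4 * CV + (d + 1) * Nb, 3 + 2 * θ, by positivity, by positivity,
    by linarith, ?_⟩
  intro k lam q hq hqlam hk
  have hq3 : 3 ≤ q := by linarith
  have hq0 : 0 < q := by linarith
  have hq4 : 2 * θ ^ 2 ≤ q ^ 4 := by
    have h1 : 4 * θ ^ 2 + 9 ≤ q ^ 2 := by nlinarith
    nlinarith [sq_nonneg θ]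
  have hre : 0 < lam.re := by rw [← hqlam]; positivity
  -- The small parameter `|k| / (Re λ)^{3/2}`: every correction below is linear in it up to
  -- constants.
  obtain ⟨δ, hδ⟩ : ∃ δ : ℝ, δ = |k| / q ^ 6 := ⟨_, rfl⟩
  have hδ0 : 0 ≤ δ := by rw [hδ]; positivity
  have hkδ : |k| = δ * q ^ 6 := by rw [hδ]; field_simp
  have hδΓ : δ * Γ ≤ 1 / 2 := by
    have : δ ≤ 1 / (2 * Γ) := by
      rw [hδ, div_le_iff₀ (by positivity)]; exact hk
    calc δ * Γ ≤ 1 / (2 * Γ) * Γ := by gcongr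
      _ = 1 / 2 := by field_simp
  have hδ1 : δ ≤ 1 := by nlinarith
  obtain ⟨s, hs, hs0, hsre, hsn⟩ := exists_sqrt hre
  have hqs : q ^ 2 ≤ s.re := by
    refine (sq_le_sq₀ (by positivity) hs0.le).1 ?_
    calc (q ^ 2) ^ 2 = q ^ 4 := by ring
      _ ≤ _ := by rw [hqlam]; exact hsre
  have hs6 : 6 ≤ s.re := by nlinarith
  set l := ‖lam‖ ^ (1 / 4 : ℝ) with hl'
  have hl0 : 0 ≤ l := by positivity
  have hl4 : l ^ 4 = ‖lam‖ := by
    rw [hl', ← Real.rpow_natCast, ← Real.rpow_mul (norm_nonneg _)]; norm_num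
  have hl2 : l ^ 2 = ‖s‖ := by
    refine (sq_eq_sq₀ (by positivity) (norm_nonneg _)).1 ?_
    rw [← pow_mul, hl4, ← hs, norm_pow]
  have hql : q ≤ l := by
    refine (pow_le_pow_iff_left₀ hq0.le hl0 (by norm_num : 4 ≠ 0)).1 ?_
    rw [hl4, hqlam]; exact (le_abs_self _).trans (Complex.abs_re_le_norm lam)
  have hl1 : 1 ≤ l := by linarith
  -- the leading profile and its local correction
  obtain ⟨hE, hEn⟩ := memH_layer hs6 hsn hl0 hl2
  have hWe : IsWeight (fun y => Real.exp (-(2 * (q ^ 2 / 2) * y))) (q ^ 2 / 2) 1 :=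
    isWeight_exp (by nlinarith)
  obtain ⟨hf1, -⟩ := memLp_shear_layer hU.continuousOn_shear' hCV0 hCV hs0 hsn k hq0 hqs
    (Complex.I * k) (by simp)
  obtain ⟨hf2, hf2n⟩ := memLp_shear_layer hU.continuousOn_shear' hCV0 hCV hs0 hsn k hq0 hqs
    (-(Complex.I * k)) (by simp)
  obtain ⟨R, hR, hRn, hRw⟩ := exists_local_solution hWe hU.continuousOn_shear' k (lam := lam) hre
    (by rw [← hqlam]; nlinarith [sq_nonneg (q ^ 2)]) (negDeriv2 U) hf2
  have hRH := memLp_of_wdiv hWe hR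
  set N := nrm (wdiv (fun y => Real.exp (-(2 * (q ^ 2 / 2) * y))) R) with hNdef
  -- The source has size `|k|/q` and inverting the local operator gains `2/q⁴`, with `|k| = δ q⁶`.
  -- The mean gains a further `1/q` and the first moment `2/q³`.
  have hN : N ≤ 4 * CV * δ * q := by
    refine hRn.trans ?_
    calc 2 / lam.re * nrm _ ≤ 2 / lam.re * (2 * |k| * CV / q) := by gcongr
      _ = 4 * CV * δ * q := by rw [← hqlam, hkδ]; field_simp; norm_num; ring
  obtain ⟨hR1, hR2⟩ := moments_of_exp hq0 hR
  rw [← hNdef] at hR1 hR2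
  have hR1' : ‖meanU R‖ ≤ 4 * CV * δ := by
    refine hR1.trans ?_
    rw [div_le_iff₀ hq0]; exact hN
  have hR2' : ∫ z in Ioi (0 : ℝ), ‖(z : ℂ) * R z‖ ≤ 8 * CV * δ / q ^ 2 := by
    refine hR2.trans ?_
    calc N * 2 / q ^ 3 ≤ (4 * CV * δ * q) * 2 / q ^ 3 := by gcongr
      _ = _ := by field_simp; ring
  have hRn' : nrmH R ≤ 4 * CV * δ * l := by
    refine (nrm_le_of_wdiv hWe hR).trans ?_
    rw [one_mul]
    refine hN.trans ?_
    gcongr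
  have hw := (weakEq_layer (shear U) k hs (negDeriv2 U)).add_smul hU.continuousOn_shear'
    hU.continuousOn_negDeriv2 (memLp_of_wdiv hWe hf1).mom (memLp_of_wdiv hWe hf2).mom
    hE.mom hRH.mom hRw 1
  have hf0 : (fun y => Complex.I * k * shear U y * layer s y +
      1 * (-(Complex.I * k) * shear U y * layer s y)) = fun _ => 0 := by
    ext y; ring
  rw [hf0, mul_zero, add_zero] at hw
  simp only [one_mul] at hw
  -- the nonlocal correction
  have hb : ∫ z in Ioi (0 : ℝ), ‖(z : ℂ) * (layer s z + R z)‖ ≤ (2 + 8 * CV * δ) / q ^ 2 := by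
    have i1 := hE.mom.integrable_mul.norm
    have i2 := hRH.mom.integrable_mul.norm
    calc _ ≤ ∫ z in Ioi (0 : ℝ), (‖(z : ℂ) * layer s z‖ + ‖(z : ℂ) * R z‖) := by
          refine integral_mono (hE.mom.add hRH.mom).integrable_mul.norm (i1.add i2) fun z => ?_
          simp only [mul_add]
          exact norm_add_le _ _
      _ = _ := integral_add i1 i2
      _ ≤ 2 / q ^ 2 + 8 * CV * δ / q ^ 2 := by
          refine add_le_add ((integral_mul_layer hs0 hsn).trans ?_) hR2'
          gcongr
      _ = _ := by ring
  obtain ⟨ω, A, hsys, hωH, hωn, hAn⟩ := exists_nonlocal_correction hU hW k (lam := lam) hre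
    (by rw [← hqlam]; exact hq4) (f := fun _ => 0) 0
    Mom.zero (hE.add hRH) hw hb
  -- The powers balance exactly: `q⁻⁴` from the resolvent, `|k| = δ q⁶`, and `q⁻²` from the first
  -- moment of the layer.
  have hN2 : 2 / lam.re * (|k| * (d + 1) * ((2 + 8 * CV * δ) / q ^ 2) + ‖(0 : ℂ)‖) ≤ δ * Nb := by
    calc _ = δ * (2 * (d + 1) * (2 + 8 * CV * δ)) := by
          rw [norm_zero, ← hqlam, hkδ]; field_simp; ring
      _ ≤ δ * (2 * (d + 1) * (2 + 8 * CV * 1)) := by gcongr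
      _ = δ * Nb := by rw [hNb, mul_one]
  have hωn' : nrmH ω ≤ d * (δ * Nb) := hωn.trans (by gcongr)
  have hAn' : ‖A‖ ≤ δ * Nb := hAn.trans hN2
  refine ⟨_, A, hsys, ?_, ?_, ?_⟩
  · have e1 : meanU (fun y => layer s y + R y + ω y) = 1 + meanU R + meanU ω := by
      rw [meanU_add (hE.mom.add hRH.mom) hωH.mom, meanU_add hE.mom hRH.mom, meanU_layer hs0]
    have h1 : ‖meanU ω‖ ≤ d * (δ * Nb) := (norm_meanU_le hωH.mom).trans (hωH.mom_le.trans hωn')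
    have h2 : ‖-(meanU R + meanU ω - A)‖ ≤ 4 * CV * δ + d * (δ * Nb) + δ * Nb := by
      rw [norm_neg]
      refine (norm_sub_le _ _).trans (add_le_add ((norm_add_le _ _).trans (add_le_add hR1' h1)) hAn')
    have h3 := norm_sub_norm_le (1 : ℂ) (-(meanU R + meanU ω - A))
    rw [e1]
    have e2 : (1 : ℂ) + meanU R + meanU ω - A = 1 - -(meanU R + meanU ω - A) := by ring
    rw [e2]
    rw [norm_one] at h3
    have h4 : 4 * CV * δ + d * (δ * Nb) + δ * Nb ≤ δ * Γ := by
      have e3 : δ * Γ = δ + (4 * CV * δ + d * (δ * Nb) + δ * Nb) := by rw [hΓ]; ring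
      linarith
    linarith
  · refine (nrmH_add_le (hE.add hRH) hωH).trans ?_
    have := nrmH_add_le hE hRH
    have h1 : d * (δ * Nb) ≤ (d * Nb) * l := by
      calc d * (δ * Nb) = d * Nb * δ := by ring
        _ ≤ d * Nb * l := by gcongr; linarith
    have h2 : 4 * CV * δ * l ≤ 4 * CV * l := by
      calc 4 * CV * δ * l = 4 * CV * l * δ := by ring
        _ ≤ 4 * CV * l * 1 := by gcongr
        _ = _ := mul_one _
    have h3 : 0 ≤ Nb * l := by positivity
    have : nrmH (layer s) ≤ 2 * l := hEn
    have e3 : (2 + 4 * CV + (d + 1) * Nb) * l = 2 * l + 4 * CV * l + d * Nb * l + Nb * l := by ring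
    linarith
  · refine hAn'.trans ?_
    calc δ * Nb ≤ 1 * Nb := by gcongr
      _ ≤ (2 + 4 * CV + (d + 1) * Nb) * 1 := by
        have e3 : (d + 1) * Nb = d * Nb + Nb := by ring
        have := mul_nonneg hd hNb0.le
        linarith
      _ ≤ _ := by gcongr

/-! ### Existence with the resolvent estimate -/

/-- A solution of the full system, for arbitrary data, without the mean constraint. -/
theorem exists_sys {U : ℝ → ℝ} (hU : IsShearProfile U) {θ d : ℝ}
    (hW : IsWeight (negDeriv2 U) θ d) {k : ℝ} {lam : ℂ} {κ : ℝ} (hκ : 1 ≤ κ) (hkκ : |k| = κ ^ 3)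
    (h18 : 18 ≤ lam.re) (hc : 2 * θ ^ 2 ≤ lam.re) (hr : κ ^ 2 ≤ lam.re)
    {f : ℝ → ℂ} (hf : MemH f) (a : ℂ) {F : ℝ} (hF1 : nrmH f ≤ F) (hF2 : ‖a‖ ≤ F) :
    ∃ (ω : ℝ → ℂ) (A : ℂ), IsSys U k lam f a ω A ∧
      nrmH ω ≤ (1 + d * (2 * d + 3)) * (κ * F) ∧ ‖A‖ ≤ (2 * d + 3) * (κ * F) := by
  have hd := hW.nonneg_d
  have h0 : 0 < lam.re := by linarith
  have hF0 : 0 ≤ F := (norm_nonneg _).trans hF2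
  have hf' : MemLp (wdiv (fun y => ((1 + y) ^ 6)⁻¹) f) 2 hl := MemLp.ae_eq wdiv_pow.symm hf
  -- The weight `(1 + y)⁻⁶` has `θ = 3`, whence the threshold `18 = 2 · 3²`. Its weighted space is
  -- the vorticity part of `H` itself.
  obtain ⟨ω₀, hω₀, hn₀, hw₀⟩ := exists_local_solution isWeight_pow hU.continuousOn_shear' k h0
    (by linarith) (negDeriv2 U) hf'
  have hH₀ := memLp_of_wdiv isWeight_pow hω₀
  rw [nrm_congr wdiv_pow, nrm_congr wdiv_pow] at hn₀
  change nrmH ω₀ ≤ 2 / lam.re * nrmH f at hn₀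
  have hb : nrmH ω₀ ≤ 2 / lam.re * F := hn₀.trans (by gcongr)
  obtain ⟨ω₁, A, hsys, hH₁, hn₁, hA⟩ := exists_nonlocal_correction hU hW k h0 hc a hf.mom hH₀ hw₀
    ((integral_norm_mul_le_mom hH₀.mom).trans hH₀.mom_le)
  change nrmH ω₁ ≤ d * (2 / lam.re * (|k| * (d + 1) * nrmH ω₀ + ‖a‖)) at hn₁
  change ‖A‖ ≤ 2 / lam.re * (|k| * (d + 1) * nrmH ω₀ + ‖a‖) at hA
  have h2 : 2 / lam.re ≤ 1 := by rw [div_le_one h0]; linarith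
  have hκF : F ≤ κ * F := by nlinarith
  -- Here the factor `|k|^{1/3}` appears: `|k| / Re λ ≤ κ³/κ² = κ`.
  have hkb : |k| * nrmH ω₀ ≤ 2 * (κ * F) := by
    calc |k| * nrmH ω₀ ≤ κ ^ 3 * (2 / lam.re * F) := by rw [hkκ]; gcongr
      _ = 2 * (κ * F) * (κ ^ 2 / lam.re) := by ring
      _ ≤ 2 * (κ * F) * 1 := by
          gcongr
          rw [div_le_one h0]; exact hr
      _ = _ := mul_one _
  have hN : 2 / lam.re * (|k| * (d + 1) * nrmH ω₀ + ‖a‖) ≤ (2 * d + 3) * (κ * F) := by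
    have h3 : |k| * (d + 1) * nrmH ω₀ + ‖a‖ ≤ (2 * d + 3) * (κ * F) := by
      calc |k| * (d + 1) * nrmH ω₀ + ‖a‖ = (d + 1) * (|k| * nrmH ω₀) + ‖a‖ := by ring
        _ ≤ (d + 1) * (2 * (κ * F)) + κ * F := by gcongr; exact hF2.trans hκF
        _ = _ := by ring
    have h4 : 0 ≤ |k| * (d + 1) * nrmH ω₀ + ‖a‖ := by
      have := nrmH_nonneg ω₀
      positivity
    calc _ ≤ 1 * (|k| * (d + 1) * nrmH ω₀ + ‖a‖) := by gcongr
      _ ≤ _ := by rw [one_mul]; exact h3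
  refine ⟨_, A, hsys, ?_, hA.trans hN⟩
  have hb' : nrmH ω₀ ≤ κ * F := by
    refine hb.trans ?_
    calc 2 / lam.re * F ≤ 1 * F := by gcongr
      _ ≤ _ := by rw [one_mul]; exact hκF
  calc _ ≤ nrmH ω₀ + nrmH ω₁ := nrmH_add_le hH₀ hH₁
    _ ≤ κ * F + d * ((2 * d + 3) * (κ * F)) := by
        refine add_le_add hb' (hn₁.trans ?_)
        gcongr
    _ = _ := by ring

theorem norm_meanU_le_nrmH {ω : ℝ → ℂ} (h : MemH ω) : ‖meanU ω‖ ≤ nrmH ω :=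
  (norm_meanU_le h.mom).trans h.mom_le

theorem IsSys.congr_data {U : ℝ → ℝ} {k : ℝ} {lam : ℂ} {f g ω : ℝ → ℂ} {a b A : ℂ}
    (h : IsSys U k lam f a ω A) (hf : f = g) (ha : a = b) : IsSys U k lam g b ω A := by
  subst hf ha; exact h

theorem normH_le_add {ω : ℝ → ℂ} (h : MemH ω) (A : ℂ) : normH ω A ≤ nrmH ω + ‖A‖ := by
  rw [normH_eq h]
  have h1 := nrmH_nonneg ω
  have h2 := norm_nonneg A
  refine (Real.sqrt_le_left (by positivity)).2 ?_
  change nrmH ω ^ 2 + _ ≤ _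
  nlinarith [mul_nonneg h1 h2]

theorem nrmH_le_normH {ω : ℝ → ℂ} (h : MemH ω) (A : ℂ) : nrmH ω ≤ normH ω A := by
  rw [normH_eq h]
  exact Real.le_sqrt_of_sq_le (by change nrmH ω ^ 2 ≤ nrmH ω ^ 2 + _; nlinarith [sq_nonneg ‖A‖])

theorem norm_le_normH {ω : ℝ → ℂ} (h : MemH ω) (A : ℂ) : ‖A‖ ≤ normH ω A := by
  rw [normH_eq h]
  refine Real.le_sqrt_of_sq_le ?_
  change _ ≤ nrmH ω ^ 2 + _
  nlinarith [sq_nonneg (nrmH ω)]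

set_option maxHeartbeats 400000 in
/-- Existence with the resolvent estimate, together with a homogeneous solution with nonzero mean
defect. -/
theorem exists_solution_bound {U : ℝ → ℝ} (hU : IsShearProfile U) {θ : ℝ} :
    ∃ K M : ℝ, 0 < K ∧ 0 < M ∧ ∀ (k : ℝ) (lam : ℂ), 1 ≤ |k| →
      K * |k| ^ (2 / 3 : ℝ) ≤ lam.re → θ ^ 2 < lam.re ∧
      (∃ (Ω : ℝ → ℂ) (B : ℂ), IsSys U k lam (fun _ => 0) 0 Ω B ∧ meanU Ω ≠ B) ∧
      ∀ (f : ℝ → ℂ) (a : ℂ), MemH f → ∃ (ω : ℝ → ℂ) (A : ℂ),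
        IsSys U k lam f a ω A ∧ meanU ω = A ∧
        normH ω A ≤ M * |k| ^ (1 / 3 : ℝ) * ‖lam‖ ^ (1 / 4 : ℝ) * normH f a := by
  obtain ⟨δ, C, q₀, hδ, hC, hq₀, hhom⟩ := exists_homogeneous hU
  obtain ⟨θ', d, -, hW⟩ := hU.exists_isWeight
  have hd := hW.nonneg_d
  obtain ⟨c, hcdef⟩ : ∃ c : ℝ, c = 1 + (1 + d) * (2 * d + 3) := ⟨_, rfl⟩
  have hc0 : 0 < c := by rw [hcdef]; positivity
  -- Each summand secures one requirement: `q ≥ q₀`, smallness of `|k|/q⁶`, the polynomial weight,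
  -- the weight `-U''` in the existence part, and `θ² < Re λ` for the uniqueness part.
  refine ⟨q₀ ^ 4 + 1 / δ + 18 + 2 * θ' ^ 2 + θ ^ 2, 2 * (c * (1 + 2 * C)), by positivity,
    by positivity, fun k lam hk hlam => ?_⟩
  obtain ⟨K, hK⟩ : ∃ K, K = q₀ ^ 4 + 1 / δ + 18 + 2 * θ' ^ 2 + θ ^ 2 := ⟨_, rfl⟩
  rw [← hK] at hlam
  have hδinv : 0 < 1 / δ := by positivity
  have hq4 : 0 < q₀ ^ 4 := by positivity
  have hθ2 := sq_nonneg θ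
  have hθ2' := sq_nonneg θ'
  have hKδ : 1 / δ ≤ K := by linarith
  have hK18 : 18 ≤ K := by linarith
  have hKq : q₀ ^ 4 ≤ K := by linarith
  have hKθ' : 2 * θ' ^ 2 ≤ K := by linarith
  have hKθ : θ ^ 2 < K := by linarith
  set κ := |k| ^ (1 / 3 : ℝ) with hκdef
  have hκ3 : κ ^ 3 = |k| := by
    rw [hκdef, ← Real.rpow_natCast, ← Real.rpow_mul (abs_nonneg k)]; norm_num
  have hκ2 : κ ^ 2 = |k| ^ (2 / 3 : ℝ) := by
    rw [hκdef, ← Real.rpow_natCast, ← Real.rpow_mul (abs_nonneg k)]; norm_num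
  have hκ1 : 1 ≤ κ := Real.one_le_rpow hk (by norm_num)
  have hκsq : 1 ≤ κ ^ 2 := one_le_pow₀ hκ1
  rw [← hκ2] at hlam
  clear_value κ
  have hKre : K ≤ lam.re := (le_mul_of_one_le_right (by linarith) hκsq).trans hlam
  have hκre : κ ^ 2 ≤ lam.re := (le_mul_of_one_le_left (by linarith) (by linarith)).trans hlam
  have hre : 0 < lam.re := by linarith
  set q := lam.re ^ (1 / 4 : ℝ) with hqdef
  have hq0 : 0 ≤ q := by positivity
  have hq : q ^ 4 = lam.re := by
    rw [hqdef, ← Real.rpow_natCast, ← Real.rpow_mul hre.le]; norm_num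
  clear_value q
  have hqq : q₀ ≤ q := by
    refine (pow_le_pow_iff_left₀ (by linarith) hq0 (by norm_num : 4 ≠ 0)).1 ?_
    rw [hq]; linarith
  -- After squaring, the claim is `|k|² ≤ δ² (Re λ)³`, which follows from `Re λ ≥ K κ²`, `δK ≥ 1`
  -- and `K ≥ 1`.
  have hkq : |k| ≤ δ * q ^ 6 := by
    refine (sq_le_sq₀ (abs_nonneg k) (by positivity)).1 ?_
    have h1 : 1 ≤ δ * K := by
      have := mul_le_mul_of_nonneg_left hKδ hδ.le
      rwa [mul_one_div_cancel hδ.ne'] at this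
    have h2 : (δ * q ^ 6) ^ 2 = δ ^ 2 * lam.re ^ 3 := by rw [← hq]; ring
    rw [h2, ← hκ3]
    calc (κ ^ 3) ^ 2 = 1 ^ 2 * 1 * (κ ^ 2) ^ 3 := by ring
      _ ≤ (δ * K) ^ 2 * K * (κ ^ 2) ^ 3 := by gcongr; linarith
      _ = δ ^ 2 * (K * κ ^ 2) ^ 3 := by ring
      _ ≤ _ := by gcongr
  obtain ⟨Ω, B, hΩ, hdef, hΩn, hBn⟩ := hhom k lam q hqq hq hkq
  have hne : meanU Ω - B ≠ 0 := fun h => by rw [h, norm_zero] at hdef; norm_num at hdef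
  refine ⟨by linarith, ⟨Ω, B, hΩ, fun h => hne (sub_eq_zero.2 h)⟩, fun f a hf => ?_⟩
  obtain ⟨F, hFdef⟩ : ∃ F, F = normH f a := ⟨_, rfl⟩
  have hF1 : nrmH f ≤ F := hFdef ▸ nrmH_le_normH hf a
  have hF2 : ‖a‖ ≤ F := hFdef ▸ norm_le_normH hf a
  have hF0 : 0 ≤ F := (norm_nonneg _).trans hF2
  obtain ⟨ω, A, hω, hωn, hAn⟩ := exists_sys hU hW hκ1 hκ3.symm (by linarith) (by linarith)
    hκre hf a hF1 hF2
  set m := A - meanU ω with hm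
  -- The multiple of `Ω` that cancels the mean defect of `ω`; the denominator has modulus at least
  -- `1/2`.
  set α := m / (meanU Ω - B) with hα
  obtain ⟨l, hldef⟩ : ∃ l, l = ‖lam‖ ^ (1 / 4 : ℝ) := ⟨_, rfl⟩
  rw [← hldef] at hΩn hBn
  have hl1 : 1 ≤ l := by
    rw [hldef]
    refine Real.one_le_rpow ?_ (by norm_num)
    have := (le_abs_self _).trans (Complex.abs_re_le_norm lam)
    linarith
  have hκF : 0 ≤ κ * F := by positivity
  have hmn : ‖m‖ ≤ c * (κ * F) := by
    refine (norm_sub_le _ _).trans ?_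
    have h1 := norm_meanU_le_nrmH hω.memH
    have h2 : c * (κ * F) = (2 * d + 3) * (κ * F) + (1 + d * (2 * d + 3)) * (κ * F) := by
      rw [hcdef]; ring
    linarith
  have hαn : ‖α‖ ≤ 2 * (c * (κ * F)) := by
    rw [hα, norm_div, div_le_iff₀ (by linarith)]
    calc ‖m‖ ≤ c * (κ * F) := hmn
      _ = 2 * (c * (κ * F)) * (1 / 2) := by ring
      _ ≤ _ := by gcongr
  have hb1 : nrmH (fun y => ω y + α * Ω y) ≤ c * (1 + 2 * C) * (κ * l * F) := by
    refine (nrmH_add_le hω.memH (hΩ.memH.const_mul α)).trans ?_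
    rw [nrmH_const_mul]
    have h0 := nrmH_nonneg Ω
    have h1 : ‖α‖ * nrmH Ω ≤ 2 * (c * (κ * F)) * (C * l) := by gcongr
    have h2 : (1 + d * (2 * d + 3)) * (κ * F) ≤ c * (κ * F) * l := by
      have : (1 + d * (2 * d + 3)) ≤ c := by
        rw [hcdef]
        linarith [show (1 + d) * (2 * d + 3) = 2 * (d * d) + 5 * d + 3 by ring,
          show d * (2 * d + 3) = 2 * (d * d) + 3 * d by ring, mul_nonneg hd hd]
      calc _ ≤ c * (κ * F) * 1 := by rw [mul_one]; gcongr
        _ ≤ _ := by gcongr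
    calc _ ≤ c * (κ * F) * l + 2 * (c * (κ * F)) * (C * l) := add_le_add (hωn.trans h2) h1
      _ = _ := by ring
  have hb2 : ‖A + α * B‖ ≤ c * (1 + 2 * C) * (κ * l * F) := by
    refine (norm_add_le _ _).trans ?_
    rw [norm_mul]
    have h1 : ‖α‖ * ‖B‖ ≤ 2 * (c * (κ * F)) * (C * l) := by gcongr
    have h2 : (2 * d + 3) * (κ * F) ≤ c * (κ * F) * l := by
      have : (2 * d + 3) ≤ c := by
        rw [hcdef]
        linarith [show (1 + d) * (2 * d + 3) = 2 * (d * d) + 5 * d + 3 by ring,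
          show d * (2 * d + 3) = 2 * (d * d) + 3 * d by ring, mul_nonneg hd hd]
      calc _ ≤ c * (κ * F) * 1 := by rw [mul_one]; gcongr
        _ ≤ _ := by gcongr
    calc _ ≤ c * (κ * F) * l + 2 * (c * (κ * F)) * (C * l) := add_le_add (hAn.trans h2) h1
      _ = _ := by ring
  refine ⟨fun y => ω y + α * Ω y, A + α * B,
    (hω.add_smul hU hf.mom Mom.zero hΩ α).congr_data (by simp) (by simp), ?_, ?_⟩
  · rw [meanU_add hω.memH.mom (hΩ.memH.mom.const_mul α), meanU_const_mul]
    have : α * (meanU Ω - B) = m := div_mul_cancel₀ _ hne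
    rw [hm] at this
    linear_combination this
  · refine (normH_le_add (hω.memH.add (hΩ.memH.const_mul α)) _).trans ?_
    rw [← hldef, ← hFdef]
    calc _ ≤ c * (1 + 2 * C) * (κ * l * F) + c * (1 + 2 * C) * (κ * l * F) := add_le_add hb1 hb2
      _ = _ := by ring

/-! ### Decaying antiderivatives and regularity of weak solutions -/

/-- `∫_y^∞ f`, extended to all of `ℝ` with `f` set to zero on the negative axis. -/
def tailInt (f : ℝ → ℂ) (y : ℝ) : ℂ :=
  (∫ z in Ioi (0 : ℝ), f z) - ∫ z in (0 : ℝ)..y, (Ioi (0 : ℝ)).indicator f z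

theorem integrable_indicator_hl {f : ℝ → ℂ} (hf : Integrable f hl) :
    Integrable ((Ioi (0 : ℝ)).indicator f) := (integrable_indicator_iff measurableSet_Ioi).2 hf

theorem continuous_tailInt {f : ℝ → ℂ} (hf : Integrable f hl) : Continuous (tailInt f) :=
  continuous_const.sub (intervalIntegral.continuous_primitive
    (fun _ _ => (integrable_indicator_hl hf).intervalIntegrable) 0)

theorem tailInt_eq {f : ℝ → ℂ} (hf : Integrable f hl) {y : ℝ} (hy : 0 ≤ y) :
    tailInt f y = ∫ z in Ioi y, f z := by
  have h1 : ∫ z in (0 : ℝ)..y, (Ioi (0 : ℝ)).indicator f z = ∫ z in Ioc 0 y, f z := by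
    rw [intervalIntegral.integral_of_le hy]
    exact setIntegral_congr_fun measurableSet_Ioc fun z hz => indicator_of_mem hz.1 f
  have h2 : Ioi (0 : ℝ) = Ioc 0 y ∪ Ioi y := (Ioc_union_Ioi_eq_Ioi hy).symm
  have hf' : IntegrableOn f (Ioi 0) := hf
  unfold tailInt
  rw [h1, h2, setIntegral_union (Ioc_disjoint_Ioi le_rfl) measurableSet_Ioi
    (hf'.mono_set Ioc_subset_Ioi_self) (hf'.mono_set (Ioi_subset_Ioi hy))]
  ring

theorem hasDerivAt_tailInt {f : ℝ → ℂ} (hf : Integrable f hl) (hc : ContinuousOn f (Ioi 0)) {y : ℝ}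
    (hy : 0 < y) : HasDerivAt (tailInt f) (-f y) y := by
  have hfi := integrable_indicator_hl hf
  have he : (Ioi (0 : ℝ)).indicator f =ᶠ[𝓝 y] f := by
    filter_upwards [Ioi_mem_nhds hy] with z hz using indicator_of_mem hz f
  have h1 : ContinuousAt ((Ioi (0 : ℝ)).indicator f) y :=
    (hc.continuousAt (Ioi_mem_nhds hy)).congr he.symm
  have h2 := intervalIntegral.integral_hasDerivAt_right (a := 0) (b := y) hfi.intervalIntegrable
    hfi.1.stronglyMeasurableAtFilter h1
  rw [he.eq_of_nhds] at h2
  exact h2.const_sub _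

theorem tendsto_tailInt {f : ℝ → ℂ} (hf : Integrable f hl) :
    Tendsto (tailInt f) atTop (𝓝 0) := by
  have hfi := integrable_indicator_hl hf
  have h1 := intervalIntegral_tendsto_integral_Ioi (μ := volume) 0 hfi.integrableOn tendsto_id
  have h2 : ∫ z in Ioi (0 : ℝ), (Ioi (0 : ℝ)).indicator f z = ∫ z in Ioi (0 : ℝ), f z :=
    setIntegral_congr_fun measurableSet_Ioi fun z hz => indicator_of_mem hz f
  rw [h2] at h1
  have h3 := h1.const_sub (∫ z in Ioi (0 : ℝ), f z)
  rw [sub_self] at h3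
  exact h3

/-- The decaying second antiderivative `∫_y^∞ (z - y) F(z) dz`. -/
def doubleTail (F : ℝ → ℂ) (y : ℝ) : ℂ :=
  tailInt (fun z : ℝ => (z : ℂ) * F z) y - y * tailInt F y

theorem continuous_doubleTail {F : ℝ → ℂ} (hF : Mom F) : Continuous (doubleTail F) :=
  (continuous_tailInt hF.integrable_mul).sub
    (Complex.continuous_ofReal.mul (continuous_tailInt hF.integrable))

theorem hasDerivAt_doubleTail {F : ℝ → ℂ} (hF : Mom F) (hc : ContinuousOn F (Ioi 0)) {y : ℝ}
    (hy : 0 < y) : HasDerivAt (doubleTail F) (-tailInt F y) y := by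
  have h1 := hasDerivAt_tailInt hF.integrable_mul
    (Complex.continuous_ofReal.continuousOn.mul hc) hy
  have h2 := ((hasDerivAt_id y).ofReal_comp).fun_mul (hasDerivAt_tailInt hF.integrable hc hy)
  refine (h1.sub h2).congr_deriv ?_
  simp only [id]
  push_cast
  ring

theorem Mom.integrable_max {F : ℝ → ℂ} (hF : Mom F) {y : ℝ} (hy : 0 ≤ y) :
    Integrable (fun z : ℝ => ((max (z - y) 0 : ℝ) : ℂ) * F z) hl := by
  refine hF.integrable_mul_bounded (C := 1)
    (by fun_prop : Continuous fun z : ℝ => ((max (z - y) 0 : ℝ) : ℂ)).aestronglyMeasurable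
    fun z hz => ?_
  rw [Complex.norm_real, Real.norm_of_nonneg (le_max_right _ _)]
  exact max_le (by linarith) (by linarith)

theorem doubleTail_eq {F : ℝ → ℂ} (hF : Mom F) {y : ℝ} (hy : 0 ≤ y) :
    doubleTail F y = ∫ z in Ioi (0 : ℝ), ((max (z - y) 0 : ℝ) : ℂ) * F z := by
  have hi1 : IntegrableOn (fun z : ℝ => (z : ℂ) * F z) (Ioi y) :=
    IntegrableOn.mono_set (t := Ioi 0) hF.integrable_mul (Ioi_subset_Ioi hy)
  have hi2 : IntegrableOn F (Ioi y) :=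
    IntegrableOn.mono_set (t := Ioi 0) hF.integrable (Ioi_subset_Ioi hy)
  unfold doubleTail
  rw [tailInt_eq hF.integrable_mul hy, tailInt_eq hF.integrable hy, ← integral_const_mul,
    ← integral_sub hi1 (hi2.const_mul _)]
  have h1 : ∫ z in Ioi (0 : ℝ), ((max (z - y) 0 : ℝ) : ℂ) * F z =
      ∫ z in Ioi (0 : ℝ), (Ioi y).indicator (fun z : ℝ => (z : ℂ) * F z - y * F z) z := by
    refine setIntegral_congr_fun measurableSet_Ioi fun z hz => ?_
    by_cases h : y < z
    · rw [indicator_of_mem (show z ∈ Ioi y from h), max_eq_left (by linarith)]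
      push_cast; ring
    · rw [indicator_of_notMem (show z ∉ Ioi y from h), max_eq_right (by linarith)]
      simp
  rw [h1, setIntegral_indicator measurableSet_Ioi, inter_eq_right.2 (Ioi_subset_Ioi hy)]

theorem norm_doubleTail_le {F : ℝ → ℂ} (hF : Mom F) {y : ℝ} (hy : 0 ≤ y) :
    ‖doubleTail F y‖ ≤ mom F := by
  rw [doubleTail_eq hF hy]
  refine (norm_integral_le_integral_norm _).trans ?_
  refine setIntegral_mono_on (hF.integrable_max hy).norm hF.integrable_norm measurableSet_Ioi ?_
  intro z hz
  have hz' : (0 : ℝ) < z := hz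
  rw [norm_mul, Complex.norm_real, Real.norm_of_nonneg (le_max_right _ _)]
  gcongr
  exact max_le (by linarith) (by linarith)

/-- First primitive from `0`. -/
def prim (ψ : ℝ → ℝ) (y : ℝ) : ℝ := ∫ z in (0 : ℝ)..y, ψ z

theorem hasDerivAt_prim {ψ : ℝ → ℝ} (h : Continuous ψ) (y : ℝ) : HasDerivAt (prim ψ) (ψ y) y :=
  intervalIntegral.integral_hasDerivAt_right (h.intervalIntegrable _ _)
    (h.stronglyMeasurableAtFilter _ _) h.continuousAt

/-- Second primitive from `0`. -/
def prim2 (ψ : ℝ → ℝ) (y : ℝ) : ℝ := y * prim ψ y - prim (fun z => z * ψ z) y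

theorem hasDerivAt_prim2 {ψ : ℝ → ℝ} (h : Continuous ψ) (y : ℝ) :
    HasDerivAt (prim2 ψ) (prim ψ y) y := by
  have h1 := (hasDerivAt_id y).fun_mul (hasDerivAt_prim h y)
  have h2 := hasDerivAt_prim (ψ := fun z => z * ψ z) (by fun_prop) y
  refine (h1.sub h2).congr_deriv ?_
  simp

theorem contDiff_of_hasDerivAt {f f' : ℝ → ℝ} (h : ∀ y, HasDerivAt f (f' y) y)
    (hf' : ContDiff ℝ ((⊤ : ℕ∞) : WithTop ℕ∞) f') : ContDiff ℝ ((⊤ : ℕ∞) : WithTop ℕ∞) f := by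
  have e : deriv f = f' := funext fun y => (h y).deriv
  have := (contDiff_succ_iff_deriv (n := ((⊤ : ℕ∞) : WithTop ℕ∞)) (f := f)).2
    ⟨fun y => (h y).differentiableAt, by simp, by rw [e]; exact hf'⟩
  simpa using this

theorem prim_eq_zero {ψ : ℝ → ℝ} {a : ℝ} (ha : 0 < a) (hz : ∀ y, y < a → ψ y = 0) {y : ℝ}
    (hy : y < a) : prim ψ y = 0 := by
  unfold prim
  rw [intervalIntegral.integral_congr (g := fun _ => 0)]
  · simp
  · intro z hz'
    refine hz z ?_
    rcases le_total 0 y with h | h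
    · rw [uIcc_of_le h] at hz'; linarith [hz'.2]
    · rw [uIcc_of_ge h] at hz'; linarith [hz'.2]

theorem abs_prim_le {ψ : ℝ → ℝ} (h : Integrable ψ) (y : ℝ) : |prim ψ y| ≤ ∫ z, |ψ z| := by
  have h1 := intervalIntegral.norm_integral_le_integral_norm_uIoc (f := ψ) (a := 0) (b := y)
    (μ := volume)
  refine h1.trans ?_
  exact setIntegral_le_integral h.norm (ae_of_all _ fun z => abs_nonneg _)

theorem prim2_eq {ψ : ℝ → ℝ} (h : Continuous ψ) {y : ℝ} (hy : 0 ≤ y) :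
    prim2 ψ y = ∫ z in Ioi (0 : ℝ), max (y - z) 0 * ψ z := by
  have h1 : prim2 ψ y = ∫ z in (0 : ℝ)..y, (y - z) * ψ z := by
    unfold prim2 prim
    rw [← intervalIntegral.integral_const_mul, ← intervalIntegral.integral_sub]
    · simp only [sub_mul]
    · exact (by fun_prop : Continuous fun z => y * ψ z).intervalIntegrable _ _
    · exact (by fun_prop : Continuous fun z => z * ψ z).intervalIntegrable _ _
  have h2 : ∫ z in Ioi (0 : ℝ), max (y - z) 0 * ψ z =
      ∫ z in Ioi (0 : ℝ), (Ioc 0 y).indicator (fun z => (y - z) * ψ z) z := by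
    refine setIntegral_congr_fun measurableSet_Ioi fun z hz => ?_
    by_cases h : z ≤ y
    · rw [indicator_of_mem (show z ∈ Ioc 0 y from ⟨hz, h⟩), max_eq_left (by linarith)]
    · rw [indicator_of_notMem (fun hh : z ∈ Ioc 0 y => h hh.2), max_eq_right (by linarith), zero_mul]
  rw [h1, h2, setIntegral_indicator measurableSet_Ioc, inter_eq_right.2 Ioc_subset_Ioi_self,
    intervalIntegral.integral_of_le hy]

/-- Fubini with the kernel `(y - z)₊`: integrating twice from `0` is the transpose of integrating
twice from infinity. -/
theorem integral_prim2_mul {ψ : ℝ → ℝ} (h : IsTest ψ) {F : ℝ → ℂ} (hF : Mom F) :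
    ∫ y in Ioi (0 : ℝ), (prim2 ψ y : ℂ) * F y = ∫ z in Ioi (0 : ℝ), (ψ z : ℂ) * doubleTail F z := by
  have hψi : Integrable (fun z => (ψ z : ℂ)) hl :=
    ((h.contDiff.continuous.integrable_of_hasCompactSupport h.compact).ofReal).restrict
  have hint : Integrable (Function.uncurry fun y z : ℝ =>
      ((max (y - z) 0 : ℝ) : ℂ) * (ψ z : ℂ) * F y) (hl.prod hl) := by
    have hm : AEStronglyMeasurable (Function.uncurry fun y z : ℝ =>
        ((max (y - z) 0 : ℝ) : ℂ) * (ψ z : ℂ) * F y) (hl.prod hl) := by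
      refine AEStronglyMeasurable.mul (AEStronglyMeasurable.mul ?_ ?_) ?_
      · exact (by fun_prop : Continuous fun p : ℝ × ℝ =>
          ((max (p.1 - p.2) 0 : ℝ) : ℂ)).aestronglyMeasurable
      · exact hψi.1.comp_snd
      · exact hF.aestronglyMeasurable.comp_fst
    refine (hF.integrable_mul.mul_prod hψi).mono hm ?_
    rw [Measure.prod_restrict]
    filter_upwards [ae_restrict_mem (measurableSet_Ioi.prod measurableSet_Ioi)] with p hp
    have h1 : (0 : ℝ) < p.1 := hp.1
    have h2 : (0 : ℝ) < p.2 := hp.2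
    simp only [Function.uncurry, norm_mul, Complex.norm_real,
      Real.norm_of_nonneg (le_max_right (p.1 - p.2) 0), Real.norm_of_nonneg h1.le]
    have h3 : max (p.1 - p.2) 0 ≤ p.1 := max_le (by linarith) h1.le
    calc _ = max (p.1 - p.2) 0 * (‖ψ p.2‖ * ‖F p.1‖) := by ring
      _ ≤ p.1 * (‖ψ p.2‖ * ‖F p.1‖) := by gcongr
      _ = _ := by ring
  calc _ = ∫ y in Ioi (0 : ℝ), ∫ z in Ioi (0 : ℝ), ((max (y - z) 0 : ℝ) : ℂ) * (ψ z : ℂ) * F y := by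
        refine setIntegral_congr_fun measurableSet_Ioi fun y hy => ?_
        have hy' : (0 : ℝ) < y := hy
        rw [integral_mul_const, prim2_eq h.contDiff.continuous hy'.le, ← integral_complex_ofReal]
        simp
    _ = ∫ z in Ioi (0 : ℝ), ∫ y in Ioi (0 : ℝ), ((max (y - z) 0 : ℝ) : ℂ) * (ψ z : ℂ) * F y :=
        integral_integral_swap hint
    _ = _ := by
        refine setIntegral_congr_fun measurableSet_Ioi fun z hz => ?_
        have hz' : (0 : ℝ) < z := hz
        rw [doubleTail_eq hF hz'.le, ← integral_const_mul]
        congr 1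
        ext y; ring

/-- Cut-off test functions growing linearly at infinity. -/
theorem exists_cutoff {ψ : ℝ → ℝ} (h : IsTest ψ) :
    ∃ (Φ : ℕ → ℝ → ℝ) (D : ℝ), (∀ n, IsTest (Φ n)) ∧
      (∀ n y, 0 < y → |Φ n y| ≤ D * (1 + y)) ∧
      (∀ n y, 0 < y → |iteratedDeriv 2 (Φ n) y| ≤ D * (1 + y)) ∧
      (∀ y, 0 < y → ∀ᶠ n in atTop, Φ n y = prim2 ψ y) ∧
      (∀ y, 0 < y → ∀ᶠ n in atTop, iteratedDeriv 2 (Φ n) y = ψ y) := by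
  obtain ⟨a, b, ha, hz⟩ := h.exists_Icc
  have hza : ∀ y, y < a → ψ y = 0 := fun y hy => hz y fun hh => absurd hh.1 (not_le.2 hy)
  have hψc := h.contDiff.continuous
  have hψi : Integrable ψ := hψc.integrable_of_hasCompactSupport h.compact
  have hψi' : Integrable fun z => z * ψ z :=
    (continuous_id.mul hψc).integrable_of_hasCompactSupport h.compact.mul_left
  set C0 := ∫ z, |ψ z|
  set C1 := ∫ z, |z * ψ z|
  have hC0 : 0 ≤ C0 := integral_nonneg fun _ => abs_nonneg _
  have hC1 : 0 ≤ C1 := integral_nonneg fun _ => abs_nonneg _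
  have hP : ∀ y, |prim ψ y| ≤ C0 := abs_prim_le hψi
  have hP2 : ∀ y, 0 < y → |prim2 ψ y| ≤ (C0 + C1) * (1 + y) := fun y hy => by
    refine (abs_sub _ _).trans ?_
    have h1 := abs_prim_le hψi' y
    rw [abs_mul, abs_of_pos hy]
    have h2 := mul_le_mul_of_nonneg_left (hP y) hy.le
    nlinarith [mul_nonneg hC1 hy.le]
  have hP2z : ∀ y, y < a → prim2 ψ y = 0 := fun y hy => by
    unfold prim2
    rw [prim_eq_zero ha hza hy, prim_eq_zero ha (fun z hz' => by rw [hza z hz', mul_zero]) hy]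
    ring
  have hsm : ContDiff ℝ ((⊤ : ℕ∞) : WithTop ℕ∞) (prim2 ψ) :=
    contDiff_of_hasDerivAt (hasDerivAt_prim2 hψc)
      (contDiff_of_hasDerivAt (hasDerivAt_prim hψc) h.contDiff)
  let ζ : ContDiffBump (0 : ℝ) := ⟨1, 2, one_pos, by norm_num⟩
  have hζs : ContDiff ℝ ((⊤ : ℕ∞) : WithTop ℕ∞) (ζ : ℝ → ℝ) := ζ.contDiff
  have hζc : HasCompactSupport (ζ : ℝ → ℝ) := ζ.hasCompactSupport
  have hζ1 : ContDiff ℝ ((⊤ : ℕ∞) : WithTop ℕ∞) (deriv (ζ : ℝ → ℝ)) :=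
    ((contDiff_succ_iff_deriv (n := ((⊤ : ℕ∞) : WithTop ℕ∞))).1 (by simpa using hζs)).2.2
  have hζ2 : Continuous (deriv (deriv (ζ : ℝ → ℝ))) := hζ1.continuous_deriv (by simp)
  obtain ⟨B0, hB0⟩ := hζc.exists_bound_of_continuous hζs.continuous
  obtain ⟨B1, hB1⟩ := hζc.deriv.exists_bound_of_continuous hζ1.continuous
  obtain ⟨B2, hB2⟩ := hζc.deriv.deriv.exists_bound_of_continuous hζ2
  obtain ⟨B3, hB3⟩ := h.compact.exists_bound_of_continuous hψc
  have hB0' : 0 ≤ B0 := (norm_nonneg _).trans (hB0 0)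
  have hB1' : 0 ≤ B1 := (norm_nonneg _).trans (hB1 0)
  have hB2' : 0 ≤ B2 := (norm_nonneg _).trans (hB2 0)
  have hB3' : 0 ≤ B3 := (norm_nonneg _).trans (hB3 0)
  have hle : C0 + C1 ≤ C0 + C1 + B3 := by linarith
  have hBle : B0 ≤ B2 + 2 * B1 + B0 := by linarith
  let c : ℕ → ℝ := fun n => ((n : ℝ) + 1)⁻¹
  have hc0 : ∀ n, 0 < c n := fun n => by positivity
  have hc1 : ∀ n, c n ≤ 1 := fun n => inv_le_one_of_one_le₀ (by
    have : (0 : ℝ) ≤ n := Nat.cast_nonneg n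
    linarith)
  -- The second primitive vanishes near the wall but may grow linearly, so it is cut off at scale `n
  -- + 1`. At a fixed point the cutoff is eventually locally constant `1`, which removes every term
  -- with a derivative of `ζ`.
  let Φ : ℕ → ℝ → ℝ := fun n y => ζ (c n * y) * prim2 ψ y
  have hlin : ∀ n y, HasDerivAt (fun y => c n * y) (c n) y := fun n y => by
    simpa using (hasDerivAt_id y).const_mul (c n)
  have hd1 : ∀ n y, HasDerivAt (Φ n)
      (deriv ζ (c n * y) * c n * prim2 ψ y + ζ (c n * y) * prim ψ y) y := fun n y =>
    (((hζs.differentiable (by simp)) (c n * y)).hasDerivAt.comp y (hlin n y)).fun_mul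
      (hasDerivAt_prim2 hψc y)
  have hd2 : ∀ n y, iteratedDeriv 2 (Φ n) y =
      deriv (deriv ζ) (c n * y) * c n ^ 2 * prim2 ψ y + 2 * (deriv ζ (c n * y) * c n * prim ψ y)
        + ζ (c n * y) * ψ y := fun n y => by
    have e1 : deriv (Φ n) = fun y =>
        deriv ζ (c n * y) * c n * prim2 ψ y + ζ (c n * y) * prim ψ y :=
      funext fun y => (hd1 n y).deriv
    rw [iteratedDeriv_two, e1]
    have f1 := (((hζ1.differentiable (by simp)) (c n * y)).hasDerivAt.comp y
      (hlin n y)).mul_const (c n) |>.fun_mul (hasDerivAt_prim2 hψc y)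
    have f2 := (((hζs.differentiable (by simp)) (c n * y)).hasDerivAt.comp y
      (hlin n y)).fun_mul (hasDerivAt_prim hψc y)
    refine ((f1.add f2).deriv).trans ?_
    simp only [Function.comp]
    ring
  have hev : ∀ y : ℝ, 0 < y → ∀ᶠ n in atTop, c n * y < 1 := fun y hy => by
    filter_upwards [eventually_ge_atTop ⌈y⌉₊] with n hn
    have h1 : y ≤ n := (Nat.le_ceil y).trans (by exact_mod_cast hn)
    have h2 : (0 : ℝ) < (n : ℝ) + 1 := by positivity
    change ((n : ℝ) + 1)⁻¹ * y < 1
    rw [inv_mul_lt_iff₀ h2]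
    linarith
  have hone : ∀ x : ℝ, |x| < 1 → (ζ : ℝ → ℝ) =ᶠ[𝓝 x] fun _ => 1 := fun x hx => by
    have : Metric.ball (0 : ℝ) 1 ∈ 𝓝 x := Metric.isOpen_ball.mem_nhds (by simpa using hx)
    filter_upwards [this] with z hz'
    exact ζ.one_of_mem_closedBall (Metric.ball_subset_closedBall hz')
  refine ⟨Φ, (B2 + 2 * B1 + B0) * (C0 + C1 + B3), fun n => ⟨?_, ?_, ?_⟩, fun n y hy => ?_,
    fun n y hy => ?_, fun y hy => ?_, fun y hy => ?_⟩
  · exact (hζs.comp (contDiff_const.mul contDiff_id)).mul hsm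
  · refine HasCompactSupport.intro (K := Icc a (2 / c n)) isCompact_Icc fun y hy => ?_
    by_cases h1 : y < a
    · simp [Φ, hP2z y h1]
    · have h2 : 2 / c n < y := by
        by_contra h2
        exact hy ⟨not_lt.1 h1, not_lt.1 h2⟩
      have h3 : 2 < c n * y := by
        rw [div_lt_iff₀ (hc0 n)] at h2; linarith
      have : ζ (c n * y) = 0 := ζ.zero_of_le_dist (by
        rw [Real.dist_eq, sub_zero]
        exact h3.le.trans (le_abs_self _))
      simp [Φ, this]
  · have h1 : tsupport (Φ n) ⊆ Ici a := by
      refine closure_minimal (fun y hy => ?_) isClosed_Ici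
      by_contra h1
      exact hy (by simp [Φ, hP2z y (not_le.1 h1)])
    exact h1.trans fun y hy => lt_of_lt_of_le ha hy
  · have h1 := hB0 (c n * y)
    rw [Real.norm_eq_abs] at h1
    have h2 := hP2 y hy
    change |ζ (c n * y) * prim2 ψ y| ≤ _
    rw [abs_mul]
    calc _ ≤ B0 * ((C0 + C1) * (1 + y)) := by gcongr
      _ ≤ (B2 + 2 * B1 + B0) * ((C0 + C1 + B3) * (1 + y)) :=
          mul_le_mul hBle (mul_le_mul_of_nonneg_right hle (by linarith)) (by positivity)
            (by positivity)
      _ = _ := by ring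
  · rw [hd2]
    have g0 := hB0 (c n * y)
    have g1 := hB1 (c n * y)
    have g2 := hB2 (c n * y)
    have g3 := hB3 y
    rw [Real.norm_eq_abs] at g0 g1 g2 g3
    have h2 := hP2 y hy
    have hc' := (hc0 n).le
    have t1 : |deriv (deriv ζ) (c n * y) * c n ^ 2 * prim2 ψ y| ≤
        B2 * ((C0 + C1 + B3) * (1 + y)) := by
      rw [abs_mul, abs_mul, abs_of_nonneg (by positivity : 0 ≤ c n ^ 2)]
      calc _ ≤ B2 * 1 * ((C0 + C1) * (1 + y)) := by
            gcongr
            exact pow_le_one₀ hc' (hc1 n)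
        _ ≤ _ := by
            rw [mul_one]
            exact mul_le_mul_of_nonneg_left (mul_le_mul_of_nonneg_right hle (by linarith)) hB2'
    have t2 : |2 * (deriv ζ (c n * y) * c n * prim ψ y)| ≤
        2 * B1 * ((C0 + C1 + B3) * (1 + y)) := by
      rw [abs_mul, abs_mul, abs_mul, abs_two, abs_of_nonneg hc', mul_assoc 2]
      refine mul_le_mul_of_nonneg_left ?_ zero_le_two
      calc _ ≤ B1 * 1 * C0 := by
            gcongr
            · exact hc1 n
            · exact hP y
        _ ≤ B1 * ((C0 + C1 + B3) * (1 + y)) := by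
            rw [mul_one]; gcongr
            nlinarith [mul_nonneg hC0 hy.le, mul_nonneg hC1 hy.le, mul_nonneg hB3' hy.le]
    have t3 : |ζ (c n * y) * ψ y| ≤ B0 * ((C0 + C1 + B3) * (1 + y)) := by
      rw [abs_mul]
      gcongr
      nlinarith [mul_nonneg hC0 hy.le, mul_nonneg hC1 hy.le, mul_nonneg hB3' hy.le]
    refine (abs_add_le _ _).trans ((add_le_add ((abs_add_le _ _).trans (add_le_add t1 t2)) t3).trans
      (le_of_eq ?_))
    ring
  · filter_upwards [hev y hy] with n hn
    have := (hone (c n * y) (by rw [abs_of_pos (mul_pos (hc0 n) hy)]; exact hn)).eq_of_nhds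
    simp [Φ, this]
  · filter_upwards [hev y hy] with n hn
    have e0 := hone (c n * y) (by rw [abs_of_pos (mul_pos (hc0 n) hy)]; exact hn)
    have e1 : deriv ζ =ᶠ[𝓝 (c n * y)] fun _ => 0 := by
      have := e0.deriv
      simpa using this
    have e2 : deriv (deriv ζ) (c n * y) = 0 := by
      rw [e1.deriv_eq]; simp
    rw [hd2, e0.eq_of_nhds, e1.eq_of_nhds, e2]
    ring

/-- A weak solution of `ω'' = F` decaying at infinity is the double tail integral of `F`. -/
theorem ae_eq_doubleTail {ω F : ℝ → ℂ} (hω : Mom ω) (hF : Mom F)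
    (h : ∀ φ : ℝ → ℝ, IsTest φ → ∫ y in Ioi (0 : ℝ), (φ y : ℂ) * F y =
      ∫ y in Ioi (0 : ℝ), ((iteratedDeriv 2 φ y : ℝ) : ℂ) * ω y) :
    ω =ᵐ[hl] doubleTail F := by
  have key : ∀ ψ : ℝ → ℝ, IsTest ψ → ∫ y in Ioi (0 : ℝ), (ψ y : ℂ) * ω y =
      ∫ y in Ioi (0 : ℝ), (ψ y : ℂ) * doubleTail F y := by
    intro ψ hψ
    rw [← integral_prim2_mul hψ hF]
    obtain ⟨Φ, D, hT, hb1, hb2, hl1, hl2⟩ := exists_cutoff hψ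
    -- The linear bounds on the cut-off functions and their second derivatives are integrable
    -- against a function with finite first moment. Passing to the limit excludes an affine term in
    -- `ω`.
    have lim : ∀ {η : ℝ → ℂ}, Mom η → ∀ {g : ℕ → ℝ → ℝ} {g' : ℝ → ℝ}, (∀ n, Continuous (g n)) →
        (∀ n y, 0 < y → |g n y| ≤ D * (1 + y)) → (∀ y, 0 < y → ∀ᶠ n in atTop, g n y = g' y) →
        Tendsto (fun n => ∫ y in Ioi (0 : ℝ), (g n y : ℂ) * η y) atTop
          (𝓝 (∫ y in Ioi (0 : ℝ), (g' y : ℂ) * η y)) := by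
      intro η hη g g' hgc hgb hgl
      refine tendsto_integral_of_dominated_convergence (fun y => D * ((1 + y) * ‖η y‖))
        (fun n => ?_) (hη.integrable_norm.const_mul D) (fun n => ?_) ?_
      · exact (Complex.continuous_ofReal.comp (hgc n)).aestronglyMeasurable.mul
          hη.aestronglyMeasurable
      · filter_upwards [ae_restrict_mem measurableSet_Ioi] with y hy
        rw [norm_mul, Complex.norm_real, Real.norm_eq_abs, ← mul_assoc]
        gcongr
        exact hgb n y hy
      · filter_upwards [ae_restrict_mem measurableSet_Ioi] with y hy
        refine tendsto_const_nhds.congr' ?_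
        filter_upwards [hgl y hy] with n hn
        rw [hn]
    have l1 := lim hF (fun n => (hT n).contDiff.continuous) hb1 hl1
    have l2 := lim hω (g := fun n => iteratedDeriv 2 (Φ n)) (fun n => by
      rw [iteratedDeriv_two]; exact (hT n).deriv.deriv.contDiff.continuous) hb2 hl2
    simp only [fun n => h (Φ n) (hT n)] at l1
    exact tendsto_nhds_unique l2 l1
  have hloc : LocallyIntegrableOn (fun y => ω y - doubleTail F y) (Ioi 0) := by
    refine LocallyIntegrableOn.sub ?_ ?_
    · exact IntegrableOn.locallyIntegrableOn hω.integrable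
    · exact (continuous_doubleTail hF).locallyIntegrable.locallyIntegrableOn _
  have := isOpen_Ioi.ae_eq_zero_of_integral_contDiff_smul_eq_zero (μ := volume) hloc ?_
  · refine (ae_restrict_iff' measurableSet_Ioi).2 ?_
    filter_upwards [this] with y hy hy'
    exact sub_eq_zero.1 (hy hy')
  · intro g g1 g2 g3
    have hg : IsTest g := ⟨g1, g2, g3⟩
    have i1 := hg.integrable hω
    have i2 : Integrable (fun y => (g y : ℂ) * doubleTail F y) hl := by
      obtain ⟨a, b, ha, hz⟩ := hg.exists_Icc
      exact memLp_one_iff_integrable.1 (memLp_of_continuousOn_compact ha (b := b)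
        ((Complex.continuous_ofReal.comp hg.contDiff.continuous).mul
          (continuous_doubleTail hF)).continuousOn (fun y hy => by simp [hz y hy]) 1)
    have e1 : ∫ y, g y • (ω y - doubleTail F y) =
        ∫ y in Ioi (0 : ℝ), g y • (ω y - doubleTail F y) := by
      refine (setIntegral_eq_integral_of_forall_compl_eq_zero fun y hy => ?_).symm
      have : g y = 0 := image_eq_zero_of_notMem_tsupport fun hh => hy (g3 hh)
      rw [this, zero_smul]
    rw [e1]
    simp only [Complex.real_smul, mul_sub]
    rw [integral_sub i1 i2, key g hg, sub_self]

theorem IsWeight.le_sq {v : ℝ → ℝ} {θ d : ℝ} (h : IsWeight v θ d) {y : ℝ} (hy : 0 < y) :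
    v y * (1 + y) ^ 2 ≤ d ^ 2 * ((1 + y) ^ 4)⁻¹ := by
  have h1 := h.bound y hy
  have h2 : (0 : ℝ) < (1 + y) ^ 4 := by positivity
  rw [← div_eq_mul_inv, le_div_iff₀ h2]
  calc _ = v y * (1 + y) ^ 6 := by ring
    _ ≤ _ := h1

/-- The linear growth of `V` costs one power of `1 + y`, and `(1 + y)²|ω| = (1 + y)⁻¹ · (1 + y)³|ω|`
is still integrable. The nonlocal part has `v (1 + y)²`, which decays like `(1 + y)⁻⁴`. -/
theorem MemH.mom_sysRhs {v V : ℝ → ℝ} {θ d C : ℝ} (hv : IsWeight v θ d)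
    (hVc : ContinuousOn V (Ioi 0)) (hV : ∀ y, 0 < y → |V y| ≤ C * y) {ω : ℝ → ℂ} (h : MemH ω)
    (k : ℝ) (lam : ℂ) (κ : ℝ) (A : ℂ) : Mom (sysRhs V k lam κ v (fun _ => 0) ω A) := by
  have hC : 0 ≤ C := by simpa using (abs_nonneg _).trans (hV 1 one_pos)
  have h1 : Mom fun y => (lam + Complex.I * k * V y) * ω y := by
    have i1 := (memLp_inv_pow (n := 1) le_rfl).norm.integrable_mul h.norm
    refine (i1.const_mul (‖lam‖ + |k| * C)).mono' ?_ ?_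
    · refine (by fun_prop : Continuous fun y : ℝ => ((1 + y : ℝ) : ℂ)).aestronglyMeasurable.mul
        (AEStronglyMeasurable.mul ?_ h.aestronglyMeasurable)
      refine ContinuousOn.aestronglyMeasurable ?_ measurableSet_Ioi
      exact continuousOn_const.add
        (continuousOn_const.mul (Complex.continuous_ofReal.comp_continuousOn hVc))
    · filter_upwards [ae_restrict_mem measurableSet_Ioi] with y hy
      have hy' : (0 : ℝ) < y := hy
      have e1 : ‖lam + Complex.I * k * V y‖ ≤ (‖lam‖ + |k| * C) * (1 + y) := by
        refine (norm_add_le _ _).trans ?_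
        rw [norm_mul, norm_mul, Complex.norm_I, one_mul, Complex.norm_real, Complex.norm_real,
          Real.norm_eq_abs, Real.norm_eq_abs]
        have := mul_le_mul_of_nonneg_left (hV y hy') (abs_nonneg k)
        nlinarith [norm_nonneg lam, mul_nonneg (abs_nonneg k) hC, mul_nonneg (norm_nonneg lam) hy'.le]
      simp only [Pi.mul_apply, norm_mul, Complex.norm_real, Real.norm_eq_abs, pow_one]
      rw [abs_of_pos (by positivity : 0 < 1 + y), abs_of_pos (by positivity : 0 < (1 + y)⁻¹),
        abs_of_pos (by positivity : 0 < (1 + y) ^ 3)]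
      calc _ ≤ (1 + y) * (((‖lam‖ + |k| * C) * (1 + y)) * ‖ω y‖) := by gcongr
        _ = _ := by field_simp
  have h2 : Mom fun y => Complex.I * κ * (v y * (greenV ω y + y * A)) := by
    have i1 := (integral_inv_pow (n := 4) (by norm_num)).1
    have i2 : Integrable (fun y : ℝ => ((1 + y) ^ 4)⁻¹) hl := i1
    refine (i2.const_mul (|κ| * (TripleDeck.mom ω + ‖A‖) * d ^ 2)).mono' ?_ ?_
    · refine (by fun_prop : Continuous fun y : ℝ => ((1 + y : ℝ) : ℂ)).aestronglyMeasurable.mul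
        (ContinuousOn.aestronglyMeasurable ?_ measurableSet_Ioi)
      refine continuousOn_const.mul ((Complex.continuous_ofReal.comp_continuousOn hv.continuousOn).mul ?_)
      exact ((continuous_greenV h.mom).add
        (Complex.continuous_ofReal.mul continuous_const)).continuousOn
    · filter_upwards [ae_restrict_mem measurableSet_Ioi] with y hy
      have hy' : (0 : ℝ) < y := hy
      have hm := mom_nonneg ω
      have hvp := hv.pos y hy'
      have e1 : ‖greenV ω y + y * A‖ ≤ (TripleDeck.mom ω + ‖A‖) * (1 + y) := by
        refine (norm_add_le _ _).trans ?_
        rw [norm_mul, Complex.norm_real, Real.norm_of_nonneg hy'.le]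
        nlinarith [norm_greenV_le h.mom y, norm_nonneg A, mul_nonneg hm hy'.le]
      simp only [norm_mul, Complex.norm_real, Real.norm_eq_abs, Complex.norm_I, one_mul]
      rw [abs_of_pos (by positivity : 0 < 1 + y), abs_of_pos hvp]
      calc _ ≤ (1 + y) * (|κ| * (v y * ((TripleDeck.mom ω + ‖A‖) * (1 + y)))) := by gcongr
        _ = |κ| * (TripleDeck.mom ω + ‖A‖) * (v y * (1 + y) ^ 2) := by ring
        _ ≤ |κ| * (TripleDeck.mom ω + ‖A‖) * (d ^ 2 * ((1 + y) ^ 4)⁻¹) := by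
            have := hv.le_sq hy'
            gcongr
        _ = _ := by ring
  have h3 := h1.add h2
  refine Integrable.congr h3 (ae_of_all _ fun y => ?_)
  simp only [sysRhs, sub_zero]

theorem continuousOn_sysRhs {v V : ℝ → ℝ} (hv : ContinuousOn v (Ioi 0))
    (hVc : ContinuousOn V (Ioi 0)) {ω : ℝ → ℂ} (h : Mom ω) (hω : ContinuousOn ω (Ioi 0))
    (k : ℝ) (lam : ℂ) (κ : ℝ) (A : ℂ) :
    ContinuousOn (sysRhs V k lam κ v (fun _ => 0) ω A) (Ioi 0) := by
  refine ContinuousOn.sub (ContinuousOn.add ?_ ?_) continuousOn_const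
  · exact (continuousOn_const.add
        (continuousOn_const.mul (Complex.continuous_ofReal.comp_continuousOn hVc))).mul hω
  · refine continuousOn_const.mul ((Complex.continuous_ofReal.comp_continuousOn hv).mul ?_)
    exact ((continuous_greenV h).add
        (Complex.continuous_ofReal.mul continuous_const)).continuousOn

/-- Solutions have a representative for which the equation holds classically. -/
theorem exists_regular {v V : ℝ → ℝ} {θ d C : ℝ} (hv : IsWeight v θ d)
    (hVc : ContinuousOn V (Ioi 0)) (hV : ∀ y, 0 < y → |V y| ≤ C * y) {ω : ℝ → ℂ} (h : MemH ω)
    {k : ℝ} {lam : ℂ} {κ : ℝ} {A : ℂ} (hw : WeakEq V k lam κ v (fun _ => 0) ω A) :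
    ∃ F : ℝ → ℂ, Mom F ∧ ContinuousOn F (Ioi 0) ∧ ω =ᵐ[hl] doubleTail F ∧
      (∀ y, 0 < y → F y = sysRhs V k lam κ v (fun _ => 0) (doubleTail F) A y) ∧
      ∫ y in Ioi (0 : ℝ), F y = ∫ y in Ioi (0 : ℝ), sysRhs V k lam κ v (fun _ => 0) ω A y := by
  set F₀ := sysRhs V k lam κ v (fun _ => 0) ω A with hF₀
  have hm₀ : Mom F₀ := h.mom_sysRhs hv hVc hV k lam κ A
  have e₀ : ω =ᵐ[hl] doubleTail F₀ := ae_eq_doubleTail h.mom hm₀ hw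
  have hG : Mom (doubleTail F₀) := Integrable.congr h.mom (by
    filter_upwards [e₀] with y hy; rw [hy])
  -- `F₀` is built from the merely measurable `ω`. Inserting the continuous representative changes
  -- it only on a null set and makes it continuous, so the equation then holds at every point.
  set F := sysRhs V k lam κ v (fun _ => 0) (doubleTail F₀) A with hFdef
  have eF : F₀ =ᵐ[hl] F := by
    filter_upwards [e₀] with y hy
    simp only [hF₀, hFdef, sysRhs]
    rw [hy, greenV_congr e₀]
  have hm : Mom F := Integrable.congr hm₀ (by
    filter_upwards [eF] with y hy; rw [hy])
  have eD : ∀ y, 0 ≤ y → doubleTail F₀ y = doubleTail F y := fun y hy => by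
    rw [doubleTail_eq hm₀ hy, doubleTail_eq hm hy]
    refine integral_congr_ae ?_
    filter_upwards [eF] with z hz
    rw [hz]
  have eD' : doubleTail F₀ =ᵐ[hl] doubleTail F := by
    filter_upwards [ae_restrict_mem measurableSet_Ioi] with y hy using eD y (le_of_lt hy)
  refine ⟨F, hm, continuousOn_sysRhs hv.continuousOn hVc hG (continuous_doubleTail hm₀).continuousOn
    k lam κ A, e₀.trans eD', fun y hy => ?_, integral_congr_ae eF.symm⟩
  rw [hFdef]
  simp only [sysRhs]
  rw [← hFdef, ← eD y hy.le, greenV_congr eD']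

/-! ### The weighted energy inequality and uniqueness -/

/-- Since `v/(v + ε) ≤ 1`, the bound does not depend on `ε`. It both gives integrability of the
density and dominates the limit `ε → 0`. -/
theorem norm_energyDensity_le {v : ℝ → ℝ} {θ d : ℝ} (hv : IsWeight v θ d) {F : ℝ → ℂ}
    (hF : Mom F) (hG : Mom (doubleTail F)) {lam : ℂ} (hlam : θ ^ 2 < lam.re) {ε : ℝ} (hε : 0 < ε)
    (k : ℝ) (A : ℂ) {y : ℝ} (hy : 0 < y) :
    ‖((lam.re - θ ^ 2) * (v y + 1)⁻¹ : ℝ) * doubleTail F y +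
      (v y * (v y + ε)⁻¹ : ℝ) * (Complex.I * k * (greenV (doubleTail F) y + y * A))‖ ≤
      ((lam.re - θ ^ 2) * mom F + |k| * (mom (doubleTail F) + ‖A‖)) * (1 + y) := by
  set G := doubleTail F
  have hδ : 0 < lam.re - θ ^ 2 := by linarith
  have hvp := hv.pos y hy
  have b1 : (v y + 1)⁻¹ ≤ 1 := inv_le_one_of_one_le₀ (by linarith)
  have b2 : v y * (v y + ε)⁻¹ ≤ 1 := by
    rw [← div_eq_mul_inv, div_le_one (by positivity)]; linarith
  have b3 : ‖greenV G y + y * A‖ ≤ (mom G + ‖A‖) * (1 + y) := by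
    refine (norm_add_le _ _).trans ?_
    rw [norm_mul, Complex.norm_real, Real.norm_of_nonneg hy.le]
    nlinarith [norm_greenV_le hG y, norm_nonneg A, mul_nonneg (mom_nonneg G) hy.le]
  have b4 := norm_doubleTail_le hF hy.le
  have hmF := mom_nonneg F
  refine (norm_add_le _ _).trans ?_
  rw [norm_mul, norm_mul, norm_mul, norm_mul, Complex.norm_I, one_mul, Complex.norm_real,
    Complex.norm_real, Complex.norm_real, Real.norm_of_nonneg (by positivity),
    Real.norm_of_nonneg (by positivity), Real.norm_eq_abs]
  calc _ ≤ (lam.re - θ ^ 2) * 1 * mom F + 1 * (|k| * ((mom G + ‖A‖) * (1 + y))) := by gcongr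
    _ ≤ _ := by nlinarith [mul_nonneg (mul_nonneg hδ.le hmF) hy.le]

/-- The energy inequality with the weight `1 / v` regularised to `1 / (v + ε)`. -/
theorem energy_le_regularised {v V : ℝ → ℝ} {θ d : ℝ} (hv : IsWeight v θ d) {F : ℝ → ℂ}
    (hF : Mom F) (hc : ContinuousOn F (Ioi 0)) (hG : Mom (doubleTail F)) {k : ℝ} {lam : ℂ} {A : ℂ}
    (he : ∀ y, 0 < y → F y = sysRhs V k lam k v (fun _ => 0) (doubleTail F) A y)
    (h0 : ∫ y in Ioi (0 : ℝ), F y = 0) (hlam : θ ^ 2 < lam.re) {ε : ℝ} (hε : 0 < ε) (hε1 : ε ≤ 1) :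
    (∫ y in Ioi (0 : ℝ), (((lam.re - θ ^ 2) * (v y + 1)⁻¹ : ℝ) * doubleTail F y +
      (v y * (v y + ε)⁻¹ : ℝ) * (Complex.I * k * (greenV (doubleTail F) y + y * A))) *
        starRingEnd ℂ (doubleTail F y)).re ≤ 0 := by
  set G := doubleTail F with hGdef
  set T := tailInt F with hT
  have hGc : Continuous G := continuous_doubleTail hF
  have hTc : Continuous T := continuous_tailInt hF.integrable
  set g : ℝ → ℂ := fun y => ((lam.re - θ ^ 2) * (v y + 1)⁻¹ : ℝ) * G y +
      (v y * (v y + ε)⁻¹ : ℝ) * (Complex.I * k * (greenV G y + y * A)) with hg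
  have hδ : 0 < lam.re - θ ^ 2 := by linarith
  have hm1 : ContinuousOn (fun y => (v y + 1)⁻¹) (Ioi 0) :=
    (hv.continuousOn.add continuousOn_const).inv₀ fun y hy =>
      (add_pos (hv.pos y hy) one_pos).ne'
  have hmε : ContinuousOn (fun y => (v y + ε)⁻¹) (Ioi 0) :=
    (hv.continuousOn.add continuousOn_const).inv₀ fun y hy =>
      (add_pos (hv.pos y hy) hε).ne'
  have hgc : ContinuousOn g (Ioi 0) := by
    refine ContinuousOn.add (ContinuousOn.mul ?_ hGc.continuousOn) (ContinuousOn.mul ?_ ?_)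
    · exact Complex.continuous_ofReal.comp_continuousOn (continuousOn_const.mul hm1)
    · exact Complex.continuous_ofReal.comp_continuousOn (hv.continuousOn.mul hmε)
    · exact (continuous_const.mul ((continuous_greenV hG).add
        (Complex.continuous_ofReal.mul continuous_const))).continuousOn
  have hgb := fun y (hy : 0 < y) => norm_energyDensity_le hv hF hG hlam hε k A hy
  have hQi : Integrable (fun y => g y * starRingEnd ℂ (G y)) hl :=
    hG.conj.integrable_mul_bounded (hgc.aestronglyMeasurable measurableSet_Ioi) hgb
  have hQc : ContinuousOn (fun y => g y * starRingEnd ℂ (G y)) (Ioi 0) :=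
    hgc.mul (Complex.continuous_conj.comp hGc).continuousOn
  obtain ⟨v', hv'c, hv'⟩ := hv.hasDeriv
  -- With `T = -G'`, the first term is the boundary flux `(v + ε)⁻¹ Re(G' Ḡ)` and the second is the
  -- energy beyond `y`. Showing that `S` increases to `0` gives the inequality without assuming that
  -- the weighted norms of `G` and `G'` are finite.
  set S : ℝ → ℝ := fun y => -((v y + ε)⁻¹ * (T y * starRingEnd ℂ (G y)).re) +
    (tailInt (fun y => g y * starRingEnd ℂ (G y)) y).re with hS
  have hSd : ∀ y, 0 < y → ∃ D, HasDerivAt S D y ∧ 0 ≤ D := by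
    intro y hy
    obtain ⟨d1, d1b⟩ := hv' y hy
    have hvp := hv.pos y hy
    have d2 := (d1.add_const ε).fun_inv (by positivity)
    have d3 := hasDerivAt_tailInt hF.integrable hc hy
    have d4 := (hasDerivAt_doubleTail hF hc hy).star
    have d5 := Complex.reCLM.hasFDerivAt.comp_hasDerivAt y (d3.fun_mul d4)
    have d6 := Complex.reCLM.hasFDerivAt.comp_hasDerivAt y (hasDerivAt_tailInt hQi hQc hy)
    have d7 := (d2.fun_mul d5).fun_neg.fun_add d6
    refine ⟨_, d7, ?_⟩
    have hvε : 0 < v y + ε := by positivity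
    obtain ⟨m, hm⟩ : ∃ m, m = (v y + ε)⁻¹ := ⟨_, rfl⟩
    have hm0 : 0 < m := by rw [hm]; positivity
    have hm' : |-v' y / (v y + ε) ^ 2| ≤ 2 * θ * m := by
      have hθ : 0 ≤ 2 * θ * v y := (abs_nonneg _).trans d1b
      rw [abs_div, abs_neg, abs_of_pos (by positivity : 0 < (v y + ε) ^ 2), hm,
        div_le_iff₀ (by positivity)]
      have e1 : 2 * θ * (v y + ε)⁻¹ * (v y + ε) ^ 2 = 2 * θ * (v y + ε) := by
        field_simp
      have hθ' : 0 ≤ θ := by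
        by_contra hh
        nlinarith
      rw [e1]
      nlinarith
    -- Here `ε ≤ 1` enters. Weakening the coercive weight to `(v + 1)⁻¹` makes that part of the
    -- density bounded and free of `ε`.
    have hm1m : (v y + 1)⁻¹ ≤ m := by
      rw [hm]; exact inv_anti₀ hvε (by linarith)
    obtain ⟨W, hW⟩ : ∃ W, W = Complex.I * k * (greenV G y + y * A) := ⟨_, rfl⟩
    have eF : (F y * starRingEnd ℂ (G y)).re =
        lam.re * ‖G y‖ ^ 2 + v y * (W * starRingEnd ℂ (G y)).re := by
      rw [he y hy, hW, ← Complex.normSq_eq_norm_sq, Complex.normSq_apply]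
      simp only [sysRhs, Complex.mul_re, Complex.mul_im, Complex.add_re, Complex.add_im,
        Complex.sub_re, Complex.sub_im, Complex.ofReal_re, Complex.ofReal_im, Complex.I_re,
        Complex.I_im, Complex.conj_re, Complex.conj_im, Complex.zero_re, Complex.zero_im]
      ring
    have eg : (g y * starRingEnd ℂ (G y)).re = (lam.re - θ ^ 2) * (v y + 1)⁻¹ * ‖G y‖ ^ 2 +
        v y * m * (W * starRingEnd ℂ (G y)).re := by
      simp only [hg]
      rw [← hW, ← hm, ← Complex.normSq_eq_norm_sq, Complex.normSq_apply]
      simp only [Complex.mul_re, Complex.mul_im, Complex.add_re, Complex.add_im,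
        Complex.ofReal_re, Complex.ofReal_im, Complex.conj_re, Complex.conj_im]
      ring
    have eT : (T y * starRingEnd ℂ (T y)).re = ‖T y‖ ^ 2 := by
      rw [Complex.mul_conj, Complex.ofReal_re, Complex.normSq_eq_norm_sq]
    have hp : |(T y * starRingEnd ℂ (G y)).re| ≤ ‖T y‖ * ‖G y‖ := by
      refine (Complex.abs_re_le_norm _).trans ?_
      rw [norm_mul, RCLike.norm_conj]
    have hmp : -v' y / (v y + ε) ^ 2 * (T y * starRingEnd ℂ (G y)).re ≤
        2 * θ * m * (‖T y‖ * ‖G y‖) := by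
      refine (le_abs_self _).trans ?_
      rw [abs_mul]
      exact mul_le_mul hm' hp (abs_nonneg _) ((abs_nonneg _).trans hm')
    have hG2 : (lam.re - θ ^ 2) * (v y + 1)⁻¹ * ‖G y‖ ^ 2 ≤ (lam.re - θ ^ 2) * m * ‖G y‖ ^ 2 := by
      gcongr
    -- This square absorbs the derivative of the weight at the cost of `θ²` in the zeroth-order
    -- term.
    have hsq : 0 ≤ m * (‖T y‖ - θ * ‖G y‖) ^ 2 := by positivity
    change 0 ≤ -(-v' y / (v y + ε) ^ 2 * (T y * starRingEnd ℂ (G y)).re + (v y + ε)⁻¹ *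
      (-F y * starRingEnd ℂ (G y) + T y * starRingEnd ℂ (-T y)).re) +
        (-(g y * starRingEnd ℂ (G y))).re
    rw [map_neg, mul_neg, neg_mul, Complex.add_re, Complex.neg_re, Complex.neg_re, Complex.neg_re,
      eF, eg, eT, ← hm]
    nlinarith
  have hmono : MonotoneOn S (Ioi 0) := by
    refine monotoneOn_of_deriv_nonneg (convex_Ioi 0)
      (fun y hy => (hSd y hy).choose_spec.1.continuousAt.continuousWithinAt)
      (fun y hy => ?_) fun y hy => ?_
    · rw [interior_Ioi] at hy
      exact (hSd y hy).choose_spec.1.differentiableAt.differentiableWithinAt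
    · rw [interior_Ioi] at hy
      obtain ⟨D, h1, h2⟩ := hSd y hy
      rw [h1.deriv]; exact h2
  have hPb : ∀ y, 0 < y → |(v y + ε)⁻¹ * (T y * starRingEnd ℂ (G y)).re| ≤ ε⁻¹ * mom F * ‖T y‖ := by
    intro y hy
    have hvp := hv.pos y hy
    have b4 := norm_doubleTail_le hF hy.le
    have hmF := mom_nonneg F
    rw [abs_mul, abs_of_pos (by positivity)]
    have b1 : (v y + ε)⁻¹ ≤ ε⁻¹ := inv_anti₀ hε (by linarith)
    have b2 : |(T y * starRingEnd ℂ (G y)).re| ≤ ‖T y‖ * mom F := by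
      refine (Complex.abs_re_le_norm _).trans ?_
      rw [norm_mul, RCLike.norm_conj]
      gcongr
    calc _ ≤ ε⁻¹ * (‖T y‖ * mom F) := by gcongr
      _ = _ := by ring
  have lim : ∀ {l : Filter ℝ} {c : ℂ}, (∀ᶠ y in l, 0 < y) → Tendsto T l (𝓝 0) →
      Tendsto (tailInt fun y => g y * starRingEnd ℂ (G y)) l (𝓝 c) → Tendsto S l (𝓝 c.re) := by
    intro l c h1 h2 h3
    have h4 : Tendsto (fun y => (v y + ε)⁻¹ * (T y * starRingEnd ℂ (G y)).re) l (𝓝 0) := by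
      refine squeeze_zero_norm' (a := fun y => ε⁻¹ * mom F * ‖T y‖) ?_ ?_
      · filter_upwards [h1] with y hy using hPb y hy
      · simpa using h2.norm.const_mul (ε⁻¹ * mom F)
    have h5 := h4.neg.add ((Complex.continuous_re.tendsto c).comp h3)
    rw [neg_zero, zero_add] at h5
    exact h5
  have lim1 : Tendsto S atTop (𝓝 0) := by
    simpa using lim (c := 0) (eventually_gt_atTop 0) (tendsto_tailInt hF.integrable)
      (tendsto_tailInt hQi)
  have t0 : ∀ f : ℝ → ℂ, tailInt f 0 = ∫ y in Ioi (0 : ℝ), f y := fun f => by simp [tailInt]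
  -- The flux at the wall disappears because `T(0) = ∫ F = 0`, that is, `G'(0) = 0`.
  have lim2 : Tendsto S (𝓝[>] 0) (𝓝 (∫ y in Ioi (0 : ℝ), g y * starRingEnd ℂ (G y)).re) := by
    refine lim self_mem_nhdsWithin ?_ ?_
    · have := (hTc.tendsto 0).mono_left (nhdsWithin_le_nhds (s := Ioi 0))
      rwa [hT, t0, h0] at this
    · have := ((continuous_tailInt hQi).tendsto 0).mono_left (nhdsWithin_le_nhds (s := Ioi 0))
      rwa [t0] at this
  have hS0 : ∀ y, 0 < y → S y ≤ 0 := fun y hy => by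
    refine ge_of_tendsto lim1 ?_
    filter_upwards [eventually_ge_atTop y] with z hz
    exact hmono hy (lt_of_lt_of_le hy hz) hz
  refine le_of_tendsto lim2 ?_
  filter_upwards [self_mem_nhdsWithin] with y hy using hS0 y hy

/-- The energy inequality with weight `1 / v`. -/
theorem energy_le {v V : ℝ → ℝ} {θ d : ℝ} (hv : IsWeight v θ d) {F : ℝ → ℂ}
    (hF : Mom F) (hc : ContinuousOn F (Ioi 0)) (hG : Mom (doubleTail F)) {k : ℝ} {lam : ℂ} {A : ℂ}
    (he : ∀ y, 0 < y → F y = sysRhs V k lam k v (fun _ => 0) (doubleTail F) A y)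
    (h0 : ∫ y in Ioi (0 : ℝ), F y = 0) (hlam : θ ^ 2 < lam.re) :
    (∫ y in Ioi (0 : ℝ), (((lam.re - θ ^ 2) * (v y + 1)⁻¹ : ℝ) * doubleTail F y +
      Complex.I * k * (greenV (doubleTail F) y + y * A)) *
        starRingEnd ℂ (doubleTail F y)).re ≤ 0 := by
  set G := doubleTail F with hGdef
  have hGc : Continuous G := continuous_doubleTail hF
  have hδ : 0 < lam.re - θ ^ 2 := by linarith
  set ε : ℕ → ℝ := fun n => 1 / ((n : ℝ) + 1) with hεdef
  have hε : ∀ n, 0 < ε n := fun n => by positivity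
  have hε1 : ∀ n, ε n ≤ 1 := fun n => by
    rw [hεdef]
    refine div_le_one_of_le₀ ?_ (by positivity)
    linarith [(Nat.cast_nonneg n : (0 : ℝ) ≤ n)]
  have hεl : Tendsto ε atTop (𝓝 0) := tendsto_one_div_add_atTop_nhds_zero_nat
  have hmε : ∀ e : ℝ, 0 < e → ContinuousOn (fun y => (v y + e)⁻¹) (Ioi 0) := fun e h =>
    (hv.continuousOn.add continuousOn_const).inv₀ fun y hy => (add_pos (hv.pos y hy) h).ne'
  -- Dominated convergence as `ε → 0`; the limit restores the exact skew structure, as `v/(v + ε) →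
  -- 1`.
  refine le_of_tendsto ((Complex.continuous_re.tendsto _).comp
    (tendsto_integral_of_dominated_convergence
      (F := fun n y => (((lam.re - θ ^ 2) * (v y + 1)⁻¹ : ℝ) * G y +
        (v y * (v y + ε n)⁻¹ : ℝ) * (Complex.I * k * (greenV G y + y * A))) *
          starRingEnd ℂ (G y))
      (fun y => ((lam.re - θ ^ 2) * mom F + |k| * (mom G + ‖A‖)) * ((1 + y) * ‖G y‖))
      (fun n => ?_) (hG.integrable_norm.const_mul _) (fun n => ?_) ?_))
    (Eventually.of_forall fun n => energy_le_regularised hv hF hc hG he h0 hlam (hε n) (hε1 n))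
  · refine ContinuousOn.aestronglyMeasurable ?_ measurableSet_Ioi
    refine ContinuousOn.mul ?_ (Complex.continuous_conj.comp hGc).continuousOn
    refine ContinuousOn.add (ContinuousOn.mul ?_ hGc.continuousOn) (ContinuousOn.mul ?_ ?_)
    · exact Complex.continuous_ofReal.comp_continuousOn (continuousOn_const.mul (hmε 1 one_pos))
    · exact Complex.continuous_ofReal.comp_continuousOn (hv.continuousOn.mul (hmε _ (hε n)))
    · exact (continuous_const.mul ((continuous_greenV hG).add
        (Complex.continuous_ofReal.mul continuous_const))).continuousOn
  · filter_upwards [ae_restrict_mem measurableSet_Ioi] with y hy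
    rw [norm_mul, RCLike.norm_conj]
    exact (mul_le_mul_of_nonneg_right (norm_energyDensity_le hv hF hG hlam (hε n) k A hy)
      (norm_nonneg _)).trans (le_of_eq (mul_assoc _ _ _))
  · filter_upwards [ae_restrict_mem measurableSet_Ioi] with y hy
    have hvp := hv.pos y hy
    have l1 : Tendsto (fun n => v y * (v y + ε n)⁻¹) atTop (𝓝 1) := by
      have := ((hεl.const_add (v y)).inv₀ (by simpa using hvp.ne')).const_mul (v y)
      rwa [add_zero, mul_inv_cancel₀ hvp.ne'] at this
    have l2 := (Complex.continuous_ofReal.tendsto 1).comp l1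
    have l3 := ((l2.mul_const (Complex.I * k * (greenV G y + y * A))).const_add
      ((((lam.re - θ ^ 2) * (v y + 1)⁻¹ : ℝ) : ℂ) * G y)).mul_const (starRingEnd ℂ (G y))
    rw [Complex.ofReal_one, one_mul] at l3
    exact l3

theorem opV_congr {ω η : ℝ → ℂ} (hω : Mom ω) (hη : Mom η) (h : ω =ᵐ[hl] η) : opV ω = opV η := by
  rw [opV_eq hω, opV_eq hη]
  congr 1
  refine integral_congr_ae ?_
  filter_upwards [h] with z hz
  rw [hz]

theorem re_mul_integral_greenV {G : ℝ → ℂ} (hG : Mom G) (k : ℝ) :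
    (Complex.I * k * ∫ y in Ioi (0 : ℝ), greenV G y * starRingEnd ℂ (G y)).re = 0 := by
  set X := ∫ y in Ioi (0 : ℝ), greenV G y * starRingEnd ℂ (G y) with hX
  have h1 : starRingEnd ℂ X = X := by
    rw [hX, ← integral_conj, greenV_symm hG hG.conj]
    refine integral_congr_ae (ae_of_all _ fun y => ?_)
    simp only [map_mul, Complex.conj_conj, greenV_conj]
    ring
  have h2 := Complex.conj_eq_iff_im.1 h1
  simp [h2]

/-- A homogeneous solution whose vorticity has vanishing normal derivative at the wall is zero. -/
theorem eq_zero_of_integral_eq_zero {U : ℝ → ℝ} (hU : IsShearProfile U) {θ d : ℝ}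
    (hv : IsWeight (negDeriv2 U) θ d) {k : ℝ} {lam : ℂ} (hlam : θ ^ 2 < lam.re) {ω : ℝ → ℂ} {A : ℂ}
    (h : IsSys U k lam (fun _ => 0) 0 ω A)
    (h0 : ∫ y in Ioi (0 : ℝ), sysRhs (shear U) k lam k (negDeriv2 U) (fun _ => 0) ω A y = 0) :
    ω =ᵐ[hl] (fun _ => 0) ∧ A = 0 := by
  obtain ⟨C, -, hC⟩ := hU.exists_shear_le
  obtain ⟨F, hF, hFc, hae, he, hint⟩ := exists_regular hv hU.continuousOn_shear'
    (fun y hy => hC y hy.le) h.memH h.weak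
  have hG : Mom (doubleTail F) := Integrable.congr h.memH.mom (by
    filter_upwards [hae] with y hy; rw [hy])
  have hE := energy_le hv hF hFc hG he (hint.trans h0) hlam
  have hbo : symbolBO k lam * A = Complex.I * k * opV (doubleTail F) := by
    rw [← opV_congr h.memH.mom hG hae, h.bo, add_zero]
  set G := doubleTail F
  have hδ : 0 < lam.re - θ ^ 2 := by linarith
  have hlam0 : 0 < lam.re := (sq_nonneg θ).trans_lt hlam
  have hGc : Continuous G := continuous_doubleTail hF
  have hvp : ∀ y : ℝ, 0 < y → 0 < negDeriv2 U y := hv.pos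
  have hmc : ContinuousOn (fun y => (negDeriv2 U y + 1)⁻¹) (Ioi 0) :=
    (hv.continuousOn.add continuousOn_const).inv₀ fun y hy => (add_pos (hv.pos y hy) one_pos).ne'
  have i1 : Integrable (fun y => (((lam.re - θ ^ 2) * (negDeriv2 U y + 1)⁻¹ : ℝ) * G y) *
      starRingEnd ℂ (G y)) hl := by
    refine hG.conj.integrable_mul_bounded (C := (lam.re - θ ^ 2) * mom F) ?_ fun y hy => ?_
    · exact ((Complex.continuous_ofReal.comp_continuousOn (continuousOn_const.mul hmc)).mul
        hGc.continuousOn).aestronglyMeasurable measurableSet_Ioi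
    · have := hvp y hy
      have hmF := mom_nonneg F
      rw [norm_mul, Complex.norm_real, Real.norm_of_nonneg (by positivity)]
      have b1 : (negDeriv2 U y + 1)⁻¹ ≤ 1 := inv_le_one_of_one_le₀ (by linarith)
      have b2 := norm_doubleTail_le hF hy.le
      calc _ ≤ (lam.re - θ ^ 2) * 1 * mom F := by gcongr
        _ ≤ _ := by nlinarith [mul_nonneg (mul_nonneg hδ.le hmF) hy.le]
  have i2 : Integrable (fun y => greenV G y * starRingEnd ℂ (G y)) hl := hG.conj.integrable_greenV hG
  have i3 : Integrable (fun y : ℝ => (y : ℂ) * starRingEnd ℂ (G y)) hl := hG.conj.integrable_mul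
  have e3 : ∫ y in Ioi (0 : ℝ), (y : ℂ) * starRingEnd ℂ (G y) = -starRingEnd ℂ (opV G) := by
    rw [opV_eq hG, map_neg, neg_neg, ← integral_conj]
    simp
  -- The conjugated Benjamin–Ono equation turns the coupling term into the energy `Re λ |A|²`. The
  -- energy inequality then has two nonnegative terms with sum at most `0`.
  have e4 : (Complex.I * k * A * ∫ y in Ioi (0 : ℝ), (y : ℂ) * starRingEnd ℂ (G y)).re =
      lam.re * ‖A‖ ^ 2 := by
    have := congrArg (starRingEnd ℂ) hbo
    rw [map_mul, map_mul, map_mul, Complex.conj_I, Complex.conj_ofReal] at this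
    have e5 : Complex.I * k * A * -starRingEnd ℂ (opV G) =
        starRingEnd ℂ (symbolBO k lam) * (A * starRingEnd ℂ A) := by
      linear_combination -A * this
    rw [e3, e5, Complex.mul_conj, Complex.re_mul_ofReal, Complex.conj_re, symbolBO_re,
      Complex.normSq_eq_norm_sq]
  have split : ∫ y in Ioi (0 : ℝ), (((lam.re - θ ^ 2) * (negDeriv2 U y + 1)⁻¹ : ℝ) * G y +
      Complex.I * k * (greenV G y + y * A)) * starRingEnd ℂ (G y) =
      ((∫ y in Ioi (0 : ℝ), (lam.re - θ ^ 2) * (negDeriv2 U y + 1)⁻¹ * ‖G y‖ ^ 2 : ℝ) : ℂ) +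
      (Complex.I * k * ∫ y in Ioi (0 : ℝ), greenV G y * starRingEnd ℂ (G y)) +
      (Complex.I * k * A * ∫ y in Ioi (0 : ℝ), (y : ℂ) * starRingEnd ℂ (G y)) := by
    rw [← integral_const_mul, ← integral_const_mul, ← integral_complex_ofReal]
    have e6 : ∀ y, ((((lam.re - θ ^ 2) * (negDeriv2 U y + 1)⁻¹ * ‖G y‖ ^ 2 : ℝ)) : ℂ) =
        (((lam.re - θ ^ 2) * (negDeriv2 U y + 1)⁻¹ : ℝ) * G y) * starRingEnd ℂ (G y) := fun y => by
      rw [mul_assoc (_ : ℂ) (G y), Complex.mul_conj, Complex.normSq_eq_norm_sq]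
      push_cast; ring
    simp only [e6]
    have i12 : Integrable (fun y => (((lam.re - θ ^ 2) * (negDeriv2 U y + 1)⁻¹ : ℝ) * G y) *
        starRingEnd ℂ (G y) + Complex.I * k * (greenV G y * starRingEnd ℂ (G y))) hl :=
      i1.add (i2.const_mul _)
    rw [← integral_add i1 (i2.const_mul _), ← integral_add i12 (i3.const_mul _)]
    refine integral_congr_ae (ae_of_all _ fun y => ?_)
    simp only
    ring
  rw [split, Complex.add_re, Complex.add_re, Complex.ofReal_re, re_mul_integral_greenV hG, e4,
    add_zero] at hE
  have hnn : ∀ y ∈ Ioi (0 : ℝ), 0 ≤ (lam.re - θ ^ 2) * (negDeriv2 U y + 1)⁻¹ * ‖G y‖ ^ 2 :=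
    fun y hy => by
      have := hvp y hy
      positivity
  have hI := setIntegral_nonneg (μ := volume) measurableSet_Ioi hnn
  have hA : A = 0 := by
    have h1 : lam.re * ‖A‖ ^ 2 ≤ 0 := by linarith
    have h2 : ‖A‖ ^ 2 ≤ 0 := by
      by_contra hh
      nlinarith
    exact norm_eq_zero.1 (pow_eq_zero_iff (two_ne_zero) |>.1 (le_antisymm h2 (sq_nonneg _)))
  refine ⟨hae.trans ?_, hA⟩
  have hI0 : ∫ y in Ioi (0 : ℝ), (lam.re - θ ^ 2) * (negDeriv2 U y + 1)⁻¹ * ‖G y‖ ^ 2 = 0 := by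
    refine le_antisymm ?_ hI
    nlinarith [sq_nonneg ‖A‖]
  have ii : Integrable (fun y => (lam.re - θ ^ 2) * (negDeriv2 U y + 1)⁻¹ * ‖G y‖ ^ 2) hl := by
    refine i1.norm.congr ?_
    filter_upwards [ae_restrict_mem measurableSet_Ioi] with y hy
    have := hvp y hy
    rw [norm_mul, norm_mul, RCLike.norm_conj, Complex.norm_real,
      Real.norm_of_nonneg (by positivity)]
    ring
  have hz := (integral_eq_zero_iff_of_nonneg_ae (μ := hl)
    ((ae_restrict_iff' measurableSet_Ioi).2 (ae_of_all _ hnn)) ii).1 hI0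
  filter_upwards [hz, ae_restrict_mem measurableSet_Ioi] with y hy hy0
  have h1 : 0 < (lam.re - θ ^ 2) * (negDeriv2 U y + 1)⁻¹ := by
    have := hvp y hy0
    positivity
  simpa [h1.ne'] using hy

/-- A single homogeneous solution violating the mean constraint forces uniqueness under it. -/
theorem eq_zero_of_meanU_eq {U : ℝ → ℝ} (hU : IsShearProfile U) {θ d : ℝ}
    (hv : IsWeight (negDeriv2 U) θ d) {k : ℝ} {lam : ℂ} (hlam : θ ^ 2 < lam.re)
    {Ω ω : ℝ → ℂ} {A B : ℂ} (hΩ : IsSys U k lam (fun _ => 0) 0 Ω B) (hB : meanU Ω ≠ B)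
    (h : IsSys U k lam (fun _ => 0) 0 ω A) (hA : meanU ω = A) :
    ω =ᵐ[hl] (fun _ => 0) ∧ A = 0 := by
  obtain ⟨C, -, hC⟩ := hU.exists_shear_le
  have hC' : ∀ y : ℝ, 0 < y → |shear U y| ≤ C * y := fun y hy => hC y hy.le
  set R : (ℝ → ℂ) → ℂ → ℝ → ℂ := fun ω A =>
    sysRhs (shear U) k lam k (negDeriv2 U) (fun _ => 0) ω A with hR
  have m1 : Mom (R ω A) := h.memH.mom_sysRhs hv hU.continuousOn_shear' hC' k lam k A
  have m2 : Mom (R Ω B) := hΩ.memH.mom_sysRhs hv hU.continuousOn_shear' hC' k lam k B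
  have hmean : ∀ η : ℝ → ℂ, η =ᵐ[hl] (fun _ => 0) → meanU η = 0 := fun η hη => by
    unfold meanU
    rw [integral_congr_ae hη]
    simp
  have hc2 : ∫ y in Ioi (0 : ℝ), R Ω B y ≠ 0 := fun hz => by
    obtain ⟨z1, z2⟩ := eq_zero_of_integral_eq_zero hU hv hlam hΩ hz
    exact hB (by rw [hmean Ω z1, z2])
  -- This `c` makes the wall derivative of `ω + cΩ` vanish, so the combination is zero by the energy
  -- argument.
  obtain ⟨c, hc⟩ : ∃ c, c = -(∫ y in Ioi (0 : ℝ), R ω A y) / ∫ y in Ioi (0 : ℝ), R Ω B y := ⟨_, rfl⟩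
  have h3 : IsSys U k lam (fun _ => 0) 0 (fun y => ω y + c * Ω y) (A + c * B) :=
    (h.add_smul hU Mom.zero Mom.zero hΩ c).congr_data (by funext y; simp) (by simp)
  have h4 := eq_zero_of_integral_eq_zero hU hv hlam h3 (by
    have e1 : ∀ y, sysRhs (shear U) k lam k (negDeriv2 U) (fun _ => 0) (fun y => ω y + c * Ω y)
        (A + c * B) y = R ω A y + c * R Ω B y := fun y => by
      have := sysRhs_add_smul (shear U) k lam k (negDeriv2 U) (f₁ := fun _ => 0) (f₂ := fun _ => 0)
        h.memH.mom hΩ.memH.mom A B c y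
      simpa using this
    simp only [e1]
    rw [integral_add m1.integrable (m2.integrable.const_mul c), integral_const_mul, hc]
    field_simp
    ring)
  have h5 : meanU ω + c * meanU Ω = 0 := by
    rw [← meanU_const_mul, ← meanU_add h.memH.mom (hΩ.memH.mom.const_mul c)]
    exact hmean _ h4.1
  have h6 : c = 0 := by
    -- Compare the mean of the vanishing combination with its second component: `ω` has no mean
    -- defect, so only that of `Ω` remains.
    have h7 : c * (meanU Ω - B) = 0 := by
      rw [hA] at h5
      linear_combination h5 - h4.2
    exact (mul_eq_zero.1 h7).resolve_right (sub_ne_zero.2 hB)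
  rw [h6] at h4
  simpa using h4

end TripleDeck

end

/-! ### The resolvent theorem -/

theorem proposition2p2 (U : ℝ → ℝ) (hU : TripleDeck.IsShearProfile U) :
    ∃ K k₀ M : ℝ, 0 < K ∧ 0 < k₀ ∧ 0 < M ∧
      ∀ (k : ℝ) (lam : ℂ), k₀ ≤ |k| → K * |k| ^ (2 / 3 : ℝ) ≤ lam.re →
        ∀ (ωi : ℝ → ℂ) (Ai : ℂ), TripleDeck.MemH ωi →
          ∃ (ω : ℝ → ℂ) (A : ℂ),
            TripleDeck.IsSolution U k lam ωi Ai ω A ∧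
            (∀ (ω' : ℝ → ℂ) (A' : ℂ), TripleDeck.IsSolution U k lam ωi Ai ω' A' →
              (∀ᵐ y ∂(volume.restrict (Ioi (0 : ℝ))), ω' y = ω y) ∧ A' = A) ∧
            TripleDeck.normH ω A
              ≤ M * |k| ^ (1 / 3 : ℝ) * ‖lam‖ ^ (1 / 4 : ℝ) * TripleDeck.normH ωi Ai := by
  obtain ⟨θ, d, -, hv⟩ := hU.exists_isWeight
  -- The rate `θ` of the weight is passed in so that `K` also guarantees `θ² < Re λ`, as the
  -- uniqueness argument requires.
  obtain ⟨K, M, hK, hM, H⟩ := TripleDeck.exists_solution_bound hU (θ := θ)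
  refine ⟨K, 1, M, hK, one_pos, hM, fun k lam hk hlam ωi Ai hωi => ?_⟩
  obtain ⟨hθ, ⟨Ω, B, hΩ, hB⟩, hex⟩ := H k lam hk hlam
  obtain ⟨ω, A, hs, hm, hbound⟩ := hex ωi Ai hωi
  refine ⟨ω, A, (TripleDeck.isSolution_iff hU hωi.mom).2 ⟨hs, hm⟩, fun ω' A' h' => ?_, hbound⟩
  obtain ⟨hs', hm'⟩ := (TripleDeck.isSolution_iff hU hωi.mom).1 h'
  have hd : TripleDeck.IsSys U k lam (fun _ => 0) 0 (fun y => ω' y + (-1) * ω y) (A' + (-1) * A) :=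
    (hs'.add_smul hU hωi.mom hωi.mom hs (-1)).congr_data (by funext y; ring) (by ring)
  obtain ⟨z1, z2⟩ := TripleDeck.eq_zero_of_meanU_eq hU hv hθ hΩ hB hd (by
    rw [TripleDeck.meanU_add hs'.memH.mom (hs.memH.mom.const_mul (-1)),
      TripleDeck.meanU_const_mul, hm, hm'])
  refine ⟨?_, by linear_combination z2⟩
  filter_upwards [z1] with y hy
  linear_combination hy
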